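/- Let $N\in\mathbb{Z}_{>0}$ and let $b\in\mathbb{C}$ satisfy $|b|=1$, $\mathrm{Re}\,b>0$, $\mathrm{Im}\,b>0$. Put $\boldsymbol q=e^{\frac{\pi i}{N}(1+b^2)}$, $\tilde{\boldsymbol q}=e^{\frac{\pi i}{N}(1+b^{-2})}$, $c_b=\frac i2(b+b^{-1})$, $\omega''=c_b/\sqrt N$, and for $n\in\mathbb{Z}/N\mathbb{Z}$ and $x\in\mathbb{C}$ let $$\gamma(-x,n)=\prod_{j=0}^{\infty}\frac{1-\boldsymbol q^{2j+1}\exp\left[\frac{2\pi i}{N}(-ibx\sqrt N+n)\right]}{1-\tilde{\boldsymbol q}^{-2j-1}\exp\left[\frac{2\pi i}{N}(-ib^{-1}x\sqrt N-n)\right]}$$ be the level-$N$ quantum dilogarithm. For $\mu_r\in\mathbb{R}$, $m_r\in\mathbb{Z}/N\mathbb{Z}$ and a regulator $\epsilon>0$ let, with $x=\mu/\sqrt N$ and $\lambda=\mu_r/\sqrt N$, $$\psi_r^{\epsilon}(\mu,m)=\exp\left(\tfrac{i\pi m^2}{N}+\tfrac{i\pi m_r^2}{N}+i\pi m_r^2-i\pi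 m-i\pi(x-\omega''+i\epsilon)^2\right)\gamma(-\lambda+x-\omega''+i\epsilon,m-m_r)\,\gamma(\lambda+x-\omega''+i\epsilon,m_r+m),$$ where $\mu\in\mathbb{R}$, $m\in\mathbb{Z}/N\mathbb{Z}$ (the right-hand side depends on $m,m_r$ only modulo $N$). Let $$\langle\psi^\epsilon_r|\psi^\epsilon_{r'}\rangle=\sum_{m\in\mathbb{Z}/N\mathbb{Z}}\int_{\mathbb{R}}d\mu\,\overline{\psi^\epsilon_r(\mu,m)}\,\psi^\epsilon_{r'}(\mu,m),\qquad \rho(\mu_r,m_r)=N^2\left[\sin\left(\tfrac{2\pi}{N}(ib\mu_r+m_r)\right)\sin\left(\tfrac{2\pi}{N}(-ib^{-1}\mu_r+m_r)\right)\right]^{-1}.$$ Let $m_r,m_{r'}\in\mathbb{Z}/N\mathbb{Z}$ and $\mu_{r'}\in\mathbb{R}$, with $\mu_{r'}\neq0$ or $2m_{r'}\not\equiv0\pmod N$ (that is, $\rho(\mu_{r'},m_{r'})$ is finite). Then for $0<\epsilon<\mathrm{Re}(b)/\sqrt N$ the integrals defining $\langle\psi^\epsilon_r|\psi^\epsilon_{r'}\rangle$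 converge absolutely for all $\mu_r\in\mathbb{R}$, the function $\mu_r\mapsto\langle\psi^\epsilon_r|\psi^\epsilon_{r'}\rangle$ defines by integration a tempered distribution on $\mathbb{R}$, and as $\epsilon\to0^+$ one has, in the sense of tempered distributions in $\mu_r$, $$\langle\psi^\epsilon_r|\psi^\epsilon_{r'}\rangle\ \longrightarrow\ \tfrac14\,\rho(\mu_r,m_r)\left[\delta(\mu_r-\mu_{r'})\,\delta_{m_r,m_{r'}}+\delta(\mu_r+\mu_{r'})\,\delta_{m_r,-m_{r'}}\right],$$ where $\delta_{\cdot,\cdot}$ is the Kronecker delta on $\mathbb{Z}/N\mathbb{Z}$. -/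

import Mathlib

open MeasureTheory Filter Topology
open scoped SchwartzMap ComplexConjugate

noncomputable section

namespace QTeich

/-- `q = exp (π i (1 + b²) / N)`. -/
def q (N : ℕ) (b : ℂ) : ℂ :=
  Complex.exp (Real.pi * Complex.I / N * (1 + b ^ 2))

/-- `q̃ = exp (π i (1 + b⁻²) / N)`. -/
def qt (N : ℕ) (b : ℂ) : ℂ :=
  Complex.exp (Real.pi * Complex.I / N * (1 + (b⁻¹) ^ 2))

/-- The level-`N` quantum dilogarithm `D_b(x, n)`. Under the standing assumptions `|b| = 1`,
`Re b > 0`, `Im b > 0` one has `|q| = |q̃⁻¹| < 1`, and both products converge absolutely. The second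
argument is an integer representing a class in `ℤ/N`; see `gam_add_level`, `psi_add_level`. -/
def Db (N : ℕ) (b x : ℂ) (n : ℤ) : ℂ :=
  (∏' j : ℕ, (1 - q N b ^ (2 * j + 1) *
      Complex.exp (2 * Real.pi * Complex.I / N *
        (-Complex.I * b * x * (Real.sqrt N : ℂ) + n)))) /
  (∏' j : ℕ, (1 - (qt N b)⁻¹ ^ (2 * j + 1) *
      Complex.exp (2 * Real.pi * Complex.I / N *
        (-Complex.I * b⁻¹ * x * (Real.sqrt N : ℂ) - n))))

/-- `γ(x, n) = D_b(-x, n)`. -/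
def gam (N : ℕ) (b x : ℂ) (n : ℤ) : ℂ := Db N b (-x) n

/-- `c_b = (i/2)(b + b⁻¹)`. -/
def cb (b : ℂ) : ℂ := Complex.I / 2 * (b + b⁻¹)

/-- `ω'' = c_b / √N`. -/
def om (N : ℕ) (b : ℂ) : ℂ := cb b / (Real.sqrt N : ℂ)

/-- The regularized eigenstate `ψ_r(μ, m)`, where `r` is labelled by `(μr, mr)` and `ε > 0` is the
regulator. With `x = μ/√N`, `lam = μr/√N` and `z = x - ω'' + iε`,
`ψ_r(μ,m) = exp(iπm²/N + iπmr²/N + iπmr² - iπm - iπz²) γ(z - lam, m - mr) γ(z + lam, m + mr)`. -/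
def psi (N : ℕ) (b : ℂ) (ε μr : ℝ) (mr : ℤ) (μ : ℝ) (m : ℤ) : ℂ :=
  let x : ℂ := (μ : ℂ) / (Real.sqrt N : ℂ)
  let lam : ℂ := (μr : ℂ) / (Real.sqrt N : ℂ)
  let z : ℂ := x - om N b + Complex.I * ε
  Complex.exp (Complex.I * Real.pi * (m : ℂ) ^ 2 / N + Complex.I * Real.pi * (mr : ℂ) ^ 2 / N
      + Complex.I * Real.pi * (mr : ℂ) ^ 2 - Complex.I * Real.pi * m - Complex.I * Real.pi * z ^ 2)
    * gam N b (-lam + z) (m - mr) * gam N b (lam + z) (mr + m)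

/-- The inner product `⟨ψ_r | ψ_r'⟩ = ∑_{m ∈ ℤ/N} ∫ dμ ψ_r(μ,m)^* ψ_r'(μ,m)` of `L²(ℝ) ⊗ ℂ^N`, of the
states with regulator `ε`. The classes of `ℤ/N` are represented by `0, …, N - 1`. -/
def innerPsi (N : ℕ) (b : ℂ) (ε μr : ℝ) (mr : ℤ) (μr' : ℝ) (mr' : ℤ) : ℂ :=
  ∑ m ∈ Finset.range N, ∫ μ : ℝ, conj (psi N b ε μr mr μ m) * psi N b ε μr' mr' μ m

/-- `ρ(μr, mr) = N² [sin((2π/N)(i b μr + mr)) sin((2π/N)(-i b⁻¹ μr + mr))]⁻¹`. -/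
def rho (N : ℕ) (b : ℂ) (μr : ℝ) (mr : ℤ) : ℂ :=
  (N : ℂ) ^ 2 *
    (Complex.sin (2 * Real.pi / N * (Complex.I * b * μr + mr)) *
      Complex.sin (2 * Real.pi / N * (-Complex.I * b⁻¹ * μr + mr)))⁻¹

/-- Kronecker delta on `ℤ/N`. -/
def kron (N : ℕ) (m n : ℤ) : ℂ := if m ≡ n [ZMOD N] then 1 else 0

/-- `γ(x, n)` depends on `n` modulo `N` only. -/
theorem gam_add_level (N : ℕ) (hN : 0 < N) (b x : ℂ) (n : ℤ) :
    gam N b x (n + N) = gam N b x n := by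
  have hN' : (N : ℂ) ≠ 0 := by exact_mod_cast hN.ne'
  have h1 : ∀ w : ℂ, Complex.exp (2 * Real.pi * Complex.I / N * (w + ((n + N : ℤ) : ℂ)))
      = Complex.exp (2 * Real.pi * Complex.I / N * (w + n)) := by
    intro w
    rw [show 2 * Real.pi * Complex.I / N * (w + ((n + N : ℤ) : ℂ))
      = 2 * Real.pi * Complex.I / N * (w + n) + 2 * Real.pi * Complex.I by
        push_cast; field_simp; ring, Complex.exp_periodic]
  have h2 : ∀ w : ℂ, Complex.exp (2 * Real.pi * Complex.I / N * (w - ((n + N : ℤ) : ℂ)))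
      = Complex.exp (2 * Real.pi * Complex.I / N * (w - n)) := by
    intro w
    rw [← Complex.exp_periodic (2 * Real.pi * Complex.I / N * (w - ((n + N : ℤ) : ℂ)))]
    congr 1
    push_cast; field_simp; ring
  simp only [gam, Db, h1, h2]

/-- `ψ_r(μ, m)` depends on `m` modulo `N` only. -/
theorem psi_add_level (N : ℕ) (hN : 0 < N) (b : ℂ) (ε μr : ℝ) (mr : ℤ) (μ : ℝ) (m : ℤ) :
    psi N b ε μr mr μ (m + N) = psi N b ε μr mr μ m := by
  have hN' : (N : ℂ) ≠ 0 := by exact_mod_cast hN.ne'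
  have e1 : m + (N : ℤ) - mr = (m - mr) + N := by ring
  have e2 : mr + (m + (N : ℤ)) = (mr + m) + N := by ring
  simp only [psi, e1, e2, gam_add_level N hN]
  congr 2
  rw [Complex.exp_eq_exp_iff_exists_int]
  refine ⟨m, ?_⟩
  push_cast
  field_simp
  ring

/-- `ψ_r(μ, m)` depends on `mr` modulo `N` only. -/
theorem psi_add_level_label (N : ℕ) (hN : 0 < N) (b : ℂ) (ε μr : ℝ) (mr : ℤ) (μ : ℝ) (m : ℤ) :
    psi N b ε μr (mr + N) μ m = psi N b ε μr mr μ m := by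
  have hN' : (N : ℂ) ≠ 0 := by exact_mod_cast hN.ne'
  have e1 : gam N b (-((μr : ℂ) / (Real.sqrt N : ℂ)) +
      ((μ : ℂ) / (Real.sqrt N : ℂ) - om N b + Complex.I * ε)) (m - (mr + N)) =
      gam N b (-((μr : ℂ) / (Real.sqrt N : ℂ)) +
      ((μ : ℂ) / (Real.sqrt N : ℂ) - om N b + Complex.I * ε)) (m - mr) := by
    rw [← gam_add_level N hN _ _ (m - (mr + N))]
    congr 1
    ring
  have e2 : mr + (N : ℤ) + m = (mr + m) + N := by ring
  simp only [psi, e1, e2, gam_add_level N hN]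
  congr 2
  rw [Complex.exp_eq_exp_iff_exists_int]
  obtain ⟨k, hk⟩ : Even ((N : ℤ) * (N + 1)) := Int.even_mul_succ_self _
  have hk' : (N : ℂ) * (N + 1) = k + k := by exact_mod_cast congrArg (Int.cast : ℤ → ℂ) hk
  refine ⟨mr + mr * N + k, ?_⟩
  push_cast
  field_simp
  linear_combination (N : ℂ) * hk'

end QTeich

end

open MeasureTheory Filter Topology
open scoped SchwartzMap ComplexConjugate

noncomputable section

namespace QTeich

/-! Put `w = μ + iε√N`. In this variable `γ` becomes a quotient `hq` of two Pochhammer symbols, and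
`ψ_r` becomes `wave`: a phase, a Gaussian and two dilogarithms centred at `±μ_r`. Continued to the
strip `-Re b < Im w < 2 Re b`, the dilogarithm has at most one pole, a simple one at `w = 0`,
present exactly when `N ∣ n`. Hence an eigenstate is singular only at `±μ_r` on the real axis, and
finiteness of `ρ` prevents the two poles from colliding. The regulator holds the contour just above
them.

Lower the contour to `Im w = -Re b / 4` (`inner_eq`). The poles of the conjugated state have been
pushed upwards and are not met; those of `ψ_{r'}` are crossed. The inner product becomes `innerLow -
2πi resSum`. Here `innerLow` is bounded uniformly in the labels and the regulator, so all
concentration is in the residues. As `μ_r` approaches `μ'` or `-μ'`, both crossed poles contribute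
to the singular behaviour, with conjugate denominators and opposite signs; together they form a
Poisson kernel of width `2ε√N`, up to a bounded error (`exists_resSum_bound`).

For `μ_r ≠ ±μ'` the limit is zero by orthogonality (`innerLow_eq_resSum`). The move `w ↦ w + ib`, `m
↦ m - 1` multiplies an eigenstate by `Λ_r - Λ(w, m)`, and the reflected state obeys the same law
under the inverse move. Summation by parts, that is, translation of the contour by `ib`, gives `(Λ_r
- Λ_{r'}) (innerLow - 2πi resSum) = 0` at zero regulator. The eigenvalues differ whenever `μ_r ≠
±μ'`, whatever the discrete labels.

Thus the inner product minus the Poisson kernels is bounded and tends to zero almost everywhere, and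
dominated convergence removes it. The kernels tend to `π δ`. Their weight is `4π² |residue|² = ρ /
4` (`norm_resP_sq`), which is explicit because on the real axis the dilogarithm is a unimodular
function divided by `1 - exc` (`norm_hh_real`). -/

/-! ### Pochhammer symbols. -/

/-- The infinite `p`-Pochhammer symbol `(t; p)_∞`. -/
def poch (p t : ℂ) : ℂ := ∏' j : ℕ, (1 - p ^ j * t)

theorem summable_norm_pow_mul {p : ℂ} (hp : ‖p‖ < 1) (t : ℂ) :
    Summable fun j : ℕ => ‖-(p ^ j * t)‖ := by
  simpa [norm_neg, norm_mul, norm_pow] using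
    (summable_geometric_of_lt_one (norm_nonneg p) hp).mul_right ‖t‖

theorem multipliable_poch {p : ℂ} (hp : ‖p‖ < 1) (t : ℂ) :
    Multipliable fun j : ℕ => 1 - p ^ j * t := by
  simpa [sub_eq_add_neg] using multipliable_one_add_of_summable (summable_norm_pow_mul hp t)

theorem poch_eq_mul {p : ℂ} (hp : ‖p‖ < 1) (t : ℂ) : poch p t = (1 - t) * poch p (p * t) := by
  have h := tprod_eq_zero_mul' (f := fun j : ℕ => 1 - p ^ j * t)
    (by simpa [pow_succ, mul_assoc] using multipliable_poch hp (p * t))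
  simpa [poch, pow_succ, mul_assoc] using h

theorem poch_ne_zero {p : ℂ} (hp : ‖p‖ < 1) {t : ℂ} (ht : ∀ j : ℕ, p ^ j * t ≠ 1) :
    poch p t ≠ 0 := by
  have := tprod_one_add_ne_zero_of_summable (f := fun j : ℕ => -(p ^ j * t))
    (fun j => by simpa [← sub_eq_add_neg, sub_ne_zero] using (ht j).symm)
    (summable_norm_pow_mul hp t)
  simpa [poch, sub_eq_add_neg] using this

theorem poch_ne_zero_of_norm_lt_one {p : ℂ} (hp : ‖p‖ < 1) {t : ℂ} (ht : ‖t‖ < 1) :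
    poch p t ≠ 0 := by
  refine poch_ne_zero hp fun j h => ?_
  have h1 : ‖p‖ ^ j * ‖t‖ = 1 := by rw [← norm_pow, ← norm_mul, h, norm_one]
  have h2 : ‖p‖ ^ j ≤ 1 := pow_le_one₀ (norm_nonneg _) hp.le
  nlinarith [norm_nonneg t]

theorem conj_poch {p : ℂ} (hp : ‖p‖ < 1) (t : ℂ) : conj (poch p t) = poch (conj p) (conj t) := by
  rw [poch, (multipliable_poch hp t).map_tprod (starRingEnd ℂ) Complex.continuous_conj]
  simp [poch]

theorem differentiable_poch {p : ℂ} (hp : ‖p‖ < 1) : Differentiable ℂ (poch p) := by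
  intro t
  have h := Summable.hasProdLocallyUniformlyOn_nat_one_add (f := fun j t => -(p ^ j * t))
    (K := Metric.ball (0 : ℂ) (‖t‖ + 1)) Metric.isOpen_ball
    ((summable_geometric_of_lt_one (norm_nonneg p) hp).mul_right (‖t‖ + 1))
    (.of_forall fun j x hx => by
      rw [norm_neg, norm_mul, norm_pow]
      have : ‖x‖ < ‖t‖ + 1 := by simpa using hx
      gcongr)
    (fun j => by fun_prop)
  have h2 := h.differentiableOn
    (.of_forall fun _ ↦ by simpa [Finset.prod_fn] using
      DifferentiableOn.finsetProd (fun _ _ ↦ by fun_prop)) Metric.isOpen_ball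
  have h3 := h2.differentiableAt (Metric.isOpen_ball.mem_nhds (x := t) (by simp))
  refine h3.congr_of_eventuallyEq (.of_forall fun x => ?_)
  simp [poch, sub_eq_add_neg]

theorem poch_zero (p : ℂ) : poch p 0 = 1 := by simp [poch]

/-- Near `t = 0` the Pochhammer symbol is close to one. -/
theorem exists_poch_bounds {p : ℂ} (hp : ‖p‖ < 1) :
    ∃ r > 0, ∀ t, ‖t‖ ≤ r → ‖poch p t‖ ≤ 2 ∧ 1 / 2 ≤ ‖poch p t‖ := by
  have hc : ContinuousAt (poch p) 0 := (differentiable_poch hp).continuous.continuousAt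
  obtain ⟨r, hr, h⟩ := Metric.continuousAt_iff.mp hc (1 / 2) (by norm_num)
  refine ⟨r / 2, by positivity, fun t ht => ?_⟩
  have h1 : ‖poch p t - 1‖ < 1 / 2 := by
    have := h (x := t) (by simp only [dist_zero_right]; linarith)
    rwa [poch_zero, dist_eq_norm] at this
  have h2 := norm_le_norm_add_norm_sub' (poch p t) 1
  have h3 := norm_le_norm_add_norm_sub' 1 (poch p t)
  rw [norm_sub_rev] at h3
  simp only [norm_one] at h2 h3
  constructor <;> linarith

/-! ### The rescaled quantum dilogarithm and its functional equations. -/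

/-- `p = q²`. -/
def nome (N : ℕ) (b : ℂ) : ℂ := Complex.exp (2 * Real.pi * Complex.I / N * (1 + b ^ 2))

/-- The exponential `exp (2π/N (-b w + i n))`. -/
def ex (N : ℕ) (b w : ℂ) (n : ℤ) : ℂ := Complex.exp (2 * Real.pi / N * (-b * w + Complex.I * n))

/-- The reflected exponential `exp (2π/N (-b̄ w - i n))`. -/
def exc (N : ℕ) (b w : ℂ) (n : ℤ) : ℂ :=
  Complex.exp (2 * Real.pi / N * (-conj b * w - Complex.I * n))

theorem conj_ex (N : ℕ) (b w : ℂ) (n : ℤ) : conj (ex N b w n) = exc N b (conj w) n := by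
  simp only [ex, exc, ← Complex.exp_conj]
  congr 1
  simp [map_ofNat]
  left; ring

theorem conj_exc (N : ℕ) (b w : ℂ) (n : ℤ) : conj (exc N b w n) = ex N b (conj w) n := by
  have := conj_ex N b (conj w) n
  rw [Complex.conj_conj] at this
  rw [← this, Complex.conj_conj]

theorem ex_ne_zero (N : ℕ) (b w : ℂ) (n : ℤ) : ex N b w n ≠ 0 := Complex.exp_ne_zero _
theorem exc_ne_zero (N : ℕ) (b w : ℂ) (n : ℤ) : exc N b w n ≠ 0 := Complex.exp_ne_zero _

theorem differentiable_ex (N : ℕ) (b : ℂ) (n : ℤ) : Differentiable ℂ fun w => ex N b w n := by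
  unfold ex; fun_prop

theorem differentiable_exc (N : ℕ) (b : ℂ) (n : ℤ) : Differentiable ℂ fun w => exc N b w n := by
  unfold exc; fun_prop

theorem norm_ex (N : ℕ) (b w : ℂ) (n : ℤ) :
    ‖ex N b w n‖ = Real.exp (2 * Real.pi / N * (-b.re * w.re + b.im * w.im)) := by
  rw [ex, Complex.norm_exp]
  congr 1
  have : (2 * (Real.pi : ℂ) / N) = ((2 * Real.pi / N : ℝ) : ℂ) := by push_cast; rfl
  rw [this, Complex.re_ofReal_mul]
  simp [Complex.mul_re]
  left; ring

theorem norm_exc (N : ℕ) (b w : ℂ) (n : ℤ) :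
    ‖exc N b w n‖ = Real.exp (2 * Real.pi / N * (-b.re * w.re - b.im * w.im)) := by
  rw [← Complex.norm_conj, conj_exc, norm_ex]
  congr 1
  simp
  left; ring

/-- The quantum dilogarithm in the shifted and rescaled variable: `γ((w - i Re b)/√N, n)`. -/
def hq (N : ℕ) (b w : ℂ) (n : ℤ) : ℂ :=
  poch (nome N b) (nome N b * ex N b w n) / conj (poch (nome N b) (ex N b (conj w) n))

/-- Standing assumptions on the parameters. -/
structure Param (N : ℕ) (b : ℂ) : Prop where
  pos : 0 < N
  norm : ‖b‖ = 1
  re : 0 < b.re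
  im : 0 < b.im

namespace Param
variable {N : ℕ} {b : ℂ}

theorem ne (P : Param N b) : (N : ℂ) ≠ 0 := by exact_mod_cast P.pos.ne'

theorem rpos (P : Param N b) : (0 : ℝ) < N := by exact_mod_cast P.pos

theorem mul_conj (P : Param N b) : b * conj b = 1 := by
  rw [Complex.mul_conj, Complex.normSq_eq_norm_sq, P.norm]; simp

theorem b_ne (P : Param N b) : b ≠ 0 := by rintro rfl; simpa using P.norm

theorem conj_ne (P : Param N b) : conj b ≠ 0 := by simpa using P.b_ne

theorem inv_eq (P : Param N b) : b⁻¹ = conj b := inv_eq_of_mul_eq_one_right P.mul_conj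

theorem add_conj : b + conj b = 2 * b.re := by
  rw [Complex.add_conj]; push_cast; rfl

theorem sub_conj : b - conj b = 2 * b.im * Complex.I := by
  rw [Complex.sub_conj]; push_cast; rfl

theorem norm_nome : ‖nome N b‖ = Real.exp (-(4 * Real.pi / N * (b.re * b.im))) := by
  rw [nome, Complex.norm_exp]
  congr 1
  have : (2 * (Real.pi : ℂ) * Complex.I / N) = ((2 * Real.pi / N : ℝ) : ℂ) * Complex.I := by
    push_cast; ring
  rw [this, mul_assoc, Complex.re_ofReal_mul]
  simp [Complex.mul_re, Complex.add_im, pow_two]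
  ring

theorem nome_lt (P : Param N b) : ‖nome N b‖ < 1 := by
  rw [norm_nome, Real.exp_lt_one_iff]
  have := P.re; have := P.im; have := P.rpos; have := Real.pi_pos
  have : 0 < 4 * Real.pi / N * (b.re * b.im) := by positivity
  linarith

theorem conj_nome :
    conj (nome N b) = Complex.exp (-(2 * Real.pi * Complex.I / N * (1 + conj b ^ 2))) := by
  rw [nome, ← Complex.exp_conj]
  congr 1
  simp [map_ofNat]
  ring

/-- Since `b * conj b = 1`, translation by `i b` with `n - 1` fixes `exc` and divides `ex` by the
nome, while translation by `i conj b` with `n + 1` fixes `ex` and multiplies `exc` by the conjugate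
nome. Each move therefore touches only one of the two Pochhammer symbols in `hq`. -/
theorem ex_shift (P : Param N b) (w : ℂ) (n : ℤ) :
    ex N b (w + Complex.I * b) (n - 1) * nome N b = ex N b w n := by
  rw [ex, nome, ex, ← Complex.exp_add]
  congr 1
  have := P.ne
  push_cast
  field_simp
  ring

theorem exc_shift (P : Param N b) (w : ℂ) (n : ℤ) : exc N b (w + Complex.I * b) (n - 1) =
    exc N b w n := by
  rw [exc, exc]
  congr 1
  have := P.ne
  push_cast
  linear_combination (-(2 * Real.pi / N) * Complex.I : ℂ) * P.mul_conj

theorem ex_shift' (P : Param N b) (w : ℂ) (n : ℤ) : ex N b (w + Complex.I * conj b) (n + 1) =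
    ex N b w n := by
  rw [ex, ex]
  congr 1
  have := P.ne
  push_cast
  linear_combination (-(2 * Real.pi / N) * Complex.I : ℂ) * P.mul_conj

theorem exc_shift' (P : Param N b) (w : ℂ) (n : ℤ) :
    exc N b (w + Complex.I * conj b) (n + 1) = conj (nome N b) * exc N b w n := by
  rw [exc, conj_nome, exc, ← Complex.exp_add]
  congr 1
  have := P.ne
  push_cast
  field_simp
  ring

/-- Only the numerator moves, gaining the factor that `poch_eq_mul` splits off. -/
theorem hq_shift (P : Param N b) (w : ℂ) (n : ℤ) :
    hq N b (w + Complex.I * b) (n - 1) = (1 - ex N b w n) * hq N b w n := by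
  have h1 : nome N b * ex N b (w + Complex.I * b) (n - 1) = ex N b w n := by
    rw [mul_comm, P.ex_shift]
  have h2 : ex N b (conj (w + Complex.I * b)) (n - 1) = ex N b (conj w) n := by
    rw [← conj_exc, P.exc_shift, conj_exc]
  rw [hq, hq, h1, h2, poch_eq_mul P.nome_lt]
  ring

/-- Splitting one factor off the denominator leaves a quotient of the form `f w / conj (f (conj
w))`, which has only removable singularities on the real axis. Every real pole thus comes from `1 -
exc`. -/
theorem hq_eq_div (P : Param N b) (w : ℂ) (n : ℤ) : hq N b w n = poch (nome N b)
    (nome N b * ex N b w n) /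
    conj (poch (nome N b) (nome N b * ex N b (conj w) n)) / (1 - exc N b w n) := by
  rw [hq, poch_eq_mul P.nome_lt (ex N b (conj w) n), map_mul, map_sub, map_one, conj_ex,
    Complex.conj_conj, div_div, mul_comm (1 - _)]

/-- Written as a division so that it also holds where `1 - exc` vanishes, both sides then being zero
by convention. -/
theorem hq_shift' (P : Param N b) (w : ℂ) (n : ℤ) :
    hq N b w n = hq N b (w + Complex.I * conj b) (n + 1) / (1 - exc N b w n) := by
  have h2 : ex N b (conj (w + Complex.I * conj b)) (n + 1) = nome N b * ex N b (conj w) n := by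
    rw [← conj_exc, P.exc_shift', map_mul, conj_exc, Complex.conj_conj]
  rw [P.hq_eq_div, hq, P.ex_shift', h2]

theorem ex_int (P : Param N b) (w : ℂ) (n : ℤ) (k : ℤ) : ex N b w (n + k * N) = ex N b w n := by
  rw [ex, ex, Complex.exp_eq_exp_iff_exists_int]
  refine ⟨k, ?_⟩
  have := P.ne
  push_cast
  field_simp
  ring

theorem hq_int (P : Param N b) (w : ℂ) (n : ℤ) (k : ℤ) : hq N b w (n + k * N) = hq N b w n := by
  simp only [hq, P.ex_int]

/-- `p^j E(w, n) = 1` forces the imaginary part of `w` onto the lattice `Re b ℤ`. -/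
theorem im_of_pow_mul_ex_eq_one (P : Param N b) {w : ℂ} {n : ℤ} {j : ℕ}
    (h : nome N b ^ j * ex N b w n = 1) :
    ∃ k : ℤ, w = Complex.I * ((b + conj b) * j + conj b * (n + k * N)) := by
  rw [nome, ex, ← Complex.exp_nat_mul, ← Complex.exp_add, Complex.exp_eq_one_iff] at h
  obtain ⟨k, hk⟩ := h
  refine ⟨-k, ?_⟩
  have hN := P.ne
  have hpi : (Real.pi : ℂ) ≠ 0 := by exact_mod_cast Real.pi_ne_zero
  have h1 : b * w = Complex.I * ((1 + b ^ 2) * j + n - k * N) := by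
    field_simp at hk
    linear_combination -hk
  have h2 : w = conj b * (b * w) := by rw [← mul_assoc, mul_comm (conj b), P.mul_conj, one_mul]
  rw [h2, h1]
  push_cast
  linear_combination (Complex.I * j * b) * P.mul_conj

end Param

/-! ### Removable singularities and reflection quotients. -/

/-- `f` agrees with an analytic function on a punctured neighbourhood of `w`. -/
def RegAt (f : ℂ → ℂ) (w : ℂ) : Prop := ∃ k, AnalyticAt ℂ k w ∧ f =ᶠ[𝓝[≠] w] k

/-- The value at `w` of the extension of `f` across an isolated removable singularity. -/
def reg (f : ℂ → ℂ) (w : ℂ) : ℂ := limUnder (𝓝[≠] w) f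

theorem reg_eq_of_tendsto {f : ℂ → ℂ} {w a : ℂ} (h : Tendsto f (𝓝[≠] w) (𝓝 a)) : reg f w = a :=
  h.limUnder_eq

theorem reg_eq {f k : ℂ → ℂ} {w : ℂ} (hk : ContinuousAt k w) (h : f =ᶠ[𝓝[≠] w] k) :
    reg f w = k w :=
  reg_eq_of_tendsto ((hk.tendsto.mono_left nhdsWithin_le_nhds).congr' h.symm)

/-- A punctured neighbourhood of `w` is a full neighbourhood of each of its points, so the limit
defining `reg` returns `k` at those points and not only at `w`. -/
theorem reg_eventuallyEq {f k : ℂ → ℂ} {w : ℂ} (hk : AnalyticAt ℂ k w) (h : f =ᶠ[𝓝[≠] w] k) :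
    reg f =ᶠ[𝓝 w] k := by
  have h1 : ∀ᶠ z in 𝓝[≠] w, reg f z = k z := by
    have h2 := eventually_eventually_nhdsWithin.mpr h
    have h3 : ∀ᶠ z in 𝓝[≠] w, AnalyticAt ℂ k z :=
      hk.eventually_analyticAt.filter_mono nhdsWithin_le_nhds
    filter_upwards [h2, h3, self_mem_nhdsWithin] with z hz hz' hzw
    rw [isOpen_compl_singleton.nhdsWithin_eq hzw] at hz
    exact reg_eq hz'.continuousAt (hz.filter_mono nhdsWithin_le_nhds)
  rw [EventuallyEq, eventually_nhdsWithin_iff] at *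
  filter_upwards [h1] with z hz
  by_cases hzw : z = w
  · subst hzw
    exact reg_eq hk.continuousAt (eventually_nhdsWithin_iff.mpr h)
  · exact hz hzw

theorem RegAt.analyticAt {f : ℂ → ℂ} {w : ℂ} (h : RegAt f w) : AnalyticAt ℂ (reg f) w := by
  obtain ⟨k, hk, hfk⟩ := h
  exact hk.congr (reg_eventuallyEq hk hfk).symm

theorem RegAt.tendsto {f : ℂ → ℂ} {w : ℂ} (h : RegAt f w) : Tendsto f (𝓝[≠] w) (𝓝 (reg f w)) := by
  obtain ⟨k, hk, hfk⟩ := h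
  rw [reg_eq hk.continuousAt hfk]
  exact (hk.continuousAt.tendsto.mono_left nhdsWithin_le_nhds).congr' hfk.symm

theorem AnalyticAt.regAt {f : ℂ → ℂ} {w : ℂ} (h : AnalyticAt ℂ f w) : RegAt f w :=
  ⟨f, h, EventuallyEq.rfl⟩

theorem RegAt.sub {f g : ℂ → ℂ} {w : ℂ} (hf : RegAt f w) (hg : RegAt g w) :
    RegAt (fun z => f z - g z) w := by
  obtain ⟨k, hk, hfk⟩ := hf
  obtain ⟨l, hl, hgl⟩ := hg
  exact ⟨fun z => k z - l z, hk.sub hl, hfk.sub hgl⟩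

theorem differentiable_conj_conj {f : ℂ → ℂ} (hf : Differentiable ℂ f) :
    Differentiable ℂ fun z => conj (f (conj z)) := fun z =>
  differentiableAt_conj_conj_iff.mpr (hf (conj z))

theorem AnalyticAt.conj_conj {f : ℂ → ℂ} {w : ℂ} (hf : AnalyticAt ℂ f (conj w)) :
    AnalyticAt ℂ (fun z => conj (f (conj z))) w := by
  rw [Complex.analyticAt_iff_eventually_differentiableAt] at *
  have := (Complex.continuous_conj.tendsto w).eventually hf
  filter_upwards [this] with z hz
  have := hz.conj_conj
  simpa [Function.comp_def] using this

/-- A quotient `f(z)/conj f(conj z)` has removable singularities at real points, and is unimodular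
there. -/
theorem exists_reflection_quotient {f : ℂ → ℂ} {x : ℂ} (hx : conj x = x) (hf : AnalyticAt ℂ f x)
    (h0 : ¬ ∀ᶠ z in 𝓝 x, f z = 0) :
    ∃ k, AnalyticAt ℂ k x ∧ ‖k x‖ = 1 ∧ (fun z => f z / conj (f (conj z))) =ᶠ[𝓝[≠] x] k := by
  -- The zero of `f` at `x` has the form `(z - x) ^ n`; as `x` is real, the reflected function
  -- carries the same factor and it cancels.
  obtain ⟨n, g, hg, hgx, hfg⟩ := hf.exists_eventuallyEq_pow_smul_nonzero_iff.mpr h0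
  have hg' : AnalyticAt ℂ (fun z => conj (g (conj z))) x := AnalyticAt.conj_conj (by rwa [hx])
  have hgx' : conj (g (conj x)) ≠ 0 := by rw [hx]; simpa using hgx
  refine ⟨fun z => g z / conj (g (conj z)), hg.div hg' hgx', ?_, ?_⟩
  · simp only [hx]
    rw [norm_div, Complex.norm_conj, div_self (by simpa using hgx)]
  · have hc : Tendsto (fun z : ℂ => conj z) (𝓝 x) (𝓝 x) := by
      simpa [hx] using Complex.continuous_conj.tendsto x
    filter_upwards [hfg.filter_mono nhdsWithin_le_nhds,
      (hc.eventually hfg).filter_mono nhdsWithin_le_nhds, self_mem_nhdsWithin] with z h1 h2 hz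
    have hz' : (z - x) ^ n ≠ 0 := pow_ne_zero _ (sub_ne_zero.mpr hz)
    rw [h1, h2]
    simp only [smul_eq_mul, map_mul, map_pow, map_sub, Complex.conj_conj, hx]
    rw [mul_div_mul_left _ _ hz']

theorem analyticAt_dslope {f : ℂ → ℂ} {c w : ℂ} (hc : AnalyticAt ℂ f c) (hw : AnalyticAt ℂ f w) :
    AnalyticAt ℂ (dslope f c) w := by
  rw [Complex.analyticAt_iff_eventually_differentiableAt] at *
  by_cases h : w = c
  · subst h
    obtain ⟨s, hs, hso, hws⟩ := eventually_nhds_iff.mp hc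
    have h1 : DifferentiableOn ℂ f s := fun z hz => (hs z hz).differentiableWithinAt
    have h2 := (Complex.differentiableOn_dslope (hso.mem_nhds hws)).mpr h1
    filter_upwards [hso.mem_nhds hws] with z hz using h2.differentiableAt (hso.mem_nhds hz)
  · filter_upwards [hw, isOpen_compl_singleton.mem_nhds h] with z hz hzc
    exact (differentiableAt_dslope_of_ne hzc).mpr hz

/-! ### Meromorphic continuation of the dilogarithm to the strip. -/

/-- Kronecker delta of `n` and `0` modulo `N`. -/
def chi (N : ℕ) (n : ℤ) : ℂ := if (N : ℤ) ∣ n then 1 else 0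

/-- Residue of the shifted quantum dilogarithm `hq N b · 0` at `0`. -/
def kap (N : ℕ) (b : ℂ) : ℂ :=
  N / (2 * Real.pi * conj b) * (poch (nome N b) (nome N b) / conj (poch (nome N b) (nome N b)))

/-- The regular part of `hq N b · n` on the strip `-Re b < Im w < 2 Re b`. -/
def hr (N : ℕ) (b w : ℂ) (n : ℤ) : ℂ := reg (fun z => hq N b z n - chi N n * kap N b / z) w

/-- The meromorphic extension of `hq N b · n` to the strip `-Re b < Im w < 2 Re b`. -/
def hh (N : ℕ) (b w : ℂ) (n : ℤ) : ℂ := hr N b w n + chi N n * kap N b / w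

/-- The strip on which `hh` is studied. -/
def strip (b : ℂ) : Set ℂ := {w | -b.re < w.im ∧ w.im < 2 * b.re}

namespace Param
variable {N : ℕ} {b : ℂ}

theorem differentiable_num (P : Param N b) (n : ℤ) :
    Differentiable ℂ fun w => poch (nome N b) (nome N b * ex N b w n) :=
  (differentiable_poch P.nome_lt).comp ((differentiable_ex N b n).const_mul _)

theorem differentiable_den (P : Param N b) (n : ℤ) :
    Differentiable ℂ fun w => conj (poch (nome N b) (ex N b (conj w) n)) :=
  differentiable_conj_conj ((differentiable_poch P.nome_lt).comp (differentiable_ex N b n))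

theorem poch_ex_ne_zero (P : Param N b) {w : ℂ} (hw : ∀ k : ℤ, w.im ≠ k * b.re) (n : ℤ) :
    poch (nome N b) (ex N b w n) ≠ 0 := by
  refine poch_ne_zero P.nome_lt fun j hj => ?_
  obtain ⟨k, hk⟩ := P.im_of_pow_mul_ex_eq_one hj
  refine hw (2 * j + (n + k * N)) ?_
  rw [hk, add_conj]
  simp
  ring

theorem poch_mul_ex_ne_zero (P : Param N b) {w : ℂ} (hw : ∀ k : ℤ, w.im ≠ k * b.re) (n : ℤ) :
    poch (nome N b) (nome N b * ex N b w n) ≠ 0 := by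
  have := P.poch_ex_ne_zero hw n
  rw [poch_eq_mul P.nome_lt] at this
  exact right_ne_zero_of_mul this

theorem exc_eq_one_iff (P : Param N b) {w : ℂ} {n : ℤ} (hw : w.im = 0) :
    exc N b w n = 1 ↔ w = 0 ∧ (N : ℤ) ∣ n := by
  have hN := P.ne
  have hpi : (Real.pi : ℂ) ≠ 0 := by exact_mod_cast Real.pi_ne_zero
  constructor
  · intro h
    have hw' : conj w = w := Complex.conj_eq_iff_im.mpr hw
    have h' : nome N b ^ 0 * ex N b w n = 1 := by
      rw [pow_zero, one_mul, ← hw', ← conj_exc, h, map_one]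
    obtain ⟨k, hk⟩ := P.im_of_pow_mul_ex_eq_one h'
    have h2 : b.re * (n + k * N : ℤ) = 0 := by
      have h3 := congrArg Complex.im hk
      rw [hw] at h3
      simp at h3
      push_cast
      rcases h3 with h3 | h3
      · rw [h3, zero_mul]
      · rw [h3, mul_zero]
    have h3 : n + k * N = 0 := by
      have := (mul_eq_zero.mp h2).resolve_left P.re.ne'
      exact_mod_cast this
    refine ⟨?_, ⟨-k, by linarith⟩⟩
    rw [hk]
    have : ((n : ℂ) + k * N) = 0 := by exact_mod_cast congrArg (Int.cast : ℤ → ℂ) h3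
    rw [this]; simp
  · rintro ⟨rfl, k, rfl⟩
    rw [exc, Complex.exp_eq_one_iff]
    refine ⟨-k, ?_⟩
    push_cast
    field_simp
    ring

theorem analyticAt_hq (P : Param N b) {w : ℂ} {n : ℤ}
    (h : poch (nome N b) (ex N b (conj w) n) ≠ 0) :
    AnalyticAt ℂ (fun z => hq N b z n) w :=
  ((P.differentiable_num n).analyticAt w).fun_div ((P.differentiable_den n).analyticAt w)
    (by simpa using h)

/-- A function without zeros just above `w` does not vanish identically near `w`. This supplies the
nondegeneracy hypothesis of `exists_reflection_quotient`. -/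
theorem exists_im_ne {w : ℂ} {a : ℝ} (ha : 0 < a) {k : ℂ → ℂ}
    (h : ∀ z : ℂ, w.im < z.im → z.im < w.im + a → k z ≠ 0) : ¬ ∀ᶠ z in 𝓝 w, k z = 0 := by
  intro h0
  obtain ⟨r, hr, hb⟩ := Metric.eventually_nhds_iff.mp h0
  have hd : 0 < min (r / 2) (a / 2) := by positivity
  refine h (w + (min (r / 2) (a / 2) : ℝ) * Complex.I) ?_ ?_ (hb ?_)
  · simp; exact ⟨hr, ha⟩
  · have := min_le_right (r / 2) (a / 2)
    simp
    right; linarith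
  · have := min_le_left (r / 2) (a / 2)
    simp only [dist_self_add_left, norm_mul, Complex.norm_real, Complex.norm_I, mul_one,
      Real.norm_eq_abs, abs_of_pos hd]
    linarith

theorem ne_int_mul (P : Param N b) {v : ℝ} (k : ℤ) (h1 : k * b.re < v) (h2 : v < (k + 1) * b.re)
    (l : ℤ) :
    v ≠ l * b.re := by
  rintro rfl
  have := P.re
  have h3 : k < l := by exact_mod_cast lt_of_mul_lt_mul_right h1 this.le
  have h4 : l < k + 1 := by exact_mod_cast lt_of_mul_lt_mul_right h2 this.le
  omega

/-- Near a real point, `hq` is `k/(1 - exc)` with `k` analytic, unimodular at the point. -/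
theorem exists_hq_real (P : Param N b) {x : ℂ} (hx : x.im = 0) (n : ℤ) :
    ∃ k, AnalyticAt ℂ k x ∧ ‖k x‖ = 1 ∧
      (fun z => hq N b z n) =ᶠ[𝓝[≠] x] fun z => k z / (1 - exc N b z n) := by
  have hx' : conj x = x := Complex.conj_eq_iff_im.mpr hx
  obtain ⟨k, hk, hk1, hfk⟩ := exists_reflection_quotient hx'
    ((P.differentiable_num n).analyticAt x) (exists_im_ne P.re fun z h1 h2 =>
      P.poch_mul_ex_ne_zero (P.ne_int_mul 0 (by simpa [hx] using h1) (by simpa [hx] using h2)) n)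
  refine ⟨k, hk, hk1, ?_⟩
  filter_upwards [hfk] with z hz
  rw [P.hq_eq_div, hz]

/-- Since `nome * ex z = ex (z - 2 i Re b)`, numerator and denominator are reflections of each other
in the line `Im z = Re b`, so their common zeros there cancel. -/
theorem regAt_hq_of_im_eq (P : Param N b) {w : ℂ} (hw : w.im = b.re) (n : ℤ) :
    RegAt (fun z => hq N b z n) w := by
  set x : ℂ := w - Complex.I * b.re with hxdef
  have hx : x.im = 0 := by simp [hxdef, hw]
  have hx' : conj x = x := Complex.conj_eq_iff_im.mpr hx
  have hd : Differentiable ℂ fun z => poch (nome N b) (ex N b (z - Complex.I * b.re) n) :=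
    (differentiable_poch P.nome_lt).comp ((differentiable_ex N b n).comp (by fun_prop))
  obtain ⟨k, hk, -, hfk⟩ := exists_reflection_quotient hx' (hd.analyticAt x)
    (exists_im_ne P.re fun z h1 h2 =>
      P.poch_ex_ne_zero (P.ne_int_mul (-1) (by simp; linarith) (by simp; linarith)) n)
  refine ⟨fun z => k (z - Complex.I * b.re), ?_, ?_⟩
  · exact hk.comp_of_eq (by fun_prop) rfl
  · have ht : Tendsto (fun z : ℂ => z - Complex.I * b.re) (𝓝[≠] w) (𝓝[≠] x) := by
      refine tendsto_nhdsWithin_iff.mpr ⟨?_, ?_⟩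
      · exact (Continuous.tendsto (by fun_prop) w).mono_left nhdsWithin_le_nhds
      · filter_upwards [self_mem_nhdsWithin] with z hz
        simpa [hxdef] using hz
    filter_upwards [ht.eventually hfk] with z hz
    rw [← hz, hq]
    have e1 : nome N b * ex N b z n = ex N b (z - Complex.I * b.re - Complex.I * b.re) n := by
      rw [nome, ex, ex, ← Complex.exp_add]
      congr 1
      have h1 := add_conj (b := b)
      have h2 := P.mul_conj
      linear_combination (2 * Real.pi / N * Complex.I) * (b * h1 - h2)
    rw [e1]
    congr 3
    simp

/-- `hq` minus its possible pole at the origin has only removable singularities in the strip. -/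
theorem regAt_hq_sub (P : Param N b) {w : ℂ} (hw : w ∈ strip b) (n : ℤ) :
    RegAt (fun z => hq N b z n - chi N n * kap N b / z) w := by
  have hpole : w ≠ 0 → RegAt (fun z => chi N n * kap N b / z) w := fun h =>
    AnalyticAt.regAt (analyticAt_const.fun_div analyticAt_id h)
  by_cases h0 : w.im = 0
  · by_cases h1 : exc N b w n = 1
    -- The only genuine pole. Here `1 - exc` has a simple zero; dividing by its slope writes `hq` as
    -- `k z / z` with `k` analytic, and removing `k 0 / z` leaves the slope of `k`.
    · obtain ⟨rfl, hn⟩ := (P.exc_eq_one_iff h0).mp h1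
      have hE : ex N b 0 n = 1 := by
        have := conj_exc N b 0 n
        rw [h1] at this
        simpa using this.symm
      have hk : AnalyticAt ℂ (fun z => poch (nome N b) (nome N b * ex N b z n) /
          conj (poch (nome N b) (nome N b * ex N b (conj z) n))) 0 := by
        refine ((P.differentiable_num n).analyticAt 0).fun_div
          ((differentiable_conj_conj (P.differentiable_num n)).analyticAt 0) ?_
        simp only [map_zero, hE, mul_one]
        simpa using poch_ne_zero_of_norm_lt_one P.nome_lt P.nome_lt
      have hd : AnalyticAt ℂ (dslope (fun z => 1 - exc N b z n) 0) 0 := by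
        have : AnalyticAt ℂ (fun z => 1 - exc N b z n) 0 :=
          (((differentiable_exc N b n).const_sub 1)).analyticAt 0
        exact analyticAt_dslope this this
      have hd0 : dslope (fun z => 1 - exc N b z n) 0 0 = 2 * Real.pi * conj b / N := by
        rw [dslope_same]
        have : HasDerivAt (fun z => exc N b z n) (exc N b 0 n * (2 * Real.pi / N * (-conj b))) 0 :=
          by
          have h3 : HasDerivAt (fun z : ℂ => 2 * Real.pi / N * (-conj b * z - Complex.I * n))
              (2 * Real.pi / N * (-conj b)) 0 := by
            have := (((hasDerivAt_id (0 : ℂ)).const_mul (-conj b)).sub_const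
              (Complex.I * n)).const_mul (2 * (Real.pi : ℂ) / N)
            simpa using this
          exact h3.cexp
        rw [(this.const_sub 1).deriv, h1]
        ring
      have hd1 : dslope (fun z => 1 - exc N b z n) 0 0 ≠ 0 := by
        rw [hd0]
        have hpi : (Real.pi : ℂ) ≠ 0 := by exact_mod_cast Real.pi_ne_zero
        exact div_ne_zero (mul_ne_zero (mul_ne_zero two_ne_zero hpi) P.conj_ne) P.ne
      have hquot := hk.fun_div hd hd1
      refine ⟨_, analyticAt_dslope hquot hquot, ?_⟩
      filter_upwards [self_mem_nhdsWithin] with z hz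
      have hz' : z ≠ 0 := hz
      rw [dslope_of_ne _ hz', slope_def_field, hd0, dslope_of_ne _ hz', slope_def_field, h1,
        P.hq_eq_div, chi, if_pos hn, kap]
      simp only [map_zero, hE, mul_one, sub_self, sub_zero]
      have := P.conj_ne
      have := P.ne
      field_simp
    · obtain ⟨k, hk, -, hfk⟩ := P.exists_hq_real h0 n
      have hreg : RegAt (fun z => hq N b z n) w :=
        ⟨_, hk.fun_div (((differentiable_exc N b n).const_sub 1).analyticAt w)
          (sub_ne_zero.mpr (Ne.symm h1)), hfk⟩
      by_cases hw0 : w = 0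
      · have hn : ¬ (N : ℤ) ∣ n := fun hn => h1 ((P.exc_eq_one_iff h0).mpr ⟨hw0, hn⟩)
        simpa [chi, hn] using hreg
      · exact hreg.sub (hpole hw0)
  · have hw0 : w ≠ 0 := by rintro rfl; simp at h0
    refine RegAt.sub ?_ (hpole hw0)
    by_cases hβ : w.im = b.re
    · exact P.regAt_hq_of_im_eq hβ n
    · refine AnalyticAt.regAt (P.analyticAt_hq (P.poch_ex_ne_zero (fun l => ?_) n))
      obtain ⟨hw1, hw2⟩ := hw
      rw [Complex.conj_im]
      rcases lt_or_gt_of_ne h0 with h | h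
      · exact P.ne_int_mul 0 (by simpa using h) (by simp; linarith) l
      · rcases lt_or_gt_of_ne hβ with h' | h'
        · exact P.ne_int_mul (-1) (by simp; linarith) (by simpa using h) l
        · exact P.ne_int_mul (-2) (by push_cast; linarith) (by push_cast; linarith) l

theorem analyticAt_hr (P : Param N b) {w : ℂ} (hw : w ∈ strip b) (n : ℤ) : AnalyticAt ℂ
    (fun z => hr N b z n) w :=
  (P.regAt_hq_sub hw n).analyticAt

/-- Away from the pole `hh` is the punctured limit of `hq`, so identities and bounds for `hq` pass
to `hh` by uniqueness of limits, including at removable singularities. -/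
theorem tendsto_hq (P : Param N b) {w : ℂ} (hw : w ∈ strip b) {n : ℤ} (h : w ≠ 0 ∨ ¬ (N : ℤ) ∣ n) :
    Tendsto (fun z => hq N b z n) (𝓝[≠] w) (𝓝 (hh N b w n)) := by
  have h1 := (P.regAt_hq_sub hw n).tendsto
  have h2 : Tendsto (fun z => chi N n * kap N b / z) (𝓝[≠] w) (𝓝 (chi N n * kap N b / w)) := by
    rcases h with h | h
    · have : ContinuousAt (fun z => chi N n * kap N b / z) w := by fun_prop (disch := exact h)
      exact this.tendsto.mono_left nhdsWithin_le_nhds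
    · simp [chi, h]
  refine (h1.add h2).congr fun z => by ring

theorem hh_eq_hq (P : Param N b) {w : ℂ} (hw : 0 < w.im) (hw' : w.im < b.re) (n : ℤ) :
    hh N b w n = hq N b w n := by
  have hws : w ∈ strip b := ⟨by linarith [P.re], by linarith⟩
  have hw0 : w ≠ 0 := by rintro rfl; simp at hw
  refine tendsto_nhds_unique (P.tendsto_hq hws (Or.inl hw0)) ?_
  refine (P.analyticAt_hq (P.poch_ex_ne_zero (fun l => ?_) n)).continuousAt.tendsto.mono_left
    nhdsWithin_le_nhds
  rw [Complex.conj_im]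
  exact P.ne_int_mul (-1) (by simp; linarith) (by simpa using hw) l

/-- The analytic factor in `exists_hq_real` is unimodular, so only the denominator survives.
Together with `norm_kap` this makes the moduli of the residues explicit. -/
theorem norm_hh_real (P : Param N b) {x : ℂ} (hx : x.im = 0) {n : ℤ} (h : x ≠ 0 ∨ ¬ (N : ℤ) ∣ n) :
    ‖hh N b x n‖ = 1 / ‖1 - exc N b x n‖ := by
  have hxs : x ∈ strip b := ⟨by linarith [P.re], by linarith [P.re]⟩
  obtain ⟨k, hk, hk1, hfk⟩ := P.exists_hq_real hx n
  have h1 : exc N b x n ≠ 1 := fun h1 => by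
    have := (P.exc_eq_one_iff hx).mp h1; tauto
  have h2 := hk.fun_div (((differentiable_exc N b n).const_sub 1).analyticAt x)
          (sub_ne_zero.mpr (Ne.symm h1))
  have h3 := tendsto_nhds_unique (P.tendsto_hq hxs h)
    ((h2.continuousAt.tendsto.mono_left nhdsWithin_le_nhds).congr' hfk.symm)
  rw [h3, norm_div, hk1]

theorem norm_kap (P : Param N b) : ‖kap N b‖ = N / (2 * Real.pi) := by
  have h : ‖poch (nome N b) (nome N b)‖ ≠ 0 :=
    norm_ne_zero_iff.mpr (poch_ne_zero_of_norm_lt_one P.nome_lt P.nome_lt)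
  rw [kap, norm_mul, norm_div, norm_div, norm_mul, Complex.norm_conj, Complex.norm_conj,
    div_self h, P.norm]
  simp [abs_of_pos Real.pi_pos]

theorem tendsto_add_punctured (w c : ℂ) :
    Tendsto (fun z : ℂ => z + c) (𝓝[≠] w) (𝓝[≠] (w + c)) := by
  refine tendsto_nhdsWithin_iff.mpr ⟨?_, ?_⟩
  · exact (Continuous.tendsto (by fun_prop) w).mono_left nhdsWithin_le_nhds
  · filter_upwards [self_mem_nhdsWithin] with z hz
    simpa using hz

/-- Both endpoints must avoid the pole, where `hh` carries the default value of a division by zero.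
-/
theorem hh_shift (P : Param N b) {w : ℂ} {n : ℤ} (hw : w ∈ strip b) (h : w ≠ 0 ∨ ¬ (N : ℤ) ∣ n)
    (hw' : w + Complex.I * b ∈ strip b) (h' : w + Complex.I * b ≠ 0 ∨ ¬ (N : ℤ) ∣ (n - 1)) :
    hh N b (w + Complex.I * b) (n - 1) = (1 - ex N b w n) * hh N b w n := by
  have h1 := (P.tendsto_hq hw' h').comp (tendsto_add_punctured w (Complex.I * b))
  have hc : ContinuousAt (fun z => 1 - ex N b z n) w :=
    ((differentiable_ex N b n).const_sub 1).continuous.continuousAt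
  have h2 := (hc.tendsto.mono_left nhdsWithin_le_nhds).mul (P.tendsto_hq hw h)
  exact tendsto_nhds_unique (h1.congr fun z => P.hq_shift z n) h2

theorem hh_shift' (P : Param N b) {w : ℂ} {n : ℤ} (hw : w ∈ strip b) (h : w ≠ 0 ∨ ¬ (N : ℤ) ∣ n)
    (hw' : w + Complex.I * conj b ∈ strip b)
    (h' : w + Complex.I * conj b ≠ 0 ∨ ¬ (N : ℤ) ∣ (n + 1)) (hV : exc N b w n ≠ 1) :
    hh N b (w + Complex.I * conj b) (n + 1) = (1 - exc N b w n) * hh N b w n := by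
  have h1 := (P.tendsto_hq hw' h').comp (tendsto_add_punctured w (Complex.I * conj b))
  have hc : ContinuousAt (fun z => 1 - exc N b z n) w :=
    ((differentiable_exc N b n).const_sub 1).continuous.continuousAt
  have h2 := (hc.tendsto.mono_left nhdsWithin_le_nhds).mul (P.tendsto_hq hw h)
  have h3 : ∀ᶠ z in 𝓝[≠] w, 1 - exc N b z n ≠ 0 :=
    (hc.eventually_ne (sub_ne_zero.mpr hV.symm)).filter_mono nhdsWithin_le_nhds
  refine tendsto_nhds_unique (h1.congr' ?_) h2
  filter_upwards [h3] with z hz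
  rw [P.hq_shift' z n, mul_div_cancel₀ _ hz]
  rfl

theorem chi_int (n k : ℤ) : chi N (n + k * N) = chi N n := by
  simp [chi]

theorem hr_int (P : Param N b) (w : ℂ) (n k : ℤ) : hr N b w (n + k * N) = hr N b w n := by
  simp only [hr, chi_int, P.hq_int]

theorem hh_int (P : Param N b) (w : ℂ) (n k : ℤ) : hh N b w (n + k * N) = hh N b w n := by
  simp only [hh, chi_int, P.hr_int]

/-! ### Growth of the dilogarithm in the strip. -/

/-- Only the class of `n` modulo `N` matters, so a sum of finitely many compactness bounds serves
for all `n`. -/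
theorem exists_hr_bound (P : Param N b) {K : Set ℂ} (hK : IsCompact K) (hKs : K ⊆ strip b) :
    ∃ C, 0 < C ∧ ∀ n : ℤ, ∀ w ∈ K, ‖hr N b w n‖ ≤ C := by
  have h : ∀ n : ℕ, ∃ C, 0 ≤ C ∧ ∀ w ∈ K, ‖hr N b w n‖ ≤ C := fun n => by
    obtain ⟨C, hC⟩ := hK.exists_bound_of_continuousOn (f := fun w => hr N b w n)
      fun w hw => (P.analyticAt_hr (hKs hw) n).continuousAt.continuousWithinAt
    exact ⟨max C 0, le_max_right _ _, fun w hw => (hC w hw).trans (le_max_left _ _)⟩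
  choose C hC0 hC using h
  refine ⟨∑ n ∈ Finset.range N, C n + 1, ?_, fun n w hw => ?_⟩
  · have := Finset.sum_nonneg (s := Finset.range N) fun n _ => hC0 n
    linarith
  · have hN : (N : ℤ) ≠ 0 := by exact_mod_cast P.pos.ne'
    have h1 : n = ((n % N).toNat : ℤ) + (n / N) * N := by
      rw [Int.toNat_of_nonneg (Int.emod_nonneg n hN)]
      linarith [Int.emod_add_mul_ediv n N]
    rw [h1, P.hr_int]
    have h2 : (n % N).toNat ∈ Finset.range N := by
      have := Int.emod_lt_of_pos n (b := N) (by exact_mod_cast P.pos)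
      have := Int.emod_nonneg n hN
      simp; omega
    have := Finset.single_le_sum (fun n _ => hC0 n) h2
    have := hC (n % N).toNat w hw
    linarith

/-- `hh` is bounded far to the right. -/
theorem exists_hh_bound_right (P : Param N b) :
    ∃ M, 1 ≤ M ∧ ∀ (n : ℤ) (w : ℂ), w ∈ strip b → M < w.re → ‖hh N b w n‖ ≤ 4 := by
  obtain ⟨r, hr, hb⟩ := exists_poch_bounds P.nome_lt
  have hβ := P.re
  have hs := P.im
  have hN := P.rpos
  have hpi := Real.pi_pos
  have hc : 0 < 2 * Real.pi / N * b.re := by positivity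
  have ht : Tendsto (fun M : ℝ => Real.exp (2 * Real.pi / N * (-b.re * M + b.im * (2 * b.re))))
      atTop (𝓝 0) := by
    refine Real.tendsto_exp_atBot.comp ?_
    refine (tendsto_atBot_add_const_right _ _ ?_).const_mul_atBot (by positivity)
    exact tendsto_id.const_mul_atTop_of_neg (by linarith)
  obtain ⟨M, hM, hM1⟩ := ((ht.eventually (gt_mem_nhds hr)).and (eventually_ge_atTop 1)).exists
  refine ⟨M, hM1, fun n w hw hMw => ?_⟩
  have hw0 : w ≠ 0 := by rintro rfl; simp at hMw; linarith
  have hq4 : ∀ z : ℂ, z ∈ strip b → M < z.re → ‖hq N b z n‖ ≤ 4 := fun z hz hzM => by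
    have e1 : ‖ex N b z n‖ ≤ r := by
      rw [norm_ex]
      refine le_trans (Real.exp_le_exp.mpr ?_) hM.le
      have := hz.2
      gcongr ?_ * ?_
      nlinarith
    have e2 : ‖ex N b (conj z) n‖ ≤ r := by
      rw [norm_ex]
      refine le_trans (Real.exp_le_exp.mpr ?_) hM.le
      have := hz.1
      gcongr ?_ * ?_
      simp only [Complex.conj_re, Complex.conj_im]
      nlinarith
    have e3 : ‖nome N b * ex N b z n‖ ≤ r := by
      rw [norm_mul]
      nlinarith [P.nome_lt, norm_nonneg (ex N b z n), norm_nonneg (nome N b)]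
    rw [hq, norm_div, Complex.norm_conj]
    have h1 := (hb _ e3).1
    have h2 := (hb _ e2).2
    rw [div_le_iff₀ (by linarith)]
    linarith
  have hopen : IsOpen {z : ℂ | z ∈ strip b ∧ M < z.re} := by
    refine IsOpen.inter (IsOpen.inter ?_ ?_) ?_
    · exact isOpen_lt continuous_const Complex.continuous_im
    · exact isOpen_lt Complex.continuous_im continuous_const
    · exact isOpen_lt continuous_const Complex.continuous_re
  refine le_of_tendsto (P.tendsto_hq hw (n := n) (Or.inl hw0)).norm ?_
  filter_upwards [nhdsWithin_le_nhds (hopen.mem_nhds ⟨hw, hMw⟩)] with z hz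
  exact hq4 z hz.1 hz.2

/-- Translation by `-2 Im b`. -/
theorem hh_translate (P : Param N b) {w : ℂ} {n : ℤ} (hw : w ∈ strip b) (hre : w.re < 0)
    (hV : exc N b (w - 2 * b.im) (n - 2) ≠ 1) :
    hh N b (w - 2 * b.im) (n - 2) =
      (1 - ex N b w n) * hh N b w n / (1 - exc N b (w - 2 * b.im) (n - 2)) := by
  have hs := P.im
  have hw0 : w ≠ 0 := by rintro rfl; simp at hre
  have hw0' : w + (-(2 * b.im) : ℂ) ≠ 0 := by
    intro h
    have := congrArg Complex.re h
    simp at this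
    linarith
  have hw' : w + (-(2 * b.im) : ℂ) ∈ strip b := by simpa [strip] using hw
  rw [sub_eq_add_neg] at hV ⊢
  have h1 := (P.tendsto_hq hw' (n := n - 2) (Or.inl hw0')).comp
    (tendsto_add_punctured w (-(2 * b.im)))
  have hc : ContinuousAt (fun z => 1 - ex N b z n) w :=
    ((differentiable_ex N b n).const_sub 1).continuous.continuousAt
  have hc' : ContinuousAt (fun z => 1 - exc N b (z + (-(2 * b.im) : ℂ)) (n - 2)) w :=
    ((continuous_const.sub ((differentiable_exc N b (n - 2)).continuous.comp
      (continuous_id.add continuous_const)))).continuousAt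
  have h2 := ((hc.tendsto.mono_left nhdsWithin_le_nhds).mul
    (P.tendsto_hq hw (n := n) (Or.inl hw0))).div (hc'.tendsto.mono_left nhdsWithin_le_nhds)
    (sub_ne_zero.mpr hV.symm)
  refine tendsto_nhds_unique (h1.congr fun z => ?_) h2
  -- A shift by `i b` followed by an inverse shift by `i conj b` is the real translation by `-2 Im
  -- b`, with `n` dropping by two.
  have e : z + (-(2 * b.im) : ℂ) + Complex.I * conj b = z + Complex.I * b := by
    have := sub_conj (b := b)
    linear_combination (-Complex.I) * this - 2 * b.im * Complex.I_sq
  simp only [Function.comp_apply]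
  rw [P.hq_shift', e, show n - 2 + 1 = n - 1 by ring, P.hq_shift]
  rfl

/-- The effect of the translation by `-2 Im b` on the size of `hh`, far to the left. -/
theorem exists_norm_hh_translate_le (P : Param N b) :
    ∃ M K, 1 ≤ M ∧ 0 < K ∧ ∀ (n : ℤ) (w : ℂ), w ∈ strip b → w.re ≤ -M →
      ‖hh N b (w - 2 * b.im) (n - 2)‖ ≤
        ‖hh N b w n‖ * Real.exp (-(2 * b.im * (2 * Real.pi / N * (b.re - w.im)))) *
          Real.exp (K * Real.exp (2 * Real.pi / N * b.re * w.re)) := by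
  have hβ := P.re
  have hs := P.im
  have hN := P.rpos
  have hpi := Real.pi_pos
  set d : ℝ := 2 * Real.pi / N with hd
  have hd0 : 0 < d := by positivity
  set K : ℝ := Real.exp (d * (2 * b.im * b.re)) with hK
  have hK0 : 0 < K := Real.exp_pos _
  have ht : Tendsto (fun M : ℝ => K * Real.exp (d * b.re * -M)) atTop (𝓝 0) := by
    rw [← mul_zero K]
    refine (Real.tendsto_exp_atBot.comp ?_).const_mul K
    exact tendsto_neg_atTop_atBot.const_mul_atBot (by positivity)
  obtain ⟨M, hM, hM1⟩ :=
    ((ht.eventually (gt_mem_nhds (show (0 : ℝ) < 1 / 2 by norm_num))).and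
      (eventually_ge_atTop 1)).exists
  refine ⟨M, 4 * K, hM1, by positivity, fun n w hw hwM => ?_⟩
  -- `y` dominates the reciprocals of both exponentials, so each factor `1 - E` has modulus `|E|` up
  -- to a relative error of at most `y`.
  set y : ℝ := K * Real.exp (d * b.re * w.re) with hy
  have hy0 : 0 < y := by positivity
  have hy1 : y ≤ 1 / 2 := by
    refine le_trans ?_ hM.le
    rw [hy]
    gcongr
  set e1 := ‖ex N b w n‖ with he1
  set e2 := ‖exc N b (w - 2 * b.im) (n - 2)‖ with he2
  have he1v : e1 = Real.exp (d * (-b.re * w.re + b.im * w.im)) := norm_ex _ _ _ _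
  have he2v : e2 = Real.exp (d * (-b.re * (w.re - 2 * b.im) - b.im * w.im)) := by
    rw [he2, norm_exc]; simp [hd]
  have h1 : 1 ≤ y * e1 := by
    rw [hy, he1v, hK, ← Real.exp_add, ← Real.exp_add, Real.one_le_exp_iff]
    have := hw.1
    have : 0 ≤ d * b.im * (2 * b.re + w.im) := by
      have : 0 ≤ 2 * b.re + w.im := by linarith
      positivity
    nlinarith
  have h2 : 1 ≤ y * e2 := by
    rw [hy, he2v, hK, ← Real.exp_add, ← Real.exp_add, Real.one_le_exp_iff]
    have := hw.2
    have : 0 ≤ d * b.im * (4 * b.re - w.im) := by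
      have : 0 ≤ 4 * b.re - w.im := by linarith
      positivity
    nlinarith
  have he2pos : 0 < e2 := by rw [he2v]; positivity
  have he1pos : 0 < e1 := by rw [he1v]; positivity
  have h3 : 2 ≤ e2 := by nlinarith
  have hV : exc N b (w - 2 * b.im) (n - 2) ≠ 1 := by
    intro h
    rw [he2, h, norm_one] at h3
    norm_num at h3
  rw [P.hh_translate hw (by linarith) hV, norm_div, norm_mul]
  have h4 : ‖1 - ex N b w n‖ ≤ e1 * (1 + y) := by
    have := norm_sub_le 1 (ex N b w n)
    rw [norm_one] at this
    nlinarith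
  have h5 : e2 * (1 - y) ≤ ‖1 - exc N b (w - 2 * b.im) (n - 2)‖ := by
    have := norm_sub_norm_le (exc N b (w - 2 * b.im) (n - 2)) 1
    rw [norm_one, norm_sub_rev] at this
    nlinarith
  have h6 : 0 < e2 * (1 - y) := by have : 0 < 1 - y := by linarith
                                   positivity
  have h7 : (1 + y) / (1 - y) ≤ Real.exp (4 * y) := by
    rw [div_le_iff₀ (by linarith)]
    have := Real.add_one_le_exp (4 * y)
    nlinarith
  have h8 : e1 / e2 = Real.exp (-(2 * b.im * (d * (b.re - w.im)))) := by
    rw [he1v, he2v, ← Real.exp_sub]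
    congr 1; ring
  calc ‖1 - ex N b w n‖ * ‖hh N b w n‖ / ‖1 - exc N b (w - 2 * b.im) (n - 2)‖
      ≤ e1 * (1 + y) * ‖hh N b w n‖ / (e2 * (1 - y)) := by gcongr
    _ = ‖hh N b w n‖ * (e1 / e2) * ((1 + y) / (1 - y)) := by
        have : (1 - y) ≠ 0 := by linarith
        field_simp
    _ ≤ ‖hh N b w n‖ * (e1 / e2) * Real.exp (4 * y) := by gcongr
    _ = _ := by rw [h8, hy, mul_assoc 4 K]

/-- Global bound for `hh` on closed substrips. -/
theorem exists_hh_bound (P : Param N b) {v₁ v₂ : ℝ} (hv₁ : -b.re < v₁) (hv₂ : v₂ < 2 * b.re) :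
    ∃ C, 0 < C ∧ ∀ (n : ℤ) (w : ℂ), v₁ ≤ w.im → w.im ≤ v₂ →
      ‖hh N b w n‖ * min 1 ‖w‖ ≤
        C * Real.exp (2 * Real.pi / N * (b.re - w.im) * min w.re 0) := by
  have hβ := P.re
  have hs := P.im
  have hN := P.rpos
  have hpi := Real.pi_pos
  obtain ⟨M₁, hM₁, hR⟩ := P.exists_hh_bound_right
  obtain ⟨M₂, K, hM₂, hK, hL⟩ := P.exists_norm_hh_translate_le
  set d : ℝ := 2 * Real.pi / N with hd
  have hd0 : 0 < d := by positivity
  set c : ℝ := d * b.re with hc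
  have hc0 : 0 < c := by positivity
  set M : ℝ := M₁ + M₂ + 2 * b.im with hM
  have hcomp : IsCompact (Set.Icc (-M) M ×ℂ Set.Icc v₁ v₂) := isCompact_Icc.reProdIm isCompact_Icc
  obtain ⟨C₁, hC₁, hmid⟩ := P.exists_hr_bound hcomp (fun w hw => by
    obtain ⟨-, h1, h2⟩ := hw
    exact ⟨by linarith, by linarith⟩)
  set C₂ : ℝ := C₁ + ‖kap N b‖ with hC₂
  have hC₂0 : 0 < C₂ := by positivity
  have hmid' : ∀ (n : ℤ) (w : ℂ), v₁ ≤ w.im → w.im ≤ v₂ → |w.re| ≤ M →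
      ‖hh N b w n‖ * min 1 ‖w‖ ≤ C₂ := fun n w h1 h2 h3 => by
    have h4 := hmid n w ⟨abs_le.mp h3, h1, h2⟩
    have hmin : 0 ≤ min 1 ‖w‖ := by positivity
    calc ‖hh N b w n‖ * min 1 ‖w‖
        ≤ (‖hr N b w n‖ + ‖chi N n * kap N b / w‖) * min 1 ‖w‖ := by
          gcongr; exact norm_add_le _ _
      _ = ‖hr N b w n‖ * min 1 ‖w‖ + ‖chi N n‖ * ‖kap N b‖ * (min 1 ‖w‖ / ‖w‖) := by
          rw [norm_div, norm_mul]; ring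
      _ ≤ C₁ * 1 + 1 * ‖kap N b‖ * 1 := by
          have hchi : ‖chi N n‖ ≤ 1 := by rw [chi]; split_ifs <;> simp
          gcongr
          · exact min_le_left _ _
          · exact div_le_one_of_le₀ (min_le_right _ _) (norm_nonneg _)
      _ = C₂ := by rw [hC₂]; ring
  set A : ℝ := d * (2 * b.re) * M with hA
  have hM0 : 0 < M := by rw [hM]; linarith
  have hexpA : ∀ w : ℂ, v₁ ≤ w.im → w.im ≤ v₂ → -M ≤ w.re → w.re ≤ 0 →
      -A ≤ d * (b.re - w.im) * w.re := fun w h1 h2 h3 h4 => by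
    have : b.re - w.im ≤ 2 * b.re := by linarith
    have h5 : d * (b.re - w.im) * (-w.re) ≤ d * (2 * b.re) * M := by
      have h6 : d * (b.re - w.im) * (-w.re) ≤ d * (2 * b.re) * (-w.re) := by
        have : 0 ≤ -w.re := by linarith
        gcongr
      refine h6.trans ?_
      have : -w.re ≤ M := by linarith
      gcongr
    linarith
  -- Successive translations by `-2 Im b` cost factors `exp (K X)` with `X` decreasing
  -- geometrically. `K'` sums that series, so the extra factor `exp (-(K' * exp (c * w.re)))` in
  -- `hleft` absorbs the error of each inductive step exactly.
  set K' : ℝ := K / (1 - Real.exp (-(2 * b.im * c))) with hK'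
  have hden : 0 < 1 - Real.exp (-(2 * b.im * c)) := by
    have : Real.exp (-(2 * b.im * c)) < 1 := by
      rw [Real.exp_lt_one_iff]
      have : 0 < 2 * b.im * c := by positivity
      linarith
    linarith
  have hK'0 : 0 < K' := by positivity
  set C₀ : ℝ := C₂ * Real.exp (A + K') with hC₀
  have hC₀0 : 0 < C₀ := by positivity
  have hmin1 : ∀ w : ℂ, w.re ≤ -M₂ → min 1 ‖w‖ = 1 := fun w hw => by
    refine min_eq_left ?_
    have h1 := Complex.abs_re_le_norm w
    have h2 : -w.re ≤ |w.re| := neg_le_abs _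
    linarith
  have hleft : ∀ (k : ℕ) (n : ℤ) (w : ℂ), v₁ ≤ w.im → w.im ≤ v₂ →
      -M₂ - 2 * b.im * (k + 1) ≤ w.re → w.re ≤ -M₂ → ‖hh N b w n‖ ≤
        C₀ * Real.exp (d * (b.re - w.im) * w.re) * Real.exp (-(K' * Real.exp (c * w.re))) := by
    intro k
    induction k with
    | zero =>
      intro n w h1 h2 h3 h4
      have h5 : |w.re| ≤ M := by
        rw [abs_le]
        simp at h3
        constructor <;> linarith
      have h6 := hmid' n w h1 h2 h5
      rw [hmin1 w h4, mul_one] at h6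
      refine h6.trans ?_
      rw [hC₀, mul_assoc, mul_assoc, ← Real.exp_add, ← Real.exp_add]
      refine le_mul_of_one_le_right hC₂0.le ?_
      rw [Real.one_le_exp_iff]
      have h7 := hexpA w h1 h2 (abs_le.mp h5).1 (by linarith)
      have h8 : Real.exp (c * w.re) ≤ 1 := by
        rw [Real.exp_le_one_iff]
        nlinarith
      nlinarith
    | succ k ih =>
      intro n w h1 h2 h3 h4
      by_cases h5 : -M₂ - 2 * b.im * (k + 1) ≤ w.re
      · exact ih n w h1 h2 h5 h4
      push Not at h5
      have hk0 : (0 : ℝ) ≤ k := k.cast_nonneg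
      have h6 : (w + 2 * b.im).re = w.re + 2 * b.im := by simp
      have h7 : (w + 2 * b.im).im = w.im := by simp
      have h8 := ih (n + 2) (w + 2 * b.im) (by rw [h7]; exact h1) (by rw [h7]; exact h2)
        (by rw [h6]; push_cast at h3; linarith) (by rw [h6]; nlinarith)
      have h9 := hL (n + 2) (w + 2 * b.im) ⟨by rw [h7]; linarith, by rw [h7]; linarith⟩
        (by rw [h6]; nlinarith)
      rw [add_sub_cancel_right, add_sub_cancel_right] at h9
      refine h9.trans ?_
      rw [h6, h7] at *
      set a := d * (b.re - w.im) with ha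
      set X := Real.exp (c * (w.re + 2 * b.im)) with hX
      have h10 : Real.exp (c * w.re) = X * Real.exp (-(2 * b.im * c)) := by
        rw [hX, ← Real.exp_add]; congr 1; ring
      calc _ ≤ C₀ * Real.exp (a * (w.re + 2 * b.im)) * Real.exp (-(K' * X)) *
            Real.exp (-(2 * b.im * a)) * Real.exp (K * X) := by gcongr
        _ = C₀ * Real.exp (a * w.re) * Real.exp (-(K' * Real.exp (c * w.re))) := by
          simp only [mul_assoc C₀, ← Real.exp_add]
          rw [h10]
          congr 2
          have : K = K' * (1 - Real.exp (-(2 * b.im * c))) := by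
            rw [hK']; field_simp
          linear_combination X * this
  refine ⟨C₀ + C₂ * Real.exp A + 4, by positivity, fun n w h1 h2 => ?_⟩
  have hws : w ∈ strip b := ⟨by linarith, by linarith⟩
  by_cases hR' : M₁ < w.re
  · have h3 := hR n w hws hR'
    rw [min_eq_right (show (0 : ℝ) ≤ w.re by linarith), mul_zero, Real.exp_zero, mul_one]
    have : ‖hh N b w n‖ * min 1 ‖w‖ ≤ 4 * 1 := by
      gcongr
      exact min_le_left _ _
    have : 0 < C₂ * Real.exp A := by positivity
    linarith
  push Not at hR'
  by_cases hL' : w.re ≤ -M₂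
  · obtain ⟨k, hk⟩ := exists_nat_ge ((-M₂ - w.re) / (2 * b.im))
    rw [div_le_iff₀ (by positivity)] at hk
    have h3 := hleft k n w h1 h2 (by nlinarith) hL'
    rw [hmin1 w hL', mul_one, min_eq_left (by linarith)]
    refine h3.trans ?_
    have h4 : Real.exp (-(K' * Real.exp (c * w.re))) ≤ 1 := by
      rw [Real.exp_le_one_iff]
      have : 0 < K' * Real.exp (c * w.re) := by positivity
      linarith
    have h5 : C₀ ≤ C₀ + C₂ * Real.exp A + 4 := by
      have : 0 < C₂ * Real.exp A := by positivity
      linarith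
    calc _ ≤ C₀ * Real.exp (d * (b.re - w.im) * w.re) * 1 := by gcongr
      _ ≤ _ := by rw [mul_one]; gcongr
  · push Not at hL'
    have h3 := hmid' n w h1 h2 (by rw [abs_le]; constructor <;> linarith)
    refine h3.trans ?_
    have h4 : -A ≤ d * (b.re - w.im) * min w.re 0 := by
      rcases le_total w.re 0 with h | h
      · rw [min_eq_left h]
        exact hexpA w h1 h2 (by linarith) h
      · rw [min_eq_right h, mul_zero]
        have : 0 ≤ A := by positivity
        linarith
    have h5 : 1 ≤ Real.exp A * Real.exp (d * (b.re - w.im) * min w.re 0) := by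
      rw [← Real.exp_add, Real.one_le_exp_iff]; linarith
    have h6 : 0 ≤ Real.exp (d * (b.re - w.im) * min w.re 0) := (Real.exp_pos _).le
    nlinarith

end Param

/-! ### Contour integration in a horizontal strip. -/

/-- Cauchy's theorem for a strip. -/
theorem integral_line_eq_of_differentiable {g : ℂ → ℂ} {v₁ v₂ : ℝ} (h12 : v₁ ≤ v₂)
    (hg : ∀ z : ℂ, v₁ ≤ z.im → z.im ≤ v₂ → DifferentiableAt ℂ g z)
    {B : ℝ → ℝ} (hB : Tendsto B atTop (𝓝 0))
    (hdec : ∀ᶠ R in atTop, ∀ z : ℂ, v₁ ≤ z.im → z.im ≤ v₂ → |z.re| = R → ‖g z‖ ≤ B R)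
    (h1 : Integrable fun u : ℝ => g (u + v₁ * Complex.I))
    (h2 : Integrable fun u : ℝ => g (u + v₂ * Complex.I)) :
    ∫ u : ℝ, g (u + v₁ * Complex.I) = ∫ u : ℝ, g (u + v₂ * Complex.I) := by
  have hrect : ∀ R : ℝ, (∫ u in (-R)..R, g (u + v₁ * Complex.I)) -
      (∫ u in (-R)..R, g (u + v₂ * Complex.I)) =
      Complex.I • (∫ y in v₁..v₂, g ((-R : ℝ) + y * Complex.I)) -
        Complex.I • (∫ y in v₁..v₂, g (R + y * Complex.I)) := by
    intro R
    have := Complex.integral_boundary_rect_eq_zero_of_differentiableOn g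
      ⟨-R, v₁⟩ ⟨R, v₂⟩ (fun z hz => by
        have h3 : z.im ∈ Set.uIcc v₁ v₂ := hz.2
        rw [Set.uIcc_of_le h12] at h3
        exact (hg z h3.1 h3.2).differentiableWithinAt)
    linear_combination this
  have hside : ∀ s : ℝ → ℝ, (∀ R, |s R| = |R|) →
      Tendsto (fun R : ℝ => ∫ y in v₁..v₂, g (s R + y * Complex.I)) atTop (𝓝 0) := by
    intro s hs
    have hB' : Tendsto (fun R => B R * |v₂ - v₁|) atTop (𝓝 0) := by simpa using hB.mul_const _
    refine squeeze_zero_norm' ?_ hB'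
    filter_upwards [hdec, eventually_ge_atTop 0] with R hR hR0
    refine intervalIntegral.norm_integral_le_of_norm_le_const fun y hy => ?_
    rw [Set.uIoc_of_le h12] at hy
    refine hR _ ?_ ?_ ?_
    · simp; exact hy.1.le
    · simp; exact hy.2
    · simp [hs, abs_of_nonneg hR0]
  have hlim : Tendsto (fun R : ℝ => (∫ u in (-R)..R, g (u + v₁ * Complex.I)) -
      (∫ u in (-R)..R, g (u + v₂ * Complex.I))) atTop (𝓝 0) := by
    simp_rw [hrect]
    have := ((hside (fun R => -R) (by simp)).const_smul Complex.I).sub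
      ((hside (fun R => R) (by simp)).const_smul Complex.I)
    simpa using this
  have hlim' := (intervalIntegral_tendsto_integral h1 tendsto_neg_atTop_atBot tendsto_id).sub
    (intervalIntegral_tendsto_integral h2 tendsto_neg_atTop_atBot tendsto_id)
  exact sub_eq_zero.mp (tendsto_nhds_unique hlim' hlim)

theorem integrable_inv_sq_add_sq {v : ℝ} (hv : v ≠ 0) :
    Integrable fun u : ℝ => (u ^ 2 + v ^ 2)⁻¹ := by
  have h := (integrable_inv_one_add_sq.comp_div hv).const_mul (v ^ 2)⁻¹
  refine h.congr (.of_forall fun u => ?_)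
  have : u ^ 2 + v ^ 2 = v ^ 2 * (1 + (u / v) ^ 2) := by field_simp; ring
  simp only
  rw [this, mul_inv]

theorem integral_div_sq_add_sq {v : ℝ} (hv : v ≠ 0) :
    ∫ u : ℝ, v * (u ^ 2 + v ^ 2)⁻¹ = |v| / v * Real.pi := by
  have h : ∀ u : ℝ, v * (u ^ 2 + v ^ 2)⁻¹ = v⁻¹ * (1 + (u / v) ^ 2)⁻¹ := fun u => by
    have : u ^ 2 + v ^ 2 = v ^ 2 * (1 + (u / v) ^ 2) := by field_simp; ring
    rw [this, mul_inv]
    field_simp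
  simp_rw [h]
  rw [integral_const_mul, Measure.integral_comp_div (fun u : ℝ => (1 + u ^ 2)⁻¹),
    integral_univ_inv_one_add_sq, smul_eq_mul]
  ring

/-- A decaying kernel with residue one at the origin. -/
def ker (l : ℝ) (z : ℂ) : ℂ := 1 / z - 1 / (z + l * Complex.I)

theorem norm_line_sq (u v : ℝ) : ‖(u + v * Complex.I : ℂ)‖ ^ 2 = u ^ 2 + v ^ 2 := by
  rw [← Complex.normSq_eq_norm_sq, Complex.normSq_add_mul_I]

theorem line_ne_zero {v : ℝ} (hv : v ≠ 0) (u : ℝ) : (u + v * Complex.I : ℂ) ≠ 0 := by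
  intro h
  have := congrArg Complex.im h
  simp at this
  exact hv this

theorem ker_eq {l : ℝ} {z : ℂ} (h : z ≠ 0) (h' : z + l * Complex.I ≠ 0) :
    ker l z = l * Complex.I / (z * (z + l * Complex.I)) := by
  rw [ker]; field_simp; ring

theorem norm_ker_le {l : ℝ} {z : ℂ} (h0 : z.re ≠ 0) : ‖ker l z‖ ≤ |l| * (1 / |z.re| ^ 2) := by
  have h1 : z ≠ 0 := by rintro rfl; simp at h0
  have h2 : z + l * Complex.I ≠ 0 := fun h => h0 (by simpa using congrArg Complex.re h)
  rw [ker_eq h1 h2, norm_div, norm_mul, norm_mul, Complex.norm_I, Complex.norm_real, mul_one,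
    Real.norm_eq_abs, div_eq_mul_one_div, sq]
  have h3 := Complex.abs_re_le_norm z
  have h4 : |z.re| ≤ ‖z + l * Complex.I‖ := by
    simpa using Complex.abs_re_le_norm (z + l * Complex.I)
  have h5 : 0 < |z.re| := abs_pos.mpr h0
  gcongr

theorem integrable_ker {l v : ℝ} (hv : v ≠ 0) (hv' : v + l ≠ 0) :
    Integrable fun u : ℝ => ker l (u + v * Complex.I) := by
  have hd := ((integrable_inv_sq_add_sq hv).add (integrable_inv_sq_add_sq hv')).const_mul |l|
  have e : ∀ u : ℝ, (u + v * Complex.I : ℂ) + l * Complex.I = u + ((v + l : ℝ) : ℂ) * Complex.I :=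
    fun u => by push_cast; ring
  refine hd.mono' ?_ (.of_forall fun u => ?_)
  · refine Continuous.aestronglyMeasurable ?_
    unfold ker
    have h1 := line_ne_zero hv
    have h2 := line_ne_zero hv'
    simp_rw [e]
    fun_prop (disch := first | exact h1 | exact h2)
  · rw [ker_eq (line_ne_zero hv u) (by rw [e]; exact line_ne_zero hv' u), e]
    simp only [norm_div, norm_mul, Complex.norm_I, Complex.norm_real, mul_one, Pi.add_apply,
      Real.norm_eq_abs]
    rw [div_eq_mul_inv]
    gcongr
    rw [← norm_line_sq u v, ← norm_line_sq u (v + l)]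
    have ha := norm_pos_iff.mpr (line_ne_zero hv u)
    have hb := norm_pos_iff.mpr (line_ne_zero hv' u)
    rw [mul_inv, ← inv_pow, ← inv_pow]
    nlinarith [sq_nonneg (‖(u + v * Complex.I : ℂ)‖⁻¹ - ‖(u + ((v + l : ℝ) : ℂ) * Complex.I :
      ℂ)‖⁻¹),
      sq_nonneg (‖(u + v * Complex.I : ℂ)‖⁻¹ + ‖(u + ((v + l : ℝ) : ℂ) * Complex.I : ℂ)‖⁻¹)]

/-- Averaging over `u ↦ -u` turns each simple fraction into a Poisson kernel, whose integral sees
only the sign of the height. The two fractions cancel above the real axis and add up to `2πi` below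
it. -/
theorem integral_ker {l v : ℝ} (hv : v ≠ 0) (hv' : 0 < v + l) :
    ∫ u : ℝ, ker l (u + v * Complex.I) = (1 - |v| / v) * Real.pi * Complex.I := by
  have hint := integrable_ker hv hv'.ne'
  have hneg : ∫ u : ℝ, ker l ((-u : ℝ) + v * Complex.I) = ∫ u : ℝ, ker l (u + v * Complex.I) :=
    integral_neg_eq_self (fun u : ℝ => ker l (u + v * Complex.I)) volume
  have hsum : ∀ u : ℝ, ker l (u + v * Complex.I) + ker l ((-u : ℝ) + v * Complex.I) =
      (((v + l) * (u ^ 2 + (v + l) ^ 2)⁻¹ - v * (u ^ 2 + v ^ 2)⁻¹ : ℝ) : ℂ) *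
        (2 * Complex.I) := by
    intro u
    have key : ∀ a : ℝ, a ≠ 0 → 1 / (u + a * Complex.I : ℂ) + 1 / ((-u : ℝ) + a * Complex.I : ℂ) =
        -((a * (u ^ 2 + a ^ 2)⁻¹ : ℝ) : ℂ) * (2 * Complex.I) := by
      intro a ha
      have h1 := line_ne_zero ha u
      have h2 := line_ne_zero ha (-u)
      have h3 : (u : ℂ) ^ 2 + a ^ 2 ≠ 0 := by
        have : u ^ 2 + a ^ 2 ≠ 0 := by positivity
        exact_mod_cast this
      push_cast at h2 ⊢
      rw [← div_eq_mul_inv]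
      field_simp
      linear_combination (2 * a ^ 3 * Complex.I) * Complex.I_sq
    have h1 := key v hv
    have h2 := key (v + l) hv'.ne'
    have e : ∀ x : ℂ, x + v * Complex.I + l * Complex.I = x + ((v + l : ℝ) : ℂ) * Complex.I :=
      fun x => by push_cast; ring
    rw [ker, ker, e, e, Complex.ofReal_sub]
    linear_combination h1 - h2
  have hint' : Integrable fun u : ℝ => ker l ((-u : ℝ) + v * Complex.I) := hint.comp_neg
  have h2 : 2 * ∫ u : ℝ, ker l (u + v * Complex.I) =
      ∫ u : ℝ, (ker l (u + v * Complex.I) + ker l ((-u : ℝ) + v * Complex.I)) := by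
    rw [integral_add hint hint', hneg]; ring
  simp_rw [hsum] at h2
  rw [integral_mul_const, integral_complex_ofReal, integral_sub
    ((integrable_inv_sq_add_sq hv'.ne').const_mul _) ((integrable_inv_sq_add_sq hv).const_mul _),
    integral_div_sq_add_sq hv, integral_div_sq_add_sq hv'.ne', abs_of_pos hv',
    div_self hv'.ne'] at h2
  push_cast at h2
  linear_combination (1 / 2 : ℂ) * h2

/-- The residue theorem for a strip and a function with at most two simple poles, on the real
axis. -/
theorem integral_line_sub_integral_line {f g : ℂ → ℂ} {v₁ v₂ : ℝ} (hv₁ : v₁ < 0) (hv₂ : 0 < v₂)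
    {p₁ p₂ : ℝ} {c₁ c₂ : ℂ}
    (hg : ∀ z : ℂ, v₁ ≤ z.im → z.im ≤ v₂ → DifferentiableAt ℂ g z)
    (hf : ∀ z : ℂ, v₁ ≤ z.im → z.im ≤ v₂ → z ≠ p₁ → z ≠ p₂ →
      f z = g z + c₁ / (z - p₁) + c₂ / (z - p₂))
    {B : ℝ → ℝ} (hB : Tendsto B atTop (𝓝 0))
    (hdec : ∀ᶠ R in atTop, ∀ z : ℂ, v₁ ≤ z.im → z.im ≤ v₂ → |z.re| = R → ‖f z‖ ≤ B R)
    (h1 : Integrable fun u : ℝ => f (u + v₁ * Complex.I))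
    (h2 : Integrable fun u : ℝ => f (u + v₂ * Complex.I)) :
    (∫ u : ℝ, f (u + v₁ * Complex.I)) - ∫ u : ℝ, f (u + v₂ * Complex.I) =
      2 * Real.pi * Complex.I * (c₁ + c₂) := by
  -- The poles are replaced by poles at height `-l = v₁ - 1`, below the strip. The difference is a
  -- multiple of `ker`, which, unlike a bare `1 / z`, is integrable along horizontal lines off its
  -- poles.
  set l : ℝ := 1 - v₁ with hl
  have hl0 : 0 < l := by linarith
  set G : ℂ → ℂ := fun z =>
    g z + c₁ / (z - p₁ + l * Complex.I) + c₂ / (z - p₂ + l * Complex.I) with hG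
  have hne : ∀ (z : ℂ) (p : ℝ), v₁ ≤ z.im → z - p + l * Complex.I ≠ 0 := fun z p hz h => by
    have := congrArg Complex.im h
    simp at this
    linarith
  have hGd : ∀ z : ℂ, v₁ ≤ z.im → z.im ≤ v₂ → DifferentiableAt ℂ G z := fun z h3 h4 => by
    have h5 := hg z h3 h4
    have h6 := hne z p₁ h3
    have h7 := hne z p₂ h3
    fun_prop (disch := assumption)
  have hGf : ∀ z : ℂ, v₁ ≤ z.im → z.im ≤ v₂ → z ≠ p₁ → z ≠ p₂ →
      G z = f z - c₁ * ker l (z - p₁) - c₂ * ker l (z - p₂) := fun z h3 h4 h5 h6 => by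
    rw [hf z h3 h4 h5 h6, ker, ker]
    simp only [hG]
    ring
  have hline : ∀ v : ℝ, v ≠ 0 → v₁ ≤ v → v ≤ v₂ →
      Integrable (fun u : ℝ => f (u + v * Complex.I)) →
      Integrable (fun u : ℝ => G (u + v * Complex.I)) ∧
      ∫ u : ℝ, G (u + v * Complex.I) = (∫ u : ℝ, f (u + v * Complex.I)) -
        (c₁ + c₂) * ((1 - |v| / v) * Real.pi * Complex.I) := by
    intro v hv0 hv1 hv2 hint
    have hk : ∀ p : ℝ, Integrable (fun u : ℝ => ker l (u + v * Complex.I - p)) ∧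
        ∫ u : ℝ, ker l (u + v * Complex.I - p) = (1 - |v| / v) * Real.pi * Complex.I := by
      intro p
      have e : (fun u : ℝ => ker l (u + v * Complex.I - p)) =
          fun u : ℝ => (fun t : ℝ => ker l (t + v * Complex.I)) (u - p) := by
        ext u; simp only; congr 1; push_cast; ring
      rw [e]
      refine ⟨(integrable_ker hv0 (by linarith)).comp_sub_right p, ?_⟩
      rw [integral_sub_right_eq_self (fun t : ℝ => ker l (t + v * Complex.I)) p,
        integral_ker hv0 (by linarith)]
    have e : (fun u : ℝ => G (u + v * Complex.I)) = fun u : ℝ => f (u + v * Complex.I) -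
        c₁ * ker l (u + v * Complex.I - p₁) - c₂ * ker l (u + v * Complex.I - p₂) := by
      ext u
      have hp : ∀ p : ℝ, (u + v * Complex.I : ℂ) ≠ p := fun p h => by
        have := congrArg Complex.im h
        simp at this
        exact hv0 this
      exact hGf _ (by simpa using hv1) (by simpa using hv2) (hp _) (hp _)
    have i1 := (hk p₁).1.const_mul c₁
    have i2 := (hk p₂).1.const_mul c₂
    rw [e]
    refine ⟨(hint.sub i1).sub i2, ?_⟩
    have i3 : Integrable fun u : ℝ =>
        f (u + v * Complex.I) - c₁ * ker l (u + v * Complex.I - p₁) := hint.sub i1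
    rw [integral_sub i3 i2, integral_sub hint i1, integral_const_mul, integral_const_mul,
      (hk p₁).2, (hk p₂).2]
    ring
  obtain ⟨j1, e1⟩ := hline v₁ hv₁.ne le_rfl (hv₁.trans hv₂).le h1
  obtain ⟨j2, e2⟩ := hline v₂ hv₂.ne' (hv₁.trans hv₂).le le_rfl h2
  have hdec' : ∀ᶠ R in atTop, ∀ z : ℂ, v₁ ≤ z.im → z.im ≤ v₂ → |z.re| = R →
      ‖G z‖ ≤ B R + ‖c₁‖ * (l * (1 / (R - |p₁|) ^ 2)) + ‖c₂‖ * (l * (1 / (R - |p₂|) ^ 2)) := by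
    filter_upwards [hdec, eventually_gt_atTop |p₁|, eventually_gt_atTop |p₂|] with R hR hp1 hp2
    intro z h3 h4 h5
    have hkb : ∀ p : ℝ, |p| < R → z ≠ p ∧ ‖ker l (z - p)‖ ≤ l * (1 / (R - |p|) ^ 2) := by
      intro p hp
      have hlow : R - |p| ≤ |(z - p).re| := by
        rw [← h5]; simpa using abs_sub_abs_le_abs_sub z.re p
      have hpos : 0 < R - |p| := by linarith
      refine ⟨?_, ?_⟩
      · rintro rfl
        simp at hlow
        linarith
      · refine (norm_ker_le (abs_pos.mp (hpos.trans_le hlow))).trans ?_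
        rw [abs_of_pos hl0]
        gcongr
    rw [hGf z h3 h4 (hkb p₁ hp1).1 (hkb p₂ hp2).1]
    refine (norm_sub_le _ _).trans (add_le_add ((norm_sub_le _ _).trans (add_le_add (hR z h3 h4 h5)
      ?_)) ?_)
    · rw [norm_mul]; gcongr; exact (hkb p₁ hp1).2
    · rw [norm_mul]; gcongr; exact (hkb p₂ hp2).2
  have hsq : ∀ p : ℝ, Tendsto (fun R : ℝ => 1 / (R - |p|) ^ 2) atTop (𝓝 0) := fun p => by
    have h3 : Tendsto (fun R : ℝ => (R - |p|) ^ 2) atTop atTop :=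
      (tendsto_pow_atTop two_ne_zero).comp (tendsto_atTop_add_const_right _ _ tendsto_id)
    simp_rw [one_div]
    exact h3.inv_tendsto_atTop
  have hB' : Tendsto (fun R => B R + ‖c₁‖ * (l * (1 / (R - |p₁|) ^ 2)) +
      ‖c₂‖ * (l * (1 / (R - |p₂|) ^ 2))) atTop (𝓝 0) := by
    have := (hB.add (((hsq p₁).const_mul l).const_mul ‖c₁‖)).add
      (((hsq p₂).const_mul l).const_mul ‖c₂‖)
    simpa using this
  have hfin := integral_line_eq_of_differentiable (hv₁.trans hv₂).le hGd hB' hdec' j1 j2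
  rw [e1, e2, abs_of_neg hv₁, abs_of_pos hv₂] at hfin
  have q1 : (v₁ : ℂ) / v₁ = 1 := div_self (by exact_mod_cast hv₁.ne)
  have q2 : (v₂ : ℂ) / v₂ = 1 := div_self (by exact_mod_cast hv₂.ne')
  push_cast at hfin
  rw [neg_div, q1, q2] at hfin
  linear_combination hfin

/-! ### Eigenstates as meromorphic functions and their difference equations. -/

/-- The constant phase of the eigenstate. -/
def cph (N : ℕ) (m mr : ℤ) : ℂ :=
  Complex.exp (Complex.I * Real.pi * (m : ℂ) ^ 2 / N + Complex.I * Real.pi * (mr : ℂ) ^ 2 / N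
      + Complex.I * Real.pi * (mr : ℂ) ^ 2 - Complex.I * Real.pi * m)

/-- The Gaussian factor of the eigenstate. -/
def gau (N : ℕ) (b w : ℂ) : ℂ :=
  Complex.exp (-(Complex.I * Real.pi * (w - Complex.I * b.re) ^ 2 / N))

/-- The eigenstate as a meromorphic function of the rescaled variable. -/
def wave (N : ℕ) (b : ℂ) (μr : ℝ) (mr : ℤ) (w : ℂ) (m : ℤ) : ℂ :=
  cph N m mr * gau N b w * hh N b (w - μr) (m - mr) * hh N b (w + μr) (m + mr)

/-- The reflection of `wave` in the real axis. -/
def waveC (N : ℕ) (b : ℂ) (μr : ℝ) (mr : ℤ) (w : ℂ) (m : ℤ) : ℂ :=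
  conj (wave N b μr mr (conj w) m)

/-- The eigenvalue `E + E⁻¹`. -/
def lam (N : ℕ) (b w : ℂ) (n : ℤ) : ℂ := ex N b w n + (ex N b w n)⁻¹

theorem norm_cph (N : ℕ) (m mr : ℤ) : ‖cph N m mr‖ = 1 := by
  have : cph N m mr = Complex.exp ((Real.pi * (m : ℝ) ^ 2 / N + Real.pi * (mr : ℝ) ^ 2 / N
      + Real.pi * (mr : ℝ) ^ 2 - Real.pi * m : ℝ) * Complex.I) := by
    rw [cph]; congr 1; push_cast; ring
  rw [this, Complex.norm_exp_ofReal_mul_I]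

theorem norm_gau (N : ℕ) (b w : ℂ) :
    ‖gau N b w‖ = Real.exp (-(2 * Real.pi / N * (b.re - w.im) * w.re)) := by
  rw [gau, Complex.norm_exp]
  congr 1
  have : -(Complex.I * Real.pi * (w - Complex.I * b.re) ^ 2 / N) =
      ((Real.pi / N : ℝ) : ℂ) * (-Complex.I * (w - Complex.I * b.re) ^ 2) := by
    push_cast; ring
  rw [this, Complex.re_ofReal_mul]
  simp [Complex.mul_re, pow_two]
  ring

theorem differentiable_gau (N : ℕ) (b : ℂ) : Differentiable ℂ (gau N b) := by
  unfold gau; fun_prop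

theorem cph_neg (N : ℕ) (m mr : ℤ) : cph N m (-mr) = cph N m mr := by
  simp [cph]

namespace Param
variable {N : ℕ} {b : ℂ}

/-- Moving the origin by `i Re b` multiplies `ex` by `q⁻¹`, which turns odd powers of `q` into
integer powers of the nome; `b⁻¹ = conj b` makes the denominator a conjugate symbol. -/
theorem gam_eq (P : Param N b) (x : ℂ) (n : ℤ) :
    gam N b x n = hq N b (x * (Real.sqrt N : ℂ) + Complex.I * b.re) n := by
  have hN := P.ne
  have h1 := add_conj (b := b)
  have h2 := P.mul_conj
  rw [gam, Db, hq, conj_poch P.nome_lt, conj_nome, conj_ex, Complex.conj_conj, poch, poch,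
    P.inv_eq]
  congr 1
  · refine tprod_congr fun j => ?_
    rw [q, nome, ex, ← Complex.exp_nat_mul, ← Complex.exp_nat_mul, ← Complex.exp_add,
      ← Complex.exp_add, ← Complex.exp_add]
    congr 2
    push_cast
    linear_combination (2 * Real.pi / N * b * x * (Real.sqrt N : ℂ)) * Complex.I_sq +
      (-(Real.pi / N) * Complex.I) * (b * h1 - h2)
  · refine tprod_congr fun j => ?_
    rw [qt, exc, P.inv_eq, ← Complex.exp_neg, ← Complex.exp_nat_mul, ← Complex.exp_nat_mul,
      ← Complex.exp_add, ← Complex.exp_add]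
    congr 2
    push_cast
    linear_combination (2 * Real.pi / N * conj b * x * (Real.sqrt N : ℂ)) * Complex.I_sq -
      (Real.pi / N * Complex.I) * (conj b * h1 - h2)

theorem sqrt_ne (P : Param N b) : (Real.sqrt N : ℂ) ≠ 0 := by
  have := Real.sqrt_pos.mpr P.rpos
  exact_mod_cast this.ne'

theorem sqrt_sq (P : Param N b) : (Real.sqrt N : ℂ) ^ 2 = N := by
  have := Real.sq_sqrt P.rpos.le
  exact_mod_cast congrArg (Complex.ofReal) this

/-- `√N ω'' = i Re b` is exactly the shift built into `hq`. The bounds on `ε` put both arguments in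
`0 < Im < Re b`, where `hh` and `hq` agree. -/
theorem psi_eq (P : Param N b) {ε : ℝ} (hε : 0 < ε) (hε' : ε < b.re / Real.sqrt N) (μr : ℝ) (mr : ℤ)
    (μ : ℝ)
    (m : ℤ) : psi N b ε μr mr μ m =
      wave N b μr mr (μ + (ε * Real.sqrt N : ℝ) * Complex.I) m := by
  have hs := Real.sqrt_pos.mpr P.rpos
  have hs' := P.sqrt_ne
  have h1 : 0 < ε * Real.sqrt N := by positivity
  have h2 : ε * Real.sqrt N < b.re := by rwa [lt_div_iff₀ hs] at hε'
  have hom : om N b * (Real.sqrt N : ℂ) = Complex.I * b.re := by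
    rw [om, cb, P.inv_eq, add_conj]
    field_simp
  set w : ℂ := μ + (ε * Real.sqrt N : ℝ) * Complex.I with hw
  have hz : ((μ : ℂ) / (Real.sqrt N : ℂ) - om N b + Complex.I * ε) * (Real.sqrt N : ℂ) =
      w - Complex.I * b.re := by
    rw [add_mul, sub_mul, hom, div_mul_cancel₀ _ hs', hw]
    push_cast; ring
  have im1 : (w - μr).im = ε * Real.sqrt N := by simp [hw]
  have im2 : (w + μr).im = ε * Real.sqrt N := by simp [hw]
  have g1 : gam N b (-((μr : ℂ) / (Real.sqrt N : ℂ)) +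
      ((μ : ℂ) / (Real.sqrt N : ℂ) - om N b + Complex.I * ε)) (m - mr) =
      hh N b (w - μr) (m - mr) := by
    rw [P.hh_eq_hq (by rwa [im1]) (by rwa [im1]), P.gam_eq, add_mul, hz, neg_mul,
      div_mul_cancel₀ _ hs']
    congr 1; ring
  have g2 : gam N b ((μr : ℂ) / (Real.sqrt N : ℂ) +
      ((μ : ℂ) / (Real.sqrt N : ℂ) - om N b + Complex.I * ε)) (mr + m) =
      hh N b (w + μr) (m + mr) := by
    rw [P.hh_eq_hq (by rwa [im2]) (by rwa [im2]), P.gam_eq, add_mul, hz,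
      div_mul_cancel₀ _ hs', add_comm mr m]
    congr 1; ring
  have hexp : Complex.exp (Complex.I * Real.pi * (m : ℂ) ^ 2 / N +
      Complex.I * Real.pi * (mr : ℂ) ^ 2 / N
      + Complex.I * Real.pi * (mr : ℂ) ^ 2 - Complex.I * Real.pi * m - Complex.I * Real.pi *
        ((μ : ℂ) / (Real.sqrt N : ℂ) - om N b + Complex.I * ε) ^ 2) =
      cph N m mr * gau N b w := by
    rw [cph, gau, ← Complex.exp_add]
    congr 1
    rw [← hz, mul_pow, P.sqrt_sq]
    have := P.ne
    field_simp
    ring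
  simp only [psi]
  rw [g1, g2, hexp, wave]

theorem cph_int (P : Param N b) (m mr k : ℤ) : cph N (m + k * N) mr = cph N m mr := by
  rw [cph, cph, Complex.exp_eq_exp_iff_exists_int]
  obtain ⟨l, hl⟩ : Even (k * (k - 1)) := Int.even_mul_pred_self k
  have hl' : (k : ℂ) * (k - 1) = l + l := by exact_mod_cast congrArg (Int.cast : ℤ → ℂ) hl
  have := P.ne
  refine ⟨m * k + N * l, ?_⟩
  push_cast
  field_simp
  linear_combination (N : ℂ) ^ 2 * hl'

theorem cph_int' (P : Param N b) (m mr k : ℤ) : cph N m (mr + k * N) = cph N m mr := by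
  rw [cph, cph, Complex.exp_eq_exp_iff_exists_int]
  obtain ⟨l, hl⟩ : Even ((N : ℤ) * (N + 1)) := Int.even_mul_succ_self _
  have hl' : (N : ℂ) * (N + 1) = l + l := by exact_mod_cast congrArg (Int.cast : ℤ → ℂ) hl
  have := P.ne
  refine ⟨mr * k + mr * k * N + k ^ 2 * l, ?_⟩
  push_cast
  field_simp
  linear_combination (k : ℂ) ^ 2 * N * hl'

theorem wave_int (P : Param N b) (μr : ℝ) (mr : ℤ) (w : ℂ) (m k : ℤ) :
    wave N b μr mr w (m + k * N) = wave N b μr mr w m := by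
  rw [wave, P.cph_int, show m + k * N - mr = m - mr + k * N by ring,
    show m + k * N + mr = m + mr + k * N by ring, P.hh_int, P.hh_int, wave]

/-- Global bound for the eigenstates on closed substrips. -/
theorem exists_wave_bound (P : Param N b) {v₁ v₂ : ℝ} (hv₁ : -b.re < v₁) (hv₂ : v₂ < 2 * b.re) :
    ∃ C, 0 < C ∧ ∀ (μr : ℝ) (mr m : ℤ) (w : ℂ), v₁ ≤ w.im → w.im ≤ v₂ →
      ‖wave N b μr mr w m‖ * (min 1 ‖w - μr‖ * min 1 ‖w + μr‖) ≤
        C * Real.exp (-(2 * Real.pi / N * (b.re - w.im) * max |w.re| |μr|)) := by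
  obtain ⟨C, hC, h⟩ := P.exists_hh_bound hv₁ hv₂
  refine ⟨C * C, by positivity, fun μr mr m w h1 h2 => ?_⟩
  have e1 := h (m - mr) (w - μr) (by simpa using h1) (by simpa using h2)
  have e2 := h (m + mr) (w + μr) (by simpa using h1) (by simpa using h2)
  simp only [Complex.sub_im, Complex.add_im, Complex.ofReal_im, sub_zero, add_zero, Complex.sub_re,
    Complex.add_re, Complex.ofReal_re] at e1 e2
  set a := 2 * Real.pi / N * (b.re - w.im) with ha
  -- The term `-w.re` is the Gaussian exponent; combined with the one-sided exponents of the two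
  -- dilogarithms it gives decay in both directions.
  have hmax : min (w.re - μr) 0 + min (w.re + μr) 0 - w.re = -max |w.re| |μr| := by
    rcases le_total w.re 0 with h3 | h3 <;> rcases le_total μr 0 with h4 | h4 <;>
      simp only [abs_of_nonneg, abs_of_nonpos, h3, h4] <;>
      simp only [min_def, max_def] <;> split_ifs <;> linarith
  calc ‖wave N b μr mr w m‖ * (min 1 ‖w - μr‖ * min 1 ‖w + μr‖)
      = Real.exp (-(a * w.re)) * (‖hh N b (w - μr) (m - mr)‖ * min 1 ‖w - μr‖) *
        (‖hh N b (w + μr) (m + mr)‖ * min 1 ‖w + μr‖) := by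
        rw [wave, norm_mul, norm_mul, norm_mul, norm_cph, norm_gau]; ring
    _ ≤ Real.exp (-(a * w.re)) * (C * Real.exp (a * min (w.re - μr) 0)) *
        (C * Real.exp (a * min (w.re + μr) 0)) := by gcongr
    _ = C * C * (Real.exp (-(a * w.re)) * Real.exp (a * min (w.re - μr) 0) *
        Real.exp (a * min (w.re + μr) 0)) := by ring
    _ = _ := by
        rw [← Real.exp_add, ← Real.exp_add]
        congr 2
        linear_combination a * hmax

theorem norm_waveC (μr : ℝ) (mr : ℤ) (w : ℂ) (m : ℤ) :
    ‖waveC N b μr mr w m‖ = ‖wave N b μr mr (conj w) m‖ := Complex.norm_conj _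

theorem analyticAt_hh (P : Param N b) {w : ℂ} (hw : w ∈ strip b) {n : ℤ} (h : w ≠ 0) :
    AnalyticAt ℂ (fun z => hh N b z n) w :=
  (P.analyticAt_hr hw n).fun_add (analyticAt_const.fun_div analyticAt_id h)

theorem add_real_mem_strip {w : ℂ} (hw : w ∈ strip b) (x : ℝ) : w + x ∈ strip b := by
  simpa [strip] using hw

theorem sub_real_mem_strip {w : ℂ} (hw : w ∈ strip b) (x : ℝ) : w - x ∈ strip b := by
  simpa [strip] using hw

theorem analyticAt_wave (P : Param N b) {μr : ℝ} {mr : ℤ} {w : ℂ} {m : ℤ} (hw : w ∈ strip b)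
    (h1 : w ≠ μr)
    (h2 : w ≠ -μr) : AnalyticAt ℂ (fun z => wave N b μr mr z m) w := by
  have a1 : AnalyticAt ℂ (fun z => hh N b (z - μr) (m - mr)) w :=
    (P.analyticAt_hh (sub_real_mem_strip hw μr) (sub_ne_zero.mpr h1)).comp_of_eq
      (f := fun z => z - (μr : ℂ)) (by fun_prop) rfl
  have a2 : AnalyticAt ℂ (fun z => hh N b (z + μr) (m + mr)) w :=
    (P.analyticAt_hh (add_real_mem_strip hw μr) (fun h => h2 (eq_neg_of_add_eq_zero_left
      h))).comp_of_eq
      (f := fun z => z + (μr : ℂ)) (by fun_prop) rfl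
  exact ((analyticAt_const.fun_mul ((differentiable_gau N b).analyticAt w)).fun_mul a1).fun_mul a2

theorem analyticAt_waveC (P : Param N b) {μr : ℝ} {mr : ℤ} {w : ℂ} {m : ℤ} (hw : conj w ∈ strip b)
    (h1 : w ≠ μr)
    (h2 : w ≠ -μr) : AnalyticAt ℂ (fun z => waveC N b μr mr z m) w := by
  refine AnalyticAt.conj_conj (P.analyticAt_wave hw ?_ ?_)
  · intro h
    exact h1 (by simpa using congrArg conj h)
  · intro h
    exact h2 (by simpa using congrArg conj h)

theorem ex_add (w z : ℂ) (n k : ℤ) : ex N b (w + z) (n + k) = ex N b w n * ex N b z k := by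
  rw [ex, ex, ex, ← Complex.exp_add]; congr 1; push_cast; ring

theorem ex_sub (w z : ℂ) (n k : ℤ) : ex N b (w - z) (n - k) = ex N b w n * (ex N b z k)⁻¹ := by
  rw [ex, ex, ex, ← Complex.exp_neg, ← Complex.exp_add]; congr 1; push_cast; ring

theorem exc_add (w z : ℂ) (n k : ℤ) : exc N b (w + z) (n + k) = exc N b w n * exc N b z k := by
  rw [exc, exc, exc, ← Complex.exp_add]; congr 1; push_cast; ring

theorem exc_sub (w z : ℂ) (n k : ℤ) :
    exc N b (w - z) (n - k) = exc N b w n * (exc N b z k)⁻¹ := by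
  rw [exc, exc, exc, ← Complex.exp_neg, ← Complex.exp_add]; congr 1; push_cast; ring

/-- The constants produced by the squares in the Gaussian and in the phase cancel, and the sign
comes from the term `-iπm`. -/
theorem cph_gau_shift (P : Param N b) (w : ℂ) (m mr : ℤ) :
    cph N (m - 1) mr * gau N b (w + Complex.I * b) = -(ex N b w m)⁻¹ * (cph N m mr * gau N b w) :=
      by
  have hneg : ∀ x : ℂ, -Complex.exp x = Complex.exp (x + Real.pi * Complex.I) := fun x => by
    rw [Complex.exp_add, Complex.exp_pi_mul_I]; ring
  rw [cph, gau, cph, gau, ex, ← Complex.exp_neg, ← Complex.exp_add, ← Complex.exp_add, neg_mul,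
    ← Complex.exp_add, hneg]
  congr 1
  have h1 := add_conj (b := b)
  have h2 := P.mul_conj
  have h3 := P.ne
  push_cast
  linear_combination
    (-(2 * Real.pi / N) * b * w + Real.pi / N * Complex.I * (2 * b * b.re - b ^ 2)) *
    Complex.I_sq - (Real.pi / N * Complex.I) * (h2 - b * h1)

theorem cph_gau_shift' (P : Param N b) (w : ℂ) (m mr : ℤ) :
    cph N (m + 1) mr * gau N b (w + Complex.I * conj b) =
      -(exc N b w m)⁻¹ * (cph N m mr * gau N b w) := by
  have hneg : ∀ x : ℂ, -Complex.exp x = Complex.exp (x - Real.pi * Complex.I) := fun x => by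
    rw [Complex.exp_sub, Complex.exp_pi_mul_I]; ring
  rw [cph, gau, cph, gau, exc, ← Complex.exp_neg, ← Complex.exp_add, ← Complex.exp_add, neg_mul,
    ← Complex.exp_add, hneg]
  congr 1
  have h1 := add_conj (b := b)
  have h2 := P.mul_conj
  have h3 := P.ne
  push_cast
  linear_combination (-(2 * Real.pi / N) * conj b * w +
    Real.pi / N * Complex.I * (2 * conj b * b.re - conj b ^ 2)) *
    Complex.I_sq - (Real.pi / N * Complex.I) * (h2 - conj b * h1)

/-- With `E = ex w m` and `E_r = ex μr mr`, the three factors multiply to `-E⁻¹ (1 - E / E_r) (1 - E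
E_r) = (E_r + E_r⁻¹) - (E + E⁻¹)`. The label enters the multiplier only through its eigenvalue. -/
theorem wave_shift (P : Param N b) {μr : ℝ} {mr : ℤ} {w : ℂ} (m : ℤ) (hw : -b.re < w.im)
    (hw' : w.im < b.re)
    (h0 : w.im ≠ 0) :
    wave N b μr mr (w + Complex.I * b) (m - 1) =
      (lam N b μr mr - lam N b w m) * wave N b μr mr w m := by
  have hβ := P.re
  have key : ∀ (x : ℝ) (n : ℤ), hh N b (w + x + Complex.I * b) (n - 1) =
      (1 - ex N b (w + x) n) * hh N b (w + x) n := fun x n => by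
    have i1 : (w + x).im = w.im := by simp
    have i2 : (w + x + Complex.I * b).im = w.im + b.re := by simp
    refine P.hh_shift ⟨by rw [i1]; linarith, by rw [i1]; linarith⟩ (Or.inl ?_)
      ⟨by rw [i2]; linarith, by rw [i2]; linarith⟩ (Or.inl ?_)
    · intro h; rw [h] at i1; simp at i1; exact h0 i1.symm
    · intro h; rw [h] at i2; simp at i2; linarith
  have k1 := key (-μr) (m - mr)
  have k2 := key μr (m + mr)
  push_cast at k1
  rw [← sub_eq_add_neg, ex_sub] at k1
  rw [ex_add] at k2
  rw [wave, P.cph_gau_shift, show w + Complex.I * b - μr = w - μr + Complex.I * b by ring,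
    show w + Complex.I * b + μr = w + μr + Complex.I * b by ring,
    show m - 1 - mr = m - mr - 1 by ring, show m - 1 + mr = m + mr - 1 by ring, k1, k2, wave, lam,
    lam]
  have e1 := ex_ne_zero N b w m
  have e2 := ex_ne_zero N b μr mr
  field_simp
  ring

theorem exc_ne_one (P : Param N b) {w : ℂ} {n : ℤ} (h1 : 0 ≤ w.im) (h2 : w.im < b.re) (h0 : w ≠ 0) :
    exc N b w n ≠ 1 := by
  intro h
  have h' : nome N b ^ 0 * ex N b (conj w) n = 1 := by
    rw [pow_zero, one_mul, ← conj_exc, h, map_one]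
  obtain ⟨k, hk⟩ := P.im_of_pow_mul_ex_eq_one h'
  have h3 : w.im = (-(n + k * N) : ℤ) * b.re := by
    have := congrArg Complex.im hk
    simp at this
    push_cast
    linarith
  rcases h1.eq_or_lt with h4 | h4
  · exact h0 ((P.exc_eq_one_iff h4.symm).mp h).1
  · exact P.ne_int_mul 0 (by simpa using h4) (by simpa using h2) _ h3

theorem wave_shift' (P : Param N b) {μr : ℝ} {mr : ℤ} {w : ℂ} (m : ℤ) (hw : 0 ≤ w.im)
    (hw' : w.im < b.re)
    (h1 : w ≠ μr) (h2 : w ≠ -μr) :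
    wave N b μr mr (w + Complex.I * conj b) (m + 1) =
      (exc N b μr mr + (exc N b μr mr)⁻¹ - (exc N b w m + (exc N b w m)⁻¹)) *
        wave N b μr mr w m := by
  have hβ := P.re
  have key : ∀ (x : ℝ) (n : ℤ), w + x ≠ 0 → hh N b (w + x + Complex.I * conj b) (n + 1) =
      (1 - exc N b (w + x) n) * hh N b (w + x) n := fun x n hne => by
    have i1 : (w + x).im = w.im := by simp
    have i2 : (w + x + Complex.I * conj b).im = w.im + b.re := by simp
    refine P.hh_shift' ⟨by rw [i1]; linarith, by rw [i1]; linarith⟩ (Or.inl hne)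
      ⟨by rw [i2]; linarith, by rw [i2]; linarith⟩ (Or.inl ?_)
      (P.exc_ne_one (by rw [i1]; linarith) (by rw [i1]; linarith) hne)
    intro h; rw [h] at i2; simp at i2; linarith
  have k1 := key (-μr) (m - mr) (by
    push_cast; rw [← sub_eq_add_neg]; exact sub_ne_zero.mpr h1)
  have k2 := key μr (m + mr) (fun h => h2 (eq_neg_of_add_eq_zero_left h))
  push_cast at k1
  rw [← sub_eq_add_neg, exc_sub] at k1
  rw [exc_add] at k2
  rw [wave, P.cph_gau_shift',
    show w + Complex.I * conj b - μr = w - μr + Complex.I * conj b by ring,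
    show w + Complex.I * conj b + μr = w + μr + Complex.I * conj b by ring,
    show m + 1 - mr = m - mr + 1 by ring, show m + 1 + mr = m + mr + 1 by ring, k1, k2, wave]
  have e1 := exc_ne_zero N b w m
  have e2 := exc_ne_zero N b μr mr
  field_simp
  ring

/-- Reflection exchanges `-i b` with `+i conj b`, so `wave_shift'` gives the reflected state the
same multiplier, with `lam` itself and not its conjugate. This is the symmetry behind orthogonality.
-/
theorem waveC_shift (P : Param N b) {μr : ℝ} {mr : ℤ} {w : ℂ} (m : ℤ) (hw : w.im ≤ 0)
    (hw' : -b.re < w.im)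
    (h1 : w ≠ μr) (h2 : w ≠ -μr) :
    waveC N b μr mr (w - Complex.I * b) (m + 1) =
      (lam N b μr mr - lam N b w m) * waveC N b μr mr w m := by
  have e : conj (w - Complex.I * b) = conj w + Complex.I * conj b := by
    simp
  have h := P.wave_shift' (μr := μr) (mr := mr) (w := conj w) m (by simpa using hw)
    (by simp; linarith)
    (fun h => h1 (by simpa using congrArg conj h)) (fun h => h2 (by simpa using congrArg conj h))
  rw [waveC, e, h, waveC]
  simp only [map_mul, map_sub, map_add, map_inv₀, conj_exc, Complex.conj_conj, Complex.conj_ofReal,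
    lam]

/-- Equality of `E + E⁻¹` and `E' + E'⁻¹` forces `E = E'` or `E E' = 1`; taking moduli leaves only
the continuous labels. -/
theorem lam_ne (P : Param N b) {μ μ' : ℝ} {m m' : ℤ} (h1 : μ ≠ μ') (h2 : μ ≠ -μ') :
    lam N b μ m ≠ lam N b μ' m' := by
  intro h
  have e1 := ex_ne_zero N b μ m
  have e2 := ex_ne_zero N b μ' m'
  have hN := P.rpos
  have hd : 2 * Real.pi / N ≠ 0 := by have := Real.pi_pos; positivity
  have h3 : (ex N b μ m - ex N b μ' m') * (ex N b μ m * ex N b μ' m' - 1) = 0 := by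
    rw [lam, lam] at h
    field_simp at h
    linear_combination h
  have hre := P.re.ne'
  rcases mul_eq_zero.mp h3 with h4 | h4
  · have := congrArg Norm.norm (sub_eq_zero.mp h4)
    rw [norm_ex, norm_ex, Real.exp_eq_exp] at this
    simp at this
    rcases this with (h | h) | h
    · exact h1 h
    · exact hre h
    · exact P.pos.ne' h
  · have := congrArg Norm.norm (sub_eq_zero.mp h4)
    rw [norm_mul, norm_ex, norm_ex, ← Real.exp_add, norm_one, Real.exp_eq_one_iff] at this
    simp only [Complex.ofReal_re, Complex.ofReal_im, mul_zero, add_zero, ← mul_add] at this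
    have := (mul_eq_zero.mp ((mul_eq_zero.mp this).resolve_left hd)).resolve_left
      (neg_ne_zero.mpr hre)
    exact h2 (by linarith)

end Param

/-! ### Residues of the eigenstates. -/

/-- The residue of `wave` at `μr`. -/
def resP (N : ℕ) (b : ℂ) (μr : ℝ) (mr m : ℤ) : ℂ :=
  chi N (m - mr) * kap N b * (cph N m mr * gau N b μr * hh N b (2 * μr) (m + mr))

/-- The residue of `wave` at `-μr`. -/
def resM (N : ℕ) (b : ℂ) (μr : ℝ) (mr m : ℤ) : ℂ :=
  chi N (m + mr) * kap N b * (cph N m mr * gau N b (-μr) * hh N b (-(2 * μr)) (m - mr))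

namespace Param
variable {N : ℕ} {b : ℂ}

theorem chi_mul_chi {mr m : ℤ} (h : ¬ (N : ℤ) ∣ 2 * mr) : chi N (m - mr) * chi N (m + mr) = 0 := by
  by_contra hne
  have h1 := left_ne_zero_of_mul hne
  have h2 := right_ne_zero_of_mul hne
  simp only [chi, ne_eq, ite_eq_right_iff, one_ne_zero, imp_false, not_not] at h1 h2
  apply h
  have h3 := dvd_sub h2 h1
  rwa [show m + mr - (m - mr) = 2 * mr by ring] at h3

/-- Separation of the two simple poles of `wave`. -/
theorem exists_wave_decomp (P : Param N b) {μr : ℝ} {mr : ℤ} (h : μr ≠ 0 ∨ ¬ (N : ℤ) ∣ 2 * mr)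
    (m : ℤ) :
    ∃ g : ℂ → ℂ, (∀ z ∈ strip b, AnalyticAt ℂ g z) ∧
      ∀ z ∈ strip b, z ≠ μr → z ≠ -μr → wave N b μr mr z m =
        g z + resP N b μr mr m / (z - μr) + resM N b μr mr m / (z + μr) := by
  set F : ℂ → ℂ := fun z => cph N m mr * gau N b z with hF
  have hFa : ∀ z, AnalyticAt ℂ F z := fun z =>
    analyticAt_const.fun_mul ((differentiable_gau N b).analyticAt z)
  set c₁ := chi N (m - mr) * kap N b with hc₁
  set c₂ := chi N (m + mr) * kap N b with hc₂
  have hr1 : ∀ z ∈ strip b, AnalyticAt ℂ (fun z => hr N b (z - μr) (m - mr)) z := fun z hz =>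
    (P.analyticAt_hr (sub_real_mem_strip hz μr) _).comp_of_eq
      (f := fun z => z - (μr : ℂ)) (by fun_prop) rfl
  have hr2 : ∀ z ∈ strip b, AnalyticAt ℂ (fun z => hr N b (z + μr) (m + mr)) z := fun z hz =>
    (P.analyticAt_hr (add_real_mem_strip hz μr) _).comp_of_eq
      (f := fun z => z + (μr : ℂ)) (by fun_prop) rfl
  -- For `μr = 0` the quotient `c₂ / (2 * μr)` is zero by convention. This is harmless: the
  -- hypothesis then forces `c₁ * c₂ = 0`, so there is no cross term to decompose.
  set K₁ : ℂ → ℂ := fun z => F z * (hr N b (z + μr) (m + mr) + c₂ / (2 * μr)) with hK₁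
  set K₂ : ℂ → ℂ := fun z => F z * (hr N b (z - μr) (m - mr) + c₁ / (-(2 * μr))) with hK₂
  have hK₁a : ∀ z ∈ strip b, AnalyticAt ℂ K₁ z := fun z hz =>
    (hFa z).fun_mul ((hr2 z hz).fun_add analyticAt_const)
  have hK₂a : ∀ z ∈ strip b, AnalyticAt ℂ K₂ z := fun z hz =>
    (hFa z).fun_mul ((hr1 z hz).fun_add analyticAt_const)
  have hβ := P.re
  have m1 : (μr : ℂ) ∈ strip b := ⟨by simpa using hβ, by simpa using hβ⟩
  have m2 : (-μr : ℂ) ∈ strip b := ⟨by simpa using hβ, by simpa using hβ⟩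
  refine ⟨fun z => F z * hr N b (z - μr) (m - mr) * hr N b (z + μr) (m + mr) +
    c₁ * dslope K₁ μr z + c₂ * dslope K₂ (-μr) z, fun z hz => ?_, fun z hz h1 h2 => ?_⟩
  · exact (((((hFa z).fun_mul (hr1 z hz)).fun_mul (hr2 z hz)).fun_add
      (analyticAt_const.fun_mul (analyticAt_dslope (hK₁a _ m1) (hK₁a z hz)))).fun_add
      (analyticAt_const.fun_mul (analyticAt_dslope (hK₂a _ m2) (hK₂a z hz))))
  · have n1 : z - μr ≠ 0 := sub_ne_zero.mpr h1
    have n2 : z + μr ≠ 0 := fun h => h2 (eq_neg_of_add_eq_zero_left h)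
    simp only
    rw [dslope_of_ne _ h1, dslope_of_ne _ h2, slope_def_field, slope_def_field]
    have e1 : K₁ μr = F μr * hh N b (2 * μr) (m + mr) := by
      simp only [hK₁]
      rw [hh, ← hc₂, two_mul]
    have e2 : K₂ (-μr) = F (-μr) * hh N b (-(2 * μr)) (m - mr) := by
      simp only [hK₂]
      rw [hh, ← hc₁, show -(μr : ℂ) - μr = -(2 * μr) by ring]
    have r1 : resP N b μr mr m = c₁ * K₁ μr := by rw [e1, resP]
    have r2 : resM N b μr mr m = c₂ * K₂ (-μr) := by rw [e2, resM]
    rw [r1, r2, sub_neg_eq_add]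
    have hcross : c₁ * c₂ / (z - μr) / (z + μr) =
        c₁ * (c₂ / (2 * μr)) / (z - μr) + c₂ * (c₁ / (-(2 * μr))) / (z + μr) := by
      rcases h with h | h
      · have : (μr : ℂ) ≠ 0 := by exact_mod_cast h
        field_simp
        ring
      · have h0 : c₁ * c₂ = 0 := by
          rw [hc₁, hc₂]
          linear_combination (kap N b) ^ 2 * chi_mul_chi h (m := m)
        have h0' : c₂ * c₁ = 0 := by rw [mul_comm, h0]
        rw [← mul_div_assoc, ← mul_div_assoc, h0, h0']
        simp
    have q1 : K₁ z = F z * (hr N b (z + μr) (m + mr) + c₂ / (2 * μr)) := rfl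
    have q2 : K₂ z = F z * (hr N b (z - μr) (m - mr) + c₁ / (-(2 * μr))) := rfl
    have q3 : wave N b μr mr z m = F z * (hr N b (z - μr) (m - mr) + c₁ / (z - μr)) *
      (hr N b (z + μr) (m + mr) + c₂ / (z + μr)) := rfl
    rw [q1, q2, q3]
    linear_combination F z * hcross

end Param

/-! ### Decay on lines and the residue theorem for eigenstates. -/

theorem integrable_exp_neg_mul_abs {c : ℝ} (hc : 0 < c) :
    Integrable fun u : ℝ => Real.exp (-(c * |u|)) := by
  have hm : 0 < min 1 (c ^ 2 / 2) := by positivity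
  refine (integrable_inv_one_add_sq.const_mul (min 1 (c ^ 2 / 2))⁻¹).mono'
    (Continuous.aestronglyMeasurable (by fun_prop)) (.of_forall fun u => ?_)
  rw [Real.norm_eq_abs, abs_of_pos (Real.exp_pos _), Real.exp_neg, ← mul_inv]
  refine inv_anti₀ (by positivity) ?_
  have h := Real.quadratic_le_exp_of_nonneg (x := c * |u|) (by positivity)
  refine le_trans ?_ h
  have h1 : min 1 (c ^ 2 / 2) ≤ 1 := min_le_left _ _
  have h2 : min 1 (c ^ 2 / 2) * u ^ 2 ≤ c ^ 2 / 2 * u ^ 2 := by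
    gcongr; exact min_le_right _ _
  have h3 : (c * |u|) ^ 2 = c ^ 2 * u ^ 2 := by rw [mul_pow, sq_abs]
  have h4 : 0 ≤ c * |u| := by positivity
  nlinarith

theorem integrable_of_exp_bound {f : ℝ → ℂ} (hf : Continuous f) {C δ R : ℝ} (hδ : 0 < δ)
    (h : ∀ u : ℝ, R ≤ |u| → ‖f u‖ ≤ C * Real.exp (-(δ * |u|))) : Integrable f := by
  obtain ⟨K, hK⟩ := (isCompact_Icc (a := -R) (b := R)).exists_bound_of_continuousOn
    hf.continuousOn
  refine ((integrable_exp_neg_mul_abs hδ).const_mul (|C| + |K| * Real.exp (δ * |R|))).mono'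
    hf.aestronglyMeasurable (.of_forall fun u => ?_)
  have he := Real.exp_pos (-(δ * |u|))
  by_cases hu : R ≤ |u|
  · refine (h u hu).trans ?_
    gcongr
    have : 0 ≤ |K| * Real.exp (δ * |R|) := by positivity
    linarith [le_abs_self C]
  · push Not at hu
    have h1 := hK u (abs_le.mp hu.le)
    have h2 : 1 ≤ Real.exp (δ * |R|) * Real.exp (-(δ * |u|)) := by
      rw [← Real.exp_add, Real.one_le_exp_iff]
      have : |u| ≤ |R| := hu.le.trans (le_abs_self R)
      nlinarith
    have h3 : |K| ≤ |K| * (Real.exp (δ * |R|) * Real.exp (-(δ * |u|))) :=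
      le_mul_of_one_le_right (abs_nonneg K) h2
    have h4 : 0 ≤ |C| * Real.exp (-(δ * |u|)) := by positivity
    have := le_abs_self K
    nlinarith

namespace Param
variable {N : ℕ} {b : ℂ}

/-- Bound for the eigenstates at distance at least `η` from the poles. -/
theorem exists_wave_bound_away (P : Param N b) {v₁ v₂ η : ℝ} (hv₁ : -b.re < v₁)
    (hv₂ : v₂ < 2 * b.re)
    (hη : 0 < η) :
    ∃ C, 0 < C ∧ ∀ (μr : ℝ) (mr m : ℤ) (w : ℂ), v₁ ≤ w.im → w.im ≤ v₂ → η ≤ ‖w - μr‖ →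
      η ≤ ‖w + μr‖ → ‖wave N b μr mr w m‖ ≤
        C * Real.exp (-(2 * Real.pi / N * (b.re - w.im) * max |w.re| |μr|)) := by
  obtain ⟨C, hC, h⟩ := P.exists_wave_bound hv₁ hv₂
  have hm : 0 < min 1 η := by positivity
  refine ⟨C / (min 1 η * min 1 η), by positivity, fun μr mr m w h1 h2 h3 h4 => ?_⟩
  rw [div_mul_eq_mul_div, le_div_iff₀ (by positivity)]
  refine le_trans ?_ (h μr mr m w h1 h2)
  gcongr

/-- Bound for the eigenstates off the real axis, uniform in the label. -/
theorem exists_wave_bound_line (P : Param N b) {v₁ v₂ η : ℝ} (hv₁ : -b.re < v₁) (hv₂ : v₂ ≤ b.re)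
    (hη : 0 < η) :
    ∃ C, 0 < C ∧ ∀ (μr : ℝ) (mr m : ℤ) (w : ℂ), v₁ ≤ w.im → w.im ≤ v₂ → η ≤ |w.im| →
      ‖wave N b μr mr w m‖ ≤ C * Real.exp (-(2 * Real.pi / N * (b.re - w.im) * |w.re|)) := by
  obtain ⟨C, hC, h⟩ := P.exists_wave_bound_away hv₁ (by linarith [P.re] : v₂ < 2 * b.re) hη
  refine ⟨C, hC, fun μr mr m w h1 h2 h3 => (h μr mr m w h1 h2 ?_ ?_).trans ?_⟩
  · simpa using h3.trans (by simpa using Complex.abs_im_le_norm (w - μr))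
  · simpa using h3.trans (by simpa using Complex.abs_im_le_norm (w + μr))
  · have h4 : 0 ≤ 2 * Real.pi / N * (b.re - w.im) := by
      have := Real.pi_pos
      have := P.rpos
      have : 0 ≤ b.re - w.im := by linarith
      positivity
    gcongr
    exact le_max_left _ _

/-- Bound for the eigenstates far from the poles in the horizontal direction. -/
theorem exists_wave_bound_far (P : Param N b) {v₁ v₂ : ℝ} (hv₁ : -b.re < v₁) (hv₂ : v₂ < 2 * b.re) :
    ∃ C, 0 < C ∧ ∀ (μr : ℝ) (mr m : ℤ) (w : ℂ), v₁ ≤ w.im → w.im ≤ v₂ → |μr| + 1 ≤ |w.re| →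
      ‖wave N b μr mr w m‖ ≤ C * Real.exp (-(2 * Real.pi / N * (b.re - w.im) * |w.re|)) := by
  obtain ⟨C, hC, h⟩ := P.exists_wave_bound_away hv₁ hv₂ one_pos
  refine ⟨C, hC, fun μr mr m w h1 h2 h3 => ?_⟩
  have h4 := h μr mr m w h1 h2 ?_ ?_
  · rwa [max_eq_left (by linarith)] at h4
  · refine le_trans ?_ (Complex.abs_re_le_norm (w - μr))
    have := abs_sub_abs_le_abs_sub w.re μr
    simp only [Complex.sub_re, Complex.ofReal_re]
    linarith
  · refine le_trans ?_ (Complex.abs_re_le_norm (w + μr))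
    have := abs_sub_abs_le_abs_sub w.re (-μr)
    rw [abs_neg, sub_neg_eq_add] at this
    simp only [Complex.add_re, Complex.ofReal_re]
    linarith

theorem continuous_line {f : ℂ → ℂ} {v : ℝ} (h : ∀ z : ℂ, z.im = v → ContinuousAt f z) :
    Continuous fun u : ℝ => f (u + v * Complex.I) := by
  refine continuous_iff_continuousAt.mpr fun u => ?_
  refine ContinuousAt.comp' (h _ (by simp)) ?_
  fun_prop

theorem ne_real_of_im_ne {w : ℂ} (h : w.im ≠ 0) (x : ℝ) : w ≠ x ∧ w ≠ -x := by
  constructor <;> rintro rfl <;> simp at h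

theorem integrable_mul_wave (P : Param N b) {μr : ℝ} {mr : ℤ} (m : ℤ)
    {v₁ v₂ : ℝ} (h1 : -b.re < v₁) (h2 : v₂ < 2 * b.re) {B : ℂ → ℂ}
    (hB : ∀ z : ℂ, v₁ ≤ z.im → z.im ≤ v₂ → AnalyticAt ℂ B z) {C δ R : ℝ} (hδ : 0 < δ)
    (hdec : ∀ z : ℂ, v₁ ≤ z.im → z.im ≤ v₂ → R ≤ |z.re| →
      ‖B z * wave N b μr mr z m‖ ≤ C * Real.exp (-(δ * |z.re|))) {v : ℝ} (h0 : v ≠ 0)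
    (h3 : v₁ ≤ v) (h4 : v ≤ v₂) :
    Integrable fun u : ℝ => B (u + v * Complex.I) * wave N b μr mr (u + v * Complex.I) m := by
  refine integrable_of_exp_bound (continuous_line
    (f := fun z => B z * wave N b μr mr z m) fun z hz => ?_) hδ (C := C) (R := R) fun u hu => ?_
  · have h5 := ne_real_of_im_ne (w := z) (by rwa [hz]) μr
    exact ((hB z (by rwa [hz]) (by rwa [hz])).fun_mul (P.analyticAt_wave
      ⟨by rw [hz]; linarith, by rw [hz]; linarith⟩ h5.1 h5.2)).continuousAt
  · have := hdec (u + v * Complex.I) (by simpa using h3) (by simpa using h4) (by simpa using hu)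
    simpa using this

/-- The residue theorem for a product of a holomorphic function and an eigenstate. -/
theorem integral_mul_wave_sub (P : Param N b) {μr : ℝ} {mr : ℤ} (hμ : μr ≠ 0 ∨ ¬ (N : ℤ) ∣ 2 * mr)
    (m : ℤ)
    {v₁ v₂ : ℝ} (h1 : -b.re < v₁) (h1' : v₁ < 0) (h2 : 0 < v₂) (h2' : v₂ < 2 * b.re) {B : ℂ → ℂ}
    (hB : ∀ z : ℂ, v₁ ≤ z.im → z.im ≤ v₂ → AnalyticAt ℂ B z) {C δ R : ℝ} (hδ : 0 < δ)
    (hdec : ∀ z : ℂ, v₁ ≤ z.im → z.im ≤ v₂ → R ≤ |z.re| →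
      ‖B z * wave N b μr mr z m‖ ≤ C * Real.exp (-(δ * |z.re|))) :
    (∫ u : ℝ, B (u + v₁ * Complex.I) * wave N b μr mr (u + v₁ * Complex.I) m) -
      (∫ u : ℝ, B (u + v₂ * Complex.I) * wave N b μr mr (u + v₂ * Complex.I) m) =
      2 * Real.pi * Complex.I * (B μr * resP N b μr mr m + B (-μr) * resM N b μr mr m) := by
  obtain ⟨g, hg, hw⟩ := P.exists_wave_decomp hμ m
  have hβ := P.re
  have hstrip : ∀ z : ℂ, v₁ ≤ z.im → z.im ≤ v₂ → z ∈ strip b := fun z h3 h4 =>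
    ⟨by linarith, by linarith⟩
  have hBp : AnalyticAt ℂ B μr := hB _ (by simpa using h1'.le) (by simpa using h2.le)
  have hBm : AnalyticAt ℂ B (-μr) := hB _ (by simpa using h1'.le) (by simpa using h2.le)
  have key := integral_line_sub_integral_line (f := fun z => B z * wave N b μr mr z m)
    (g := fun z => B z * g z + resP N b μr mr m * dslope B μr z +
      resM N b μr mr m * dslope B (-μr) z) (p₁ := μr) (p₂ := -μr)
    (c₁ := B μr * resP N b μr mr m) (c₂ := B (-μr) * resM N b μr mr m) h1' h2
    (fun z h3 h4 => ?_) (fun z h3 h4 h5 h6 => ?_) (B := fun R => C * Real.exp (-(δ * R))) ?_ ?_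
    (P.integrable_mul_wave m h1 h2' hB hδ hdec h1'.ne le_rfl (h1'.trans h2).le)
    (P.integrable_mul_wave m h1 h2' hB hδ hdec h2.ne' (h1'.trans h2).le le_rfl)
  · exact key
  · exact ((((hB z h3 h4).fun_mul (hg z (hstrip z h3 h4))).fun_add (analyticAt_const.fun_mul
      (analyticAt_dslope hBp (hB z h3 h4)))).fun_add (analyticAt_const.fun_mul
      (analyticAt_dslope hBm (hB z h3 h4)))).differentiableAt
  · push_cast at h6 ⊢
    rw [hw z (hstrip z h3 h4) h5 h6, dslope_of_ne _ h5, dslope_of_ne _ h6, slope_def_field,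
      slope_def_field, sub_neg_eq_add]
    ring
  · have : Tendsto (fun R : ℝ => Real.exp (-(δ * R))) atTop (𝓝 0) :=
      Real.tendsto_exp_neg_atTop_nhds_zero.comp (tendsto_id.const_mul_atTop hδ)
    simpa using this.const_mul C
  · filter_upwards [eventually_ge_atTop R] with R' hR' z h3 h4 h5
    have := hdec z h3 h4 (by rw [h5]; exact hR')
    rwa [h5] at this

end Param

/-! ### Lowering the contour of the inner product. -/

/-- The inner product after the contour has been moved to `Im w = -Re b / 4`. -/
def innerLow (N : ℕ) (b : ℂ) (ε μr : ℝ) (mr : ℤ) (μr' : ℝ) (mr' : ℤ) : ℂ :=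
  ∑ m ∈ Finset.range N, ∫ u : ℝ,
    waveC N b μr mr (u + ((-(b.re / 4) : ℝ) : ℂ) * Complex.I - 2 * ε * Complex.I) m *
      wave N b μr' mr' (u + ((-(b.re / 4) : ℝ) : ℂ) * Complex.I) m

/-- The contribution of the poles. -/
def resSum (N : ℕ) (b : ℂ) (ε μr : ℝ) (mr : ℤ) (μr' : ℝ) (mr' : ℤ) : ℂ :=
  ∑ m ∈ Finset.range N,
    (waveC N b μr mr (μr' - 2 * ε * Complex.I) m * resP N b μr' mr' m +
      waveC N b μr mr (-μr' - 2 * ε * Complex.I) m * resM N b μr' mr' m)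

theorem sum_range_shift {N : ℕ} {X : ℤ → ℂ} (h : X N = X 0) :
    ∑ m ∈ Finset.range N, X (m + 1) = ∑ m ∈ Finset.range N, X m := by
  have h1 := Finset.sum_range_succ (fun m : ℕ => X m) N
  have h2 := Finset.sum_range_succ' (fun m : ℕ => X m) N
  push_cast at h1 h2
  rw [h1, h] at h2
  exact (add_right_cancel h2).symm

namespace Param
variable {N : ℕ} {b : ℂ}

theorem waveC_int (P : Param N b) (μr : ℝ) (mr : ℤ) (w : ℂ) (m k : ℤ) :
    waveC N b μr mr w (m + k * N) = waveC N b μr mr w m := by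
  rw [waveC, P.wave_int, waveC]

theorem analyticAt_waveC_sub (P : Param N b) {μr : ℝ} {mr : ℤ} {z c : ℂ} {m : ℤ}
    (h1 : -b.re < c.im - z.im)
    (h2 : c.im - z.im < 2 * b.re) (h0 : c.im - z.im ≠ 0) :
    AnalyticAt ℂ (fun z => waveC N b μr mr (z - c) m) z := by
  have hne := ne_real_of_im_ne (w := z - c) (by
    simp only [Complex.sub_im]; intro h; apply h0; linarith) μr
  refine (P.analyticAt_waveC (w := z - c) ?_ hne.1 hne.2).comp_of_eq (f := fun z => z - c)
    (by fun_prop) rfl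
  constructor <;> simp only [Complex.conj_im, Complex.sub_im] <;> linarith

/-- Moving the contour across the poles of the second eigenstate. -/
theorem inner_eq (P : Param N b) {ε : ℝ} (hε : 0 < ε) (hε' : ε ≤ b.re / 8) (μr : ℝ) (mr : ℤ)
    {μr' : ℝ} {mr' : ℤ}
    (hμ : μr' ≠ 0 ∨ ¬ (N : ℤ) ∣ 2 * mr') :
    ∑ m ∈ Finset.range N, ∫ u : ℝ, conj (wave N b μr mr (u + ε * Complex.I) m) *
      wave N b μr' mr' (u + ε * Complex.I) m =
    innerLow N b ε μr mr μr' mr' -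
      2 * Real.pi * Complex.I * resSum N b ε μr mr μr' mr' := by
  have hβ := P.re
  have hN := P.rpos
  have hpi := Real.pi_pos
  rw [innerLow, resSum, Finset.mul_sum, ← Finset.sum_sub_distrib]
  refine Finset.sum_congr rfl fun m _ => ?_
  obtain ⟨C₁, hC₁, hb₁⟩ := P.exists_wave_bound_far (v₁ := 0) (v₂ := b.re) (by linarith)
    (by linarith)
  obtain ⟨C₂, hC₂, hb₂⟩ := P.exists_wave_bound_far (v₁ := -(b.re / 4)) (v₂ := b.re) (by linarith)
    (by linarith)
  have hc : (2 * ε * Complex.I : ℂ).im = 2 * ε := by simp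
  have hd : 0 < 2 * Real.pi / N := by positivity
  -- On `Im z = ε` the point `z - 2iε` is the conjugate of `z`, so this holomorphic `B` restricts to
  -- the conjugated state. Its poles `±μr + 2iε` lie above the strip swept by the contour.
  have key := P.integral_mul_wave_sub hμ m (v₁ := -(b.re / 4)) (v₂ := ε)
    (B := fun z => waveC N b μr mr (z - 2 * ε * Complex.I) m) (by linarith) (by linarith) hε
    (by linarith) (fun z h1 h2 => P.analyticAt_waveC_sub (by rw [hc]; linarith)
      (by rw [hc]; linarith) (by rw [hc]; intro h; linarith)) (C := C₁ * C₂)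
    (δ := 2 * Real.pi / N * (b.re / 2)) (R := |μr| + |μr'| + 1) (by positivity)
    (fun z h1 h2 h3 => by
      have e1 : (conj (z - 2 * ε * Complex.I)).im = 2 * ε - z.im := by
        rw [Complex.conj_im, Complex.sub_im, hc]; ring
      have e2 : (conj (z - 2 * ε * Complex.I)).re = z.re := by simp
      have a0 := abs_nonneg μr
      have a1 := abs_nonneg μr'
      have f1 := hb₁ μr mr m (conj (z - 2 * ε * Complex.I)) (by rw [e1]; linarith)
        (by rw [e1]; linarith) (by rw [e2]; linarith)
      have f2 := hb₂ μr' mr' m z h1 (by linarith) (by linarith)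
      rw [e1, e2] at f1
      rw [norm_mul, norm_waveC]
      have f1' : ‖wave N b μr mr (conj (z - 2 * ε * Complex.I)) m‖ ≤ C₁ := by
        refine f1.trans (mul_le_of_le_one_right hC₁.le ?_)
        rw [Real.exp_le_one_iff, neg_nonpos]
        have : 0 ≤ b.re - (2 * ε - z.im) := by linarith
        positivity
      rw [mul_assoc C₁]
      refine mul_le_mul f1' (f2.trans ?_) (norm_nonneg _) hC₁.le
      gcongr
      linarith)
  have e : ∀ u : ℝ, waveC N b μr mr (u + ε * Complex.I - 2 * ε * Complex.I) m =
      conj (wave N b μr mr (u + ε * Complex.I) m) := fun u => by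
    rw [waveC]
    congr 2
    simp only [map_sub, map_add, map_mul, Complex.conj_ofReal, Complex.conj_I, map_ofNat]
    ring
  simp only [e] at key
  rw [← key]
  ring

/-- Uniform bound for the integrand of `innerLow`. -/
theorem exists_innerLow_integrand_bound (P : Param N b) :
    ∃ C, 0 < C ∧ ∀ (ε μr : ℝ) (mr : ℤ) (μr' : ℝ) (mr' m : ℤ) (u : ℝ), 0 ≤ ε → ε ≤ b.re / 8 →
      ‖waveC N b μr mr (u + ((-(b.re / 4) : ℝ) : ℂ) * Complex.I - 2 * ε * Complex.I) m *
        wave N b μr' mr' (u + ((-(b.re / 4) : ℝ) : ℂ) * Complex.I) m‖ ≤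
        C * Real.exp (-(2 * Real.pi / N * b.re * |u|)) := by
  have hβ := P.re
  have hN := P.rpos
  have hpi := Real.pi_pos
  have hd : 0 < 2 * Real.pi / N := by positivity
  obtain ⟨C, hC, hb⟩ := P.exists_wave_bound_line (v₁ := -(b.re / 4)) (v₂ := b.re)
    (η := b.re / 4) (by linarith) le_rfl (by linarith)
  refine ⟨C * C, by positivity, fun ε μr mr μr' mr' m u h0 h1 => ?_⟩
  set w : ℂ := u + ((-(b.re / 4) : ℝ) : ℂ) * Complex.I with hw
  have i1 : w.im = -(b.re / 4) := by simp [hw]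
  have i2 : w.re = u := by simp [hw]
  have i3 : (conj (w - 2 * ε * Complex.I)).im = 2 * ε + b.re / 4 := by
    simp [i1]; ring
  have f1 := hb μr mr m (conj (w - 2 * ε * Complex.I)) (by rw [i3]; linarith)
    (by rw [i3]; linarith) (by rw [i3, abs_of_pos (by linarith)]; linarith)
  have f2 := hb μr' mr' m w (by rw [i1]) (by rw [i1]; linarith)
    (by rw [i1, abs_neg, abs_of_pos (by linarith)])
  rw [i1, i2] at f2
  rw [i3] at f1
  rw [norm_mul, norm_waveC, mul_assoc C]
  refine mul_le_mul (f1.trans (mul_le_of_le_one_right hC.le ?_)) (f2.trans ?_) (norm_nonneg _) hC.le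
  · rw [Real.exp_le_one_iff, neg_nonpos]
    have : 0 ≤ b.re - (2 * ε + b.re / 4) := by linarith
    positivity
  · gcongr
    linarith

/-- On the lowered line both factors keep a fixed distance from their poles, which makes the bound
uniform in both labels and in the regulator. -/
theorem exists_innerLow_bound (P : Param N b) :
    ∃ C, 0 < C ∧ ∀ (ε μr : ℝ) (mr : ℤ) (μr' : ℝ) (mr' : ℤ), 0 ≤ ε → ε ≤ b.re / 8 →
      ‖innerLow N b ε μr mr μr' mr'‖ ≤ C := by
  obtain ⟨C, hC, h⟩ := P.exists_innerLow_integrand_bound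
  have hβ := P.re
  have hN := P.rpos
  have hpi := Real.pi_pos
  have hc : 0 < 2 * Real.pi / N * b.re := by positivity
  refine ⟨N * (C * ∫ u : ℝ, Real.exp (-(2 * Real.pi / N * b.re * |u|))) + 1, ?_,
    fun ε μr mr μr' mr' h0 h1 => ?_⟩
  · have : 0 ≤ ∫ u : ℝ, Real.exp (-(2 * Real.pi / N * b.re * |u|)) :=
      integral_nonneg fun u => (Real.exp_pos _).le
    positivity
  · rw [innerLow]
    refine (norm_sum_le_of_le (Finset.range N)
      (n := fun _ => C * ∫ u : ℝ, Real.exp (-(2 * Real.pi / N * b.re * |u|))) fun m _ => ?_).trans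
        ?_
    · rw [← integral_const_mul]
      exact norm_integral_le_of_norm_le ((integrable_exp_neg_mul_abs hc).const_mul C)
        (.of_forall fun u => h ε μr mr μr' mr' m u h0 h1)
    · simp

theorem continuous_wave_line (P : Param N b) {v : ℝ} (h1 : -b.re < v) (h2 : v < 2 * b.re)
    (h0 : v ≠ 0) (μr : ℝ)
    (mr m : ℤ) : Continuous fun u : ℝ => wave N b μr mr (u + v * Complex.I) m :=
  continuous_line (f := fun z => wave N b μr mr z m) fun z hz => by
    have h5 := ne_real_of_im_ne (w := z) (by rwa [hz]) μr
    exact (P.analyticAt_wave ⟨by rw [hz]; linarith, by rw [hz]; linarith⟩ h5.1 h5.2).continuousAt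

theorem tendsto_innerLow (P : Param N b) (μr : ℝ) (mr : ℤ) (μr' : ℝ) (mr' : ℤ) :
    Tendsto (fun ε : ℝ => innerLow N b ε μr mr μr' mr') (𝓝[>] 0)
      (𝓝 (innerLow N b 0 μr mr μr' mr')) := by
  obtain ⟨C, hC, h⟩ := P.exists_innerLow_integrand_bound
  have hβ := P.re
  have hN := P.rpos
  have hpi := Real.pi_pos
  have hc : 0 < 2 * Real.pi / N * b.re := by positivity
  have hsmall : ∀ᶠ ε : ℝ in 𝓝[>] 0, 0 < ε ∧ ε < b.re / 8 := by
    filter_upwards [self_mem_nhdsWithin, nhdsWithin_le_nhds (Iio_mem_nhds (by positivity :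
      (0 : ℝ) < b.re / 8))] with ε h1 h2 using ⟨h1, h2⟩
  refine tendsto_finsetSum _ fun m _ => ?_
  have hcont : ∀ (ε : ℝ) (u : ℝ), 0 ≤ ε → ε < b.re / 8 →
      AnalyticAt ℂ (fun z => waveC N b μr mr z m)
        (u + ((-(b.re / 4) : ℝ) : ℂ) * Complex.I - 2 * ε * Complex.I) := fun ε u h1 h2 => by
    set w : ℂ := u + ((-(b.re / 4) : ℝ) : ℂ) * Complex.I - 2 * ε * Complex.I with hw
    have i : w.im = -(b.re / 4) - 2 * ε := by simp [hw]
    have hne := ne_real_of_im_ne (w := w) (by rw [i]; intro h; linarith) μr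
    exact P.analyticAt_waveC ⟨by rw [Complex.conj_im, i]; linarith,
      by rw [Complex.conj_im, i]; linarith⟩ hne.1 hne.2
  refine tendsto_integral_filter_of_dominated_convergence
    (fun u => C * Real.exp (-(2 * Real.pi / N * b.re * |u|))) ?_ ?_
    ((integrable_exp_neg_mul_abs hc).const_mul C) (.of_forall fun u => ?_)
  · filter_upwards [hsmall] with ε hε
    refine Continuous.aestronglyMeasurable (Continuous.mul ?_ ?_)
    · refine continuous_iff_continuousAt.mpr fun u => ?_
      exact ContinuousAt.comp' (g := fun z => waveC N b μr mr z m)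
        (hcont ε u hε.1.le hε.2).continuousAt (by fun_prop)
    · exact P.continuous_wave_line (by linarith) (by linarith) (by linarith) _ _ _
  · filter_upwards [hsmall] with ε hε
    exact .of_forall fun u => h ε μr mr μr' mr' m u hε.1.le hε.2.le
  · refine Tendsto.mul_const _ ?_
    have h1 := (hcont 0 u le_rfl (by positivity)).continuousAt
    have h2 : Tendsto (fun ε : ℝ => (u + ((-(b.re / 4) : ℝ) : ℂ) * Complex.I -
        2 * ε * Complex.I : ℂ)) (𝓝[>] 0) (𝓝 (u + ((-(b.re / 4) : ℝ) : ℂ) * Complex.I -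
        2 * (0 : ℝ) * Complex.I)) :=
      (Continuous.tendsto (by fun_prop) 0).mono_left nhdsWithin_le_nhds
    exact h1.tendsto.comp h2

theorem waveC_real_regular (P : Param N b) {μr μ : ℝ} (mr : ℤ) (m : ℤ) (h1 : μ ≠ μr)
    (h2 : μ ≠ -μr) :
    AnalyticAt ℂ (fun z => waveC N b μr mr z m) μ := by
  have hβ := P.re
  refine P.analyticAt_waveC ⟨by simpa using hβ, by simpa using hβ⟩ ?_ ?_
  · exact_mod_cast h1
  · exact_mod_cast h2

/-- For these labels the first state is regular at the poles of the second, so the regulator can be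
removed term by term. -/
theorem tendsto_resSum (P : Param N b) {μr μr' : ℝ} (mr mr' : ℤ) (h1 : μr ≠ μr') (h2 : μr ≠ -μr') :
    Tendsto (fun ε : ℝ => resSum N b ε μr mr μr' mr') (𝓝[>] 0)
      (𝓝 (resSum N b 0 μr mr μr' mr')) := by
  have key : ∀ (μ : ℝ) (m : ℤ), μ ≠ μr → μ ≠ -μr →
      Tendsto (fun ε : ℝ => waveC N b μr mr (μ - 2 * ε * Complex.I) m) (𝓝[>] 0)
      (𝓝 (waveC N b μr mr (μ - 2 * (0 : ℝ) * Complex.I) m)) := by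
    intro μ m h3 h4
    have h5 := (P.waveC_real_regular mr m h3 h4).continuousAt
    have h6 : Tendsto (fun ε : ℝ => (μ - 2 * ε * Complex.I : ℂ)) (𝓝[>] 0)
        (𝓝 (μ - 2 * (0 : ℝ) * Complex.I)) :=
      (Continuous.tendsto (by fun_prop) 0).mono_left nhdsWithin_le_nhds
    have h7 : (μ - 2 * (0 : ℝ) * Complex.I : ℂ) = μ := by simp
    rw [h7] at h6 ⊢
    exact h5.tendsto.comp h6
  refine tendsto_finsetSum _ fun m _ => ?_
  have k1 := key μr' m h1.symm (fun h => h2 (by linarith))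
  have k2 := key (-μr') m h2.symm (fun h => h1 (by linarith))
  push_cast at k2
  push_cast at k1
  exact (k1.mul_const _).add (k2.mul_const _)

/-! ### Orthogonality for different continuous labels. -/

theorem lam_int (P : Param N b) (w : ℂ) (n k : ℤ) : lam N b w (n + k * N) = lam N b w n := by
  rw [lam, lam, P.ex_int]

theorem ex_neg (w : ℂ) (n : ℤ) : ex N b (-w) (-n) = (ex N b w n)⁻¹ := by
  rw [ex, ex, ← Complex.exp_neg]; congr 1; push_cast; ring

theorem lam_neg (w : ℂ) (n : ℤ) : lam N b (-w) (-n) = lam N b w n := by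
  rw [lam, lam, ex_neg, inv_inv, add_comm]

theorem lam_mul_chi (P : Param N b) {w : ℂ} {m k : ℤ} : lam N b w m * chi N (m - k) =
    lam N b w k * chi N (m - k) := by
  by_cases h : (N : ℤ) ∣ m - k
  · obtain ⟨l, hl⟩ := h
    have : m = k + l * N := by linarith
    rw [this, P.lam_int]
  · simp [chi, h]

/-- Orthogonality of the eigenstates with different labels. -/
theorem innerLow_eq_resSum (P : Param N b) {μr μr' : ℝ} (mr : ℤ) {mr' : ℤ}
    (hμ : μr' ≠ 0 ∨ ¬ (N : ℤ) ∣ 2 * mr')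
    (h1 : μr ≠ μr') (h2 : μr ≠ -μr') :
    innerLow N b 0 μr mr μr' mr' = 2 * Real.pi * Complex.I * resSum N b 0 μr mr μr' mr' := by
  have hβ := P.re
  have hs := P.im
  have hN := P.rpos
  have hpi := Real.pi_pos
  have hd : 0 < 2 * Real.pi / N := by positivity
  set d := 2 * Real.pi / N with hddef
  set η : ℝ := b.re / 4 with hη
  set Λ := lam N b μr mr with hΛ
  set Λ' := lam N b μr' mr' with hΛ'
  -- `X` puts the shift on the second state and `Y` puts the inverse shift on the first: the two
  -- sides of a summation by parts.
  set X : ℤ → ℂ := fun m => ∫ u : ℝ, waveC N b μr mr (u + ((-η : ℝ) : ℂ) * Complex.I) m *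
    wave N b μr' mr' (u + ((-η : ℝ) : ℂ) * Complex.I + Complex.I * b) (m - 1) with hX
  set Y : ℤ → ℂ := fun m => ∫ u : ℝ,
    waveC N b μr mr (u + ((-η : ℝ) : ℂ) * Complex.I - Complex.I * b) (m + 1) *
      wave N b μr' mr' (u + ((-η : ℝ) : ℂ) * Complex.I) m with hY
  have hc : (Complex.I * b).im = b.re := by simp
  have hcr : (Complex.I * b).re = -b.im := by simp
  obtain ⟨C₁, hC₁, hb₁⟩ := P.exists_wave_bound_far (v₁ := 0) (v₂ := b.re + η) (by linarith)
    (by linarith)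
  obtain ⟨C₂, hC₂, hb₂⟩ := P.exists_wave_bound_far (v₁ := -η) (v₂ := b.re) (by linarith)
    (by linarith)
  have hB : ∀ (m : ℤ) (z : ℂ), -η ≤ z.im → z.im ≤ b.re - η →
      AnalyticAt ℂ (fun z => waveC N b μr mr (z - Complex.I * b) (m + 1)) z := fun m z h3 h4 =>
    P.analyticAt_waveC_sub (by rw [hc]; linarith) (by rw [hc]; linarith)
      (by rw [hc]; intro h; linarith)
  have hdec : ∀ (m : ℤ) (z : ℂ), -η ≤ z.im → z.im ≤ b.re - η → |μr| + |μr'| + 1 + b.im ≤ |z.re| →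
      ‖waveC N b μr mr (z - Complex.I * b) (m + 1) * wave N b μr' mr' z m‖ ≤
        (C₁ * C₂ * Real.exp (d * b.re * b.im)) * Real.exp (-(d * b.re * |z.re|)) := by
    intro m z h3 h4 h5
    have e1 : (conj (z - Complex.I * b)).im = b.re - z.im := by
      rw [Complex.conj_im, Complex.sub_im, hc]; ring
    have e2 : (conj (z - Complex.I * b)).re = z.re + b.im := by
      rw [Complex.conj_re, Complex.sub_re, hcr]; ring
    have a0 := abs_nonneg μr
    have a1 := abs_nonneg μr'
    have t1 : |z.re + b.im| - |z.re| ≤ b.im := by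
      have := abs_add_le z.re b.im
      rw [abs_of_pos hs] at this
      linarith
    have t2 : |z.re| - |z.re + b.im| ≤ b.im := by
      have := abs_sub_abs_le_abs_sub z.re (z.re + b.im)
      rw [sub_add_cancel_left, abs_neg, abs_of_pos hs] at this
      linarith
    have f1 := hb₁ μr mr (m + 1) (conj (z - Complex.I * b)) (by rw [e1]; linarith)
      (by rw [e1]; linarith) (by rw [e2]; linarith)
    have f2 := hb₂ μr' mr' m z h3 (by linarith) (by linarith)
    rw [e1, e2] at f1
    rw [norm_mul, norm_waveC]
    calc _ ≤ (C₁ * Real.exp (-(d * (b.re - (b.re - z.im)) * |z.re + b.im|))) *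
          (C₂ * Real.exp (-(d * (b.re - z.im) * |z.re|))) := by gcongr
      _ = C₁ * C₂ * Real.exp (-(d * z.im * |z.re + b.im|) - d * (b.re - z.im) * |z.re|) := by
          rw [mul_mul_mul_comm, ← Real.exp_add]; congr 2; ring
      _ ≤ C₁ * C₂ * Real.exp (d * b.re * b.im + -(d * b.re * |z.re|)) := by
          gcongr
          have : -z.im * (|z.re + b.im| - |z.re|) ≤ b.re * b.im := by
            rcases le_total 0 z.im with h | h
            · have : z.im * (|z.re| - |z.re + b.im|) ≤ z.im * b.im := by gcongr
              have : z.im * b.im ≤ b.re * b.im := by gcongr; linarith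
              linarith
            · have : -z.im * (|z.re + b.im| - |z.re|) ≤ -z.im * b.im := by
                have : 0 ≤ -z.im := by linarith
                gcongr
              have : -z.im * b.im ≤ b.re * b.im := by gcongr; linarith
              linarith
          nlinarith
      _ = _ := by rw [Real.exp_add]; ring
  have hδ : 0 < d * b.re := by positivity
  have iY : ∀ m : ℤ, Integrable fun u : ℝ =>
      waveC N b μr mr (u + ((-η : ℝ) : ℂ) * Complex.I - Complex.I * b) (m + 1) *
      wave N b μr' mr' (u + ((-η : ℝ) : ℂ) * Complex.I) m := fun m =>
    P.integrable_mul_wave m (v₁ := -η) (v₂ := b.re - η) (by linarith) (by linarith) (hB m) hδ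
      (hdec m) (by intro h; linarith) le_rfl (by linarith)
  have iX' : ∀ m : ℤ, Integrable fun u : ℝ =>
      waveC N b μr mr (u + ((b.re - η : ℝ) : ℂ) * Complex.I - Complex.I * b) (m + 1) *
      wave N b μr' mr' (u + ((b.re - η : ℝ) : ℂ) * Complex.I) m := fun m =>
    P.integrable_mul_wave m (v₁ := -η) (v₂ := b.re - η) (by linarith) (by linarith) (hB m) hδ
      (hdec m) (by intro h; linarith) (by linarith) le_rfl
  -- As `i b = -Im b + i Re b`, the shifted line is the line at height `Re b - η` up to a real
  -- translation.
  have etrans : ∀ (m : ℤ), (fun u : ℝ =>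
      waveC N b μr mr (u + ((-η : ℝ) : ℂ) * Complex.I) (m + 1) *
      wave N b μr' mr' (u + ((-η : ℝ) : ℂ) * Complex.I + Complex.I * b) m) =
      fun u : ℝ => (fun t : ℝ =>
      waveC N b μr mr (t + ((b.re - η : ℝ) : ℂ) * Complex.I - Complex.I * b) (m + 1) *
      wave N b μr' mr' (t + ((b.re - η : ℝ) : ℂ) * Complex.I) m) (u - b.im) := by
    intro m
    ext u
    have hb : b = b.re + b.im * Complex.I := (Complex.re_add_im b).symm
    have e : (((u - b.im : ℝ) : ℂ) + ((b.re - η : ℝ) : ℂ) * Complex.I) =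
        u + ((-η : ℝ) : ℂ) * Complex.I + Complex.I * b := by
      conv_rhs => rw [hb]
      push_cast
      linear_combination (-b.im : ℂ) * Complex.I_sq
    simp only
    rw [e, add_sub_cancel_right]
  have iX : ∀ m : ℤ, Integrable fun u : ℝ => waveC N b μr mr (u + ((-η : ℝ) : ℂ) * Complex.I) m *
      wave N b μr' mr' (u + ((-η : ℝ) : ℂ) * Complex.I + Complex.I * b) (m - 1) := fun m => by
    have := etrans (m - 1)
    rw [sub_add_cancel] at this
    rw [this, ]
    have i := (iX' (m - 1)).comp_sub_right b.im
    rwa [sub_add_cancel] at i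
  have eX : ∀ m : ℤ, X (m + 1) = ∫ u : ℝ,
      waveC N b μr mr (u + ((b.re - η : ℝ) : ℂ) * Complex.I - Complex.I * b) (m + 1) *
      wave N b μr' mr' (u + ((b.re - η : ℝ) : ℂ) * Complex.I) m := fun m => by
    simp only [hX, add_sub_cancel_right]
    rw [etrans m]
    exact integral_sub_right_eq_self (fun t : ℝ =>
      waveC N b μr mr (t + ((b.re - η : ℝ) : ℂ) * Complex.I - Complex.I * b) (m + 1) *
      wave N b μr' mr' (t + ((b.re - η : ℝ) : ℂ) * Complex.I) m) b.im
  -- `Y m` and `X (m + 1)` integrate one function at two heights, so they differ by residues. The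
  -- difference equation of `waveC` produces `Λ - lam`, which equals `Λ - Λ'` on the support of the
  -- delta in each residue.
  have hres : ∀ m : ℤ, Y m - X (m + 1) = 2 * Real.pi * Complex.I * ((Λ - Λ') *
      (waveC N b μr mr μr' m * resP N b μr' mr' m +
        waveC N b μr mr (-μr') m * resM N b μr' mr' m)) := by
    intro m
    have k := P.integral_mul_wave_sub hμ m (v₁ := -η) (v₂ := b.re - η) (by linarith) (by linarith)
      (by linarith) (by linarith) (hB m) hδ (hdec m)
    rw [eX, hY]
    simp only
    rw [k]
    have n1 : (μr' : ℂ) ≠ μr := by exact_mod_cast h1.symm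
    have n2 : (μr' : ℂ) ≠ -μr := by
      intro h; apply h2
      have : μr' = -μr := by exact_mod_cast h
      linarith
    have n3 : (-μr' : ℂ) ≠ μr := by
      intro h; apply h2
      have : -μr' = μr := by exact_mod_cast h
      linarith
    have n4 : (-μr' : ℂ) ≠ -μr := by
      intro h; apply h1
      have : -μr' = -μr := by exact_mod_cast h
      linarith
    rw [P.waveC_shift m (by simp) (by simpa using hβ) n1 n2,
      P.waveC_shift m (by simp) (by simpa using hβ) n3 n4]
    have l1 : lam N b μr' m * resP N b μr' mr' m = Λ' * resP N b μr' mr' m := by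
      rw [resP, mul_assoc, ← mul_assoc, P.lam_mul_chi, mul_assoc]
    have l2 : lam N b (-μr') m * resM N b μr' mr' m = Λ' * resM N b μr' mr' m := by
      rw [resM, mul_assoc, ← mul_assoc, ← sub_neg_eq_add m mr', P.lam_mul_chi, lam_neg,
        mul_assoc]
    linear_combination (-(2 * Real.pi * Complex.I) * waveC N b μr mr μr' m) * l1 -
      (2 * Real.pi * Complex.I) * waveC N b μr mr (-μr') m * l2
  -- The parts of the two multipliers depending on `w` and `m` coincide and cancel.
  have hpt : ∀ m : ℤ, (Λ - Λ') * (∫ u : ℝ,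
      waveC N b μr mr (u + ((-η : ℝ) : ℂ) * Complex.I) m *
        wave N b μr' mr' (u + ((-η : ℝ) : ℂ) * Complex.I) m) = Y m - X m := by
    intro m
    rw [hX, hY]
    simp only
    rw [← integral_sub (iY m) (iX m), ← integral_const_mul]
    refine integral_congr_ae (.of_forall fun u => ?_)
    simp only
    set w : ℂ := u + ((-η : ℝ) : ℂ) * Complex.I with hw
    have i : w.im = -η := by simp [hw]
    have hne := ne_real_of_im_ne (w := w) (by rw [i]; intro h; linarith) μr
    rw [P.waveC_shift m (by rw [i]; linarith) (by rw [i]; linarith) hne.1 hne.2,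
      P.wave_shift m (by rw [i]; linarith) (by rw [i]; linarith) (by rw [i]; intro h; linarith)]
    ring
  have hXper : X N = X 0 := by
    have e1 : ∀ w, waveC N b μr mr w (N : ℤ) = waveC N b μr mr w 0 := fun w => by
      simpa using P.waveC_int μr mr w 0 1
    have e2 : ∀ w, wave N b μr' mr' w ((N : ℤ) - 1) = wave N b μr' mr' w (0 - 1) := fun w => by
      have := P.wave_int μr' mr' w (0 - 1) 1
      rw [← this]; congr 1; ring
    simp only [hX, e1, e2]
  have hsum : (Λ - Λ') * innerLow N b 0 μr mr μr' mr' =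
      (Λ - Λ') * (2 * Real.pi * Complex.I * resSum N b 0 μr mr μr' mr') := by
    have e0 : ∀ w : ℂ, w - 2 * ((0 : ℝ) : ℂ) * Complex.I = w := fun w => by simp
    rw [innerLow, resSum]
    simp only [e0]
    rw [Finset.mul_sum]
    have : ∑ m ∈ Finset.range N, ((Y m - X (m + 1))) = ∑ m ∈ Finset.range N, (Y m - X m) := by
      rw [Finset.sum_sub_distrib, Finset.sum_sub_distrib, sum_range_shift hXper]
    rw [Finset.sum_congr rfl fun (m : ℕ) _ => hpt m, ← this,
      Finset.sum_congr rfl fun (m : ℕ) _ => hres m, Finset.mul_sum, Finset.mul_sum]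
    refine Finset.sum_congr rfl fun m _ => ?_
    ring
  exact mul_left_cancel₀ (sub_ne_zero.mpr (P.lam_ne h1 h2)) hsum

end Param

/-! ### Singular parts near coinciding labels. -/

theorem norm_chi_le (N : ℕ) (n : ℤ) : ‖chi N n‖ ≤ 1 := by
  rw [chi]; split_ifs <;> simp

theorem chi_neg (N : ℕ) (n : ℤ) : chi N (-n) = chi N n := by simp [chi]

theorem conj_chi (N : ℕ) (n : ℤ) : conj (chi N n) = chi N n := by
  rw [chi]; split_ifs <;> simp

namespace Param
variable {N : ℕ} {b : ℂ}

/-- Compactness handles `|Re w| ≤ 1`. Beyond it the pole term is bounded, and `Im w ≤ Re b` keeps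
the exponential in `exists_hh_bound` at most one. -/
theorem exists_hr_bound_strip (P : Param N b) :
    ∃ C, 0 < C ∧ ∀ (n : ℤ) (w : ℂ), -(b.re / 2) ≤ w.im → w.im ≤ b.re → ‖hr N b w n‖ ≤ C := by
  have hβ := P.re
  have hN := P.rpos
  have hpi := Real.pi_pos
  obtain ⟨C₁, hC₁, h₁⟩ := P.exists_hh_bound (v₁ := -(b.re / 2)) (v₂ := b.re) (by linarith)
    (by linarith)
  obtain ⟨C₂, hC₂, h₂⟩ := P.exists_hr_bound
    (isCompact_Icc.reProdIm isCompact_Icc : IsCompact (Set.Icc (-1) 1 ×ℂ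
      Set.Icc (-(b.re / 2)) b.re)) (fun w hw => by
    obtain ⟨-, h1, h2⟩ := hw
    exact ⟨by linarith, by linarith⟩)
  refine ⟨C₁ + ‖kap N b‖ + C₂, by positivity, fun n w h3 h4 => ?_⟩
  have hk := norm_nonneg (kap N b)
  by_cases hw : |w.re| ≤ 1
  · have := h₂ n w ⟨abs_le.mp hw, h3, h4⟩
    linarith
  · push Not at hw
    have hw1 : 1 ≤ ‖w‖ := hw.le.trans (Complex.abs_re_le_norm w)
    have h5 := h₁ n w h3 h4
    rw [min_eq_left hw1, mul_one] at h5
    have h6 : Real.exp (2 * Real.pi / N * (b.re - w.im) * min w.re 0) ≤ 1 := by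
      rw [Real.exp_le_one_iff]
      have : 0 ≤ b.re - w.im := by linarith
      exact mul_nonpos_of_nonneg_of_nonpos (by positivity) (min_le_right _ _)
    have h7 : hr N b w n = hh N b w n - chi N n * kap N b / w := by rw [hh]; ring
    have h8 : ‖chi N n * kap N b / w‖ ≤ ‖kap N b‖ := by
      rw [norm_div, norm_mul]
      refine div_le_of_le_mul₀ (norm_nonneg _) hk ?_
      nlinarith [norm_chi_le N n, norm_nonneg (chi N n)]
    rw [h7]
    refine (norm_sub_le _ _).trans ?_
    have : C₁ * Real.exp (2 * Real.pi / N * (b.re - w.im) * min w.re 0) ≤ C₁ * 1 := by gcongr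
    linarith

/-- Cauchy's estimate on discs of radius `Re b / 4`, which stay where `exists_hr_bound_strip`
applies. -/
theorem exists_hr_lipschitz (P : Param N b) :
    ∃ L, 0 < L ∧ ∀ (n : ℤ) (w z : ℂ), 0 ≤ w.im → w.im ≤ b.re / 2 → 0 ≤ z.im → z.im ≤ b.re / 2 →
      ‖hr N b w n - hr N b z n‖ ≤ L * ‖w - z‖ := by
  have hβ := P.re
  obtain ⟨C, hC, h⟩ := P.exists_hr_bound_strip
  refine ⟨C / (b.re / 4), by positivity, fun n w z h1 h2 h3 h4 => ?_⟩
  have hconv : Convex ℝ {x : ℂ | 0 ≤ x.im ∧ x.im ≤ b.re / 2} :=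
    (convex_halfSpace_im_ge 0).inter (convex_halfSpace_im_le (b.re / 2))
  refine hconv.norm_image_sub_le_of_norm_deriv_le (f := fun x => hr N b x n) (fun x hx => ?_)
    (fun x hx => ?_) ⟨h3, h4⟩ ⟨h1, h2⟩
  · exact (P.analyticAt_hr ⟨by linarith [hx.1], by linarith [hx.2]⟩ n).differentiableAt
  · have hball : ∀ y ∈ Metric.closedBall x (b.re / 4), -(b.re / 2) ≤ y.im ∧ y.im ≤ b.re :=
      fun y hy => by
        have h5 : |y.im - x.im| ≤ b.re / 4 := by
          have := Complex.abs_im_le_norm (y - x)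
          rw [Complex.sub_im] at this
          exact this.trans (by simpa [dist_eq_norm] using hy)
        have h6 := abs_le.mp h5
        have h7 := hx.1
        have h8 := hx.2
        constructor <;> linarith
    refine Complex.norm_deriv_le_of_forall_mem_sphere_norm_le (by positivity)
      (DifferentiableOn.diffContOnCl fun y hy => ?_) fun y hy => ?_
    · have h5 := hball y (Metric.closure_ball_subset_closedBall hy)
      exact (P.analyticAt_hr ⟨by linarith [h5.1], by linarith [h5.2]⟩
        n).differentiableAt.differentiableWithinAt
    · have h5 := hball y (Metric.sphere_subset_closedBall hy)
      exact h n y h5.1 h5.2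

/-- The singular part of a product of two `hh`-functions with reflected arguments. -/
theorem exists_hh_mul_hh_bound (P : Param N b) (α : ℝ) (n₁ n₂ : ℤ)
    (hα : α ≠ 0 ∨ chi N n₁ * chi N n₂ = 0) :
    ∃ C, 0 < C ∧ ∀ y ε : ℝ, 0 < ε → ε ≤ b.re / 8 →
      ‖hh N b (y + 2 * ε * Complex.I) n₁ * hh N b (α - y + 2 * ε * Complex.I) n₂ -
        (chi N n₁ * kap N b * hh N b α n₂ / (y + 2 * ε * Complex.I) +
        chi N n₂ * kap N b * hh N b α n₁ / (α - y + 2 * ε * Complex.I))‖ ≤ C := by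
  have hβ := P.re
  obtain ⟨C, hC, hb⟩ := P.exists_hr_bound_strip
  obtain ⟨L, hL, hl⟩ := P.exists_hr_lipschitz
  set c₁ := chi N n₁ * kap N b with hc₁
  set c₂ := chi N n₂ * kap N b with hc₂
  have hα' : α ≠ 0 ∨ c₁ * c₂ = 0 := hα.imp_right fun h => by
    rw [hc₁, hc₂]; linear_combination (kap N b) ^ 2 * h
  refine ⟨C * C + ‖c₁‖ * L + ‖c₂‖ * L + ‖c₁ * c₂‖ * (4 / α ^ 2) + 1, by positivity,
    fun y ε hε hε' => ?_⟩
  set z₁ : ℂ := y + 2 * ε * Complex.I with hz₁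
  set z₂ : ℂ := α - y + 2 * ε * Complex.I with hz₂
  have i1 : z₁.im = 2 * ε := by simp [hz₁]
  have i2 : z₂.im = 2 * ε := by simp [hz₂]
  have n1 : 2 * ε ≤ ‖z₁‖ := by
    have := Complex.abs_im_le_norm z₁
    rwa [i1, abs_of_pos (by linarith)] at this
  have n2 : 2 * ε ≤ ‖z₂‖ := by
    have := Complex.abs_im_le_norm z₂
    rwa [i2, abs_of_pos (by linarith)] at this
  have p1 : 0 < ‖z₁‖ := by linarith
  have p2 : 0 < ‖z₂‖ := by linarith
  have q1 : z₁ ≠ 0 := norm_pos_iff.mp p1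
  have q2 : z₂ ≠ 0 := norm_pos_iff.mp p2
  -- Each argument is as far from `α` as the other is from `0`, so the Lipschitz increment of one
  -- regular part compensates the pole of the other.
  have d1 : ‖z₂ - α‖ = ‖z₁‖ := by
    rw [show z₂ - α = -conj z₁ by simp [hz₁, hz₂, map_ofNat]; ring, norm_neg, Complex.norm_conj]
  have d2 : ‖z₁ - α‖ = ‖z₂‖ := by
    rw [show z₁ - α = -conj z₂ by simp [hz₁, hz₂, map_ofNat]; ring, norm_neg, Complex.norm_conj]
  -- Exact partial fractions would have `z₁ + z₂ = α + 4iε` in place of `α`; the discrepancy of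
  -- order `ε` absorbs the `1 / ε` from the poles.
  have hbr : ‖c₁ * c₂ / (z₁ * z₂) - c₁ * c₂ / (α * z₁) - c₁ * c₂ / (α * z₂)‖ ≤
      ‖c₁ * c₂‖ * (4 / α ^ 2) := by
    rcases hα' with h | h
    · have hαc : (α : ℂ) ≠ 0 := by exact_mod_cast h
      have hs : (α + 4 * ε * Complex.I : ℂ) ≠ 0 := by
        intro h0
        have := congrArg Complex.re h0
        simp at this
        exact h this
      have e : c₁ * c₂ / (z₁ * z₂) - c₁ * c₂ / (α * z₁) - c₁ * c₂ / (α * z₂) =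
          -(c₁ * c₂) * ((1 / z₁ + 1 / z₂) * (4 * ε * Complex.I) /
            (α * (α + 4 * ε * Complex.I))) := by
        have e2 : (α + 4 * ε * Complex.I : ℂ) = z₁ + z₂ := by rw [hz₁, hz₂]; ring
        have e3 : (4 * ε * Complex.I : ℂ) = z₁ + z₂ - α := by rw [← e2]; ring
        rw [e2] at hs ⊢
        rw [e3]
        field_simp
        ring
      rw [e, norm_mul, norm_neg]
      gcongr
      rw [norm_div, norm_mul, norm_mul (α : ℂ)]
      have u1 : ‖1 / z₁ + 1 / z₂‖ ≤ 1 / ε := by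
        refine (norm_add_le _ _).trans ?_
        rw [norm_div, norm_div, norm_one]
        have : 1 / ‖z₁‖ ≤ 1 / (2 * ε) := by gcongr
        have : 1 / ‖z₂‖ ≤ 1 / (2 * ε) := by gcongr
        have : 1 / (2 * ε) + 1 / (2 * ε) = 1 / ε := by field_simp; norm_num
        linarith
      have u2 : ‖(4 * ε * Complex.I : ℂ)‖ = 4 * ε := by simp [abs_of_pos hε]
      have u3 : |α| ≤ ‖(α + 4 * ε * Complex.I : ℂ)‖ := by
        simpa using Complex.abs_re_le_norm (α + 4 * ε * Complex.I : ℂ)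
      have u4 : 0 < |α| := abs_pos.mpr h
      rw [u2, Complex.norm_real, Real.norm_eq_abs]
      calc _ ≤ 1 / ε * (4 * ε) / (|α| * |α|) := by gcongr
        _ = 4 / α ^ 2 := by
          rw [← sq, sq_abs]; field_simp
    · rw [h]; simp
  have main : hh N b z₁ n₁ * hh N b z₂ n₂ - (c₁ * hh N b α n₂ / z₁ + c₂ * hh N b α n₁ / z₂) =
      hr N b z₁ n₁ * hr N b z₂ n₂ + c₁ * (hr N b z₂ n₂ - hr N b α n₂) / z₁ +
      c₂ * (hr N b z₁ n₁ - hr N b α n₁) / z₂ +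
      (c₁ * c₂ / (z₁ * z₂) - c₁ * c₂ / (α * z₁) - c₁ * c₂ / (α * z₂)) := by
    simp only [hh, ← hc₁, ← hc₂]
    ring_nf
  rw [main]
  have b1 := hb n₁ z₁ (by rw [i1]; linarith) (by rw [i1]; linarith)
  have b2 := hb n₂ z₂ (by rw [i2]; linarith) (by rw [i2]; linarith)
  have l1 := hl n₂ z₂ α (by rw [i2]; linarith) (by rw [i2]; linarith) (by simp) (by simp; linarith)
  have l2 := hl n₁ z₁ α (by rw [i1]; linarith) (by rw [i1]; linarith) (by simp) (by simp; linarith)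
  rw [d1] at l1
  rw [d2] at l2
  have t1 : ‖hr N b z₁ n₁ * hr N b z₂ n₂‖ ≤ C * C := by rw [norm_mul]; gcongr
  have t2 : ‖c₁ * (hr N b z₂ n₂ - hr N b α n₂) / z₁‖ ≤ ‖c₁‖ * L := by
    rw [norm_div, norm_mul, div_le_iff₀ p1, mul_assoc]; gcongr
  have t3 : ‖c₂ * (hr N b z₁ n₁ - hr N b α n₁) / z₂‖ ≤ ‖c₂‖ * L := by
    rw [norm_div, norm_mul, div_le_iff₀ p2, mul_assoc]; gcongr
  refine (norm_add_le_of_le (norm_add_le_of_le (norm_add_le_of_le t1 t2) t3) hbr).trans ?_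
  linarith

theorem hh_congr (P : Param N b) {n k : ℤ} (h : (N : ℤ) ∣ n - k) (w : ℂ) : hh N b w n =
    hh N b w k := by
  obtain ⟨l, hl⟩ := h
  rw [show n = k + l * N by linarith, P.hh_int]

theorem cph_congr_right (P : Param N b) {n k : ℤ} (h : (N : ℤ) ∣ n - k) (m : ℤ) : cph N m n =
    cph N m k := by
  obtain ⟨l, hl⟩ := h
  rw [show n = k + l * N by linarith, P.cph_int']

/-- Freezing the Gaussian at the pole costs `O(ε)`, which offsets a pole term of size `1 / ε`. -/
theorem exists_gau_lipschitz (μ : ℝ) : ∃ L, 0 < L ∧ ∀ ε : ℝ, 0 ≤ ε → ε ≤ b.re →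
    ‖gau N b (μ + 2 * ε * Complex.I)‖ ≤ L ∧
      ‖gau N b (μ + 2 * ε * Complex.I) - gau N b μ‖ ≤ L * ε := by
  have hK : IsCompact (Metric.closedBall (μ : ℂ) (2 * b.re)) := isCompact_closedBall _ _
  have hg := differentiable_gau N b
  have hg' : Continuous (deriv (gau N b)) :=
    (hg.contDiff (n := 1)).continuous_deriv le_rfl
  obtain ⟨C₁, h₁⟩ := hK.exists_bound_of_continuousOn hg.continuous.continuousOn
  obtain ⟨C₂, h₂⟩ := hK.exists_bound_of_continuousOn hg'.continuousOn
  refine ⟨|C₁| + 2 * |C₂| + 1, by positivity, fun ε h0 h1 => ?_⟩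
  have hn : ‖(2 * ε * Complex.I : ℂ)‖ = 2 * ε := by simp [abs_of_nonneg h0]
  have hm : (μ + 2 * ε * Complex.I : ℂ) ∈ Metric.closedBall (μ : ℂ) (2 * b.re) := by
    rw [Metric.mem_closedBall, dist_self_add_left, hn]; linarith
  have hm' : (μ : ℂ) ∈ Metric.closedBall (μ : ℂ) (2 * b.re) :=
    Metric.mem_closedBall_self (by linarith)
  constructor
  · have := h₁ _ hm
    have := le_abs_self C₁
    have := abs_nonneg C₂
    linarith
  · have := (convex_closedBall (μ : ℂ) (2 * b.re)).norm_image_sub_le_of_norm_deriv_le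
      (fun x _ => hg x) h₂ hm' hm
    rw [add_sub_cancel_left, hn] at this
    refine this.trans ?_
    have := le_abs_self C₂
    have := abs_nonneg C₁
    nlinarith

/-- The singular part of an eigenstate at a pole of another one, as a function of the label. -/
theorem exists_wave_pole_bound (P : Param N b) {μ' : ℝ} {m' : ℤ} (hμ : μ' ≠ 0 ∨ ¬ (N : ℤ) ∣ 2 * m')
    (mr : ℤ) :
    ∃ C, 0 < C ∧ ∀ μr ε : ℝ, 0 < ε → ε ≤ b.re / 8 →
      ‖wave N b μr mr (μ' + 2 * ε * Complex.I) m' - resP N b μ' m' m' *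
        (chi N (m' - mr) / (μ' - μr + 2 * ε * Complex.I) +
          chi N (m' + mr) / (μ' + μr + 2 * ε * Complex.I))‖ ≤ C := by
  have hβ := P.re
  obtain ⟨C, hC, hb⟩ := P.exists_hh_mul_hh_bound (2 * μ') (m' - mr) (m' + mr) (by
    rcases hμ with h | h
    · left; simpa using h
    · right
      by_contra hne
      have h1 := left_ne_zero_of_mul hne
      have h2 := right_ne_zero_of_mul hne
      simp only [chi, ne_eq, ite_eq_right_iff, one_ne_zero, imp_false, not_not] at h1 h2
      apply h
      have h3 := dvd_add h1 h2
      rwa [show m' - mr + (m' + mr) = 2 * m' by ring] at h3)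
  obtain ⟨L, hL, hg⟩ := exists_gau_lipschitz μ'
  set h₁ := hh N b (2 * μ' : ℝ) (m' + mr) with hh₁
  set h₂ := hh N b (2 * μ' : ℝ) (m' - mr) with hh₂
  set κ := kap N b with hκ
  refine ⟨L * C + L * (‖κ * h₁‖ + ‖κ * h₂‖), by positivity, fun μr ε hε hε' => ?_⟩
  have hb' := hb (μ' - μr) ε hε hε'
  obtain ⟨g1, g2⟩ := hg ε hε.le (by linarith)
  have ez1 : (((μ' - μr : ℝ) : ℂ) + 2 * ε * Complex.I) = μ' - μr + 2 * ε * Complex.I := by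
    push_cast; ring
  have ez2 : (((2 * μ' : ℝ) : ℂ) - ((μ' - μr : ℝ) : ℂ) + 2 * ε * Complex.I) =
      μ' + μr + 2 * ε * Complex.I := by
    push_cast; ring
  rw [ez1, ez2] at hb'
  set z₁ : ℂ := μ' - μr + 2 * ε * Complex.I with hz₁
  set z₂ : ℂ := μ' + μr + 2 * ε * Complex.I with hz₂
  set G := gau N b (μ' + 2 * ε * Complex.I) with hG
  set G₀ := gau N b μ' with hG₀
  set c := cph N m' mr with hc
  have i1 : z₁.im = 2 * ε := by simp [hz₁]
  have i2 : z₂.im = 2 * ε := by simp [hz₂]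
  have n1 : 2 * ε ≤ ‖z₁‖ := by
    have := Complex.abs_im_le_norm z₁
    rwa [i1, abs_of_pos (by linarith)] at this
  have n2 : 2 * ε ≤ ‖z₂‖ := by
    have := Complex.abs_im_le_norm z₂
    rwa [i2, abs_of_pos (by linarith)] at this
  have hres : resP N b μ' m' m' = κ * (cph N m' m' * G₀ * hh N b (2 * μ') (m' + m')) := by
    rw [resP, chi, if_pos (by simp), one_mul]
  have r1 : resP N b μ' m' m' * chi N (m' - mr) = c * G₀ * κ * h₁ * chi N (m' - mr) := by
    by_cases h : (N : ℤ) ∣ m' - mr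
    · have e1 : h₁ = hh N b (2 * μ') (m' + m') := by
        rw [hh₁, P.hh_congr (k := m' + m') (by
          rw [show m' + mr - (m' + m') = -(m' - mr) by ring]; exact h.neg_right)]
        push_cast; rfl
      have e2 : c = cph N m' m' := P.cph_congr_right (by
          rw [show mr - m' = -(m' - mr) by ring]; exact h.neg_right) m'
      rw [hres, e1, e2]; ring
    · simp [chi, h]
  -- Here `mr ≡ -m'`. The phase is even in `mr`, so both singular terms carry the same coefficient,
  -- the residue of the state labelled `(μ', m')`.
  have r2 : resP N b μ' m' m' * chi N (m' + mr) = c * G₀ * κ * h₂ * chi N (m' + mr) := by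
    by_cases h : (N : ℤ) ∣ m' + mr
    · have e1 : h₂ = hh N b (2 * μ') (m' + m') := by
        rw [hh₂, P.hh_congr (k := m' + m') (by
          rw [show m' - mr - (m' + m') = -(m' + mr) by ring]; exact h.neg_right)]
        push_cast; rfl
      have e2 : c = cph N m' m' := by
        rw [hc, ← cph_neg, P.cph_congr_right (k := m') (by
          rw [show -mr - m' = -(m' + mr) by ring]; exact h.neg_right)]
      rw [hres, e1, e2]; ring
    · simp [chi, h]
  have hw : wave N b μr mr (μ' + 2 * ε * Complex.I) m' =
      c * G * (hh N b z₁ (m' - mr) * hh N b z₂ (m' + mr)) := by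
    rw [wave, show (μ' + 2 * ε * Complex.I - μr : ℂ) = z₁ by rw [hz₁]; ring,
      show (μ' + 2 * ε * Complex.I + μr : ℂ) = z₂ by rw [hz₂]; ring]
    ring
  have main : wave N b μr mr (μ' + 2 * ε * Complex.I) m' - resP N b μ' m' m' *
      (chi N (m' - mr) / z₁ + chi N (m' + mr) / z₂) =
      c * G * (hh N b z₁ (m' - mr) * hh N b z₂ (m' + mr) -
        (chi N (m' - mr) * κ * h₁ / z₁ + chi N (m' + mr) * κ * h₂ / z₂)) +
      c * (G - G₀) * (chi N (m' - mr) * (κ * h₁) / z₁ + chi N (m' + mr) * (κ * h₂) / z₂) := by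
    rw [hw]
    linear_combination (-(1 / z₁)) * r1 - (1 / z₂) * r2
  rw [main]
  have hcn : ‖c‖ = 1 := norm_cph _ _ _
  refine norm_add_le_of_le ?_ ?_
  · rw [norm_mul, norm_mul, hcn, one_mul]
    gcongr
  · rw [norm_mul, norm_mul, hcn, one_mul]
    have t : ∀ (n : ℤ) (x z : ℂ), 2 * ε ≤ ‖z‖ → ‖chi N n * x / z‖ ≤ ‖x‖ * (1 / ε) := by
      intro n x z hz
      rw [norm_div, norm_mul, mul_one_div]
      have h1 := norm_chi_le N n
      calc _ ≤ 1 * ‖x‖ / ε := by gcongr; linarith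
        _ = _ := by rw [one_mul]
    have t12 := norm_add_le_of_le (t (m' - mr) (κ * h₁) z₁ n1) (t (m' + mr) (κ * h₂) z₂ n2)
    calc _ ≤ (L * ε) * (‖κ * h₁‖ * (1 / ε) + ‖κ * h₂‖ * (1 / ε)) := by gcongr
      _ = _ := by field_simp

/-- Changing the sign of the label exchanges the two dilogarithms, so the second pole reduces to the
first. -/
theorem resM_eq (μ' : ℝ) (m' m : ℤ) : resM N b μ' m' m = resP N b (-μ') (-m') m := by
  rw [resM, resP, cph_neg, sub_neg_eq_add, ← sub_eq_add_neg]
  push_cast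
  rw [mul_neg]

theorem sum_chi_mul (P : Param N b) {Φ : ℤ → ℂ} (hΦ : ∀ m k : ℤ, Φ (m + k * N) = Φ m) (k : ℤ) :
    ∑ m ∈ Finset.range N, chi N (m - k) * Φ m = Φ k := by
  have hN : (N : ℤ) ≠ 0 := by exact_mod_cast P.pos.ne'
  have h0 := Int.emod_nonneg k hN
  have hlt := Int.emod_lt_of_pos k (b := N) (by exact_mod_cast P.pos)
  have hk := Int.emod_add_mul_ediv k N
  have hmem : (k % N).toNat ∈ Finset.range N := by simp; omega
  rw [Finset.sum_eq_single_of_mem _ hmem fun m hm hne => ?_]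
  · rw [Int.toNat_of_nonneg h0, chi, if_pos ⟨-(k / N), by linarith⟩, one_mul]
    conv_rhs => rw [show k = k % N + (k / N) * N by linarith, hΦ]
  · rw [chi, if_neg, zero_mul]
    intro hdvd
    apply hne
    have h1 : (m : ℤ) % N = k % N := Int.emod_eq_emod_iff_emod_sub_eq_zero.mpr
      (Int.emod_eq_zero_of_dvd hdvd)
    rw [Int.emod_eq_of_lt (by positivity) (by exact_mod_cast Finset.mem_range.mp hm)] at h1
    omega

/-- The delta in each residue collapses the sum over `m` to the class of `m'` or of `-m'`. -/
theorem resSum_eq (P : Param N b) (ε μr : ℝ) (mr : ℤ) (μ' : ℝ) (m' : ℤ) :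
    resSum N b ε μr mr μ' m' =
      conj (wave N b μr mr (μ' + 2 * ε * Complex.I) m') * resP N b μ' m' m' +
      conj (wave N b μr mr (-μ' + 2 * ε * Complex.I) (-m')) * resP N b (-μ') (-m') (-m') := by
  have key : ∀ (x : ℝ) (k : ℤ), ∑ m ∈ Finset.range N,
      waveC N b μr mr (x - 2 * ε * Complex.I) m * resP N b x k m =
      conj (wave N b μr mr (x + 2 * ε * Complex.I) k) * resP N b x k k := by
    intro x k
    have e : ∀ m : ℤ, waveC N b μr mr (x - 2 * ε * Complex.I) m =
        conj (wave N b μr mr (x + 2 * ε * Complex.I) m) := fun m => by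
      rw [waveC]
      congr 2
      simp only [map_sub, map_mul, Complex.conj_ofReal, Complex.conj_I, map_ofNat]
      ring
    set Φ : ℤ → ℂ := fun m => waveC N b μr mr (x - 2 * ε * Complex.I) m *
      (kap N b * (cph N m k * gau N b x * hh N b (2 * x) (m + k))) with hΦ
    have h1 := P.sum_chi_mul (Φ := Φ) (fun m l => by
      simp only [hΦ]
      rw [P.waveC_int, P.cph_int, show m + l * N + k = m + k + l * N by ring, P.hh_int]) k
    have h2 : ∀ m : ℤ, waveC N b μr mr (x - 2 * ε * Complex.I) m * resP N b x k m =
        chi N (m - k) * Φ m := fun m => by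
      simp only [hΦ, resP]; ring
    simp only [h2]
    rw [h1, ← e, resP, chi, if_pos (by simp), one_mul]
  have k1 := key μ' m'
  have k2 := key (-μ') (-m')
  push_cast at k2
  rw [resSum, Finset.sum_add_distrib, k1]
  congr 1
  simp only [resM_eq]
  exact k2

end Param

/-! ### Poisson kernels and the spectral density. -/

/-- The Poisson kernel of the upper half plane, up to a factor `π`. -/
def poi (v u : ℝ) : ℝ := v * (u ^ 2 + v ^ 2)⁻¹

theorem poi_eq {v : ℝ} (hv : 0 < v) (y : ℝ) :
    1 / (y - v * Complex.I) - 1 / (y + v * Complex.I) = 2 * Complex.I * poi v y := by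
  have h1 : (y - v * Complex.I : ℂ) ≠ 0 := fun h => by
    have := congrArg Complex.im h
    simp at this; linarith
  have h2 : (y + v * Complex.I : ℂ) ≠ 0 := fun h => by
    have := congrArg Complex.im h
    simp at this; linarith
  have h3 : ((y : ℂ) ^ 2 + v ^ 2) = (y - v * Complex.I) * (y + v * Complex.I) := by
    linear_combination (v : ℂ) ^ 2 * Complex.I_sq
  rw [poi]
  push_cast
  rw [h3]
  field_simp
  ring

theorem rho_neg (N : ℕ) (b : ℂ) (μ : ℝ) (m : ℤ) : rho N b (-μ) (-m) = rho N b μ m := by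
  have e : ∀ x : ℂ, 2 * Real.pi / N * (x * ((-μ : ℝ) : ℂ) + ((-m : ℤ) : ℂ)) =
      -(2 * Real.pi / N * (x * μ + m)) := fun x => by push_cast; ring
  rw [rho, rho, e, e, Complex.sin_neg, Complex.sin_neg, neg_mul_neg]

namespace Param
variable {N : ℕ} {b : ℂ}

theorem rho_congr (P : Param N b) {m k : ℤ} (h : (N : ℤ) ∣ m - k) (μ : ℝ) : rho N b μ m =
    rho N b μ k := by
  obtain ⟨l, hl⟩ := h
  have hN := P.ne
  have e : ∀ x : ℂ, Complex.sin (2 * Real.pi / N * (x + m)) =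
      Complex.sin (2 * Real.pi / N * (x + k)) := fun x => by
    rw [← Complex.sin_add_int_mul_two_pi (2 * Real.pi / N * (x + k)) l, show m = k + N * l by
      linarith]
    congr 1
    push_cast
    field_simp
    ring
  rw [rho, rho, e, e]

theorem sin_eq (P : Param N b) (μ : ℝ) (m : ℤ) :
    Complex.sin (2 * Real.pi / N * (-Complex.I * b⁻¹ * μ + m)) =
      (exc N b μ m - (exc N b μ m)⁻¹) * Complex.I / 2 := by
  rw [Complex.sin, exc, ← Complex.exp_neg, P.inv_eq]
  congr 4
  · linear_combination (2 * Real.pi / N * conj b * μ) * Complex.I_sq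
  · linear_combination (-(2 * Real.pi / N * conj b * μ)) * Complex.I_sq

/-- Because `b⁻¹ = conj b`, the sines in `rho` are conjugate, and their product is a squared modulus
comparable with that of a residue. -/
theorem sin_eq' (P : Param N b) (μ : ℝ) (m : ℤ) :
    Complex.sin (2 * Real.pi / N * (Complex.I * b * μ + m)) =
      conj (Complex.sin (2 * Real.pi / N * (-Complex.I * b⁻¹ * μ + m))) := by
  rw [← Complex.sin_conj, P.inv_eq]
  congr 1
  simp [map_ofNat]

/-- The residues of the eigenstate determine the spectral measure. -/
theorem norm_resP_sq (P : Param N b) {μ : ℝ} {m : ℤ} (hμ : μ ≠ 0 ∨ ¬ (N : ℤ) ∣ 2 * m) :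
    4 * (Real.pi : ℂ) ^ 2 * (‖resP N b μ m m‖ ^ 2 : ℝ) = 1 / 4 * rho N b μ m := by
  have hN := P.rpos
  have hpi := Real.pi_pos
  set V := exc N b μ m with hV
  have hV0 : V ≠ 0 := Complex.exp_ne_zero _
  have hn : ‖resP N b μ m m‖ = N / (2 * Real.pi) * (‖V‖ / ‖1 - V * V‖) := by
    rw [resP, chi, if_pos (by simp), one_mul, norm_mul, norm_mul, norm_mul, norm_cph, P.norm_kap,
      P.norm_hh_real (by simp) (by
        rcases hμ with h | h
        · left; simpa using h
        · right; rwa [← two_mul]), two_mul (μ : ℂ), exc_add, norm_gau, hV, norm_exc]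
    rw [one_mul, mul_one_div]
    congr 3
    simp
    ring
  have hs : Complex.sin (2 * Real.pi / N * (Complex.I * b * μ + m)) *
      Complex.sin (2 * Real.pi / N * (-Complex.I * b⁻¹ * μ + m)) =
      ((‖1 - V * V‖ / (2 * ‖V‖)) ^ 2 : ℝ) := by
    rw [P.sin_eq', mul_comm, Complex.mul_conj, P.sin_eq, ← hV, Complex.normSq_eq_norm_sq]
    congr 2
    rw [show V - V⁻¹ = -((1 - V * V) / V) by field_simp; ring]
    simp
    field_simp
  rw [rho, hs, hn]
  have hN' := P.ne
  have hpi' : (Real.pi : ℂ) ≠ 0 := by exact_mod_cast hpi.ne'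
  push_cast
  rw [← inv_pow, inv_div]
  field_simp
  norm_num

theorem chi_mul_norm_resP_sq (P : Param N b) {μ : ℝ} {m : ℤ} (hμ : μ ≠ 0 ∨ ¬ (N : ℤ) ∣ 2 * m)
    (mr : ℤ) :
    4 * (Real.pi : ℂ) ^ 2 * (‖resP N b μ m m‖ ^ 2 : ℝ) * chi N (m - mr) =
      1 / 4 * rho N b μ mr * kron N mr m := by
  rw [P.norm_resP_sq hμ, chi, kron]
  simp only [Int.modEq_iff_dvd]
  split_ifs with h
  · rw [P.rho_congr h]
  · simp

theorem norm_resP_neg (P : Param N b) {μ : ℝ} {m : ℤ} (hμ : μ ≠ 0 ∨ ¬ (N : ℤ) ∣ 2 * m) :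
    ‖resP N b (-μ) (-m) (-m)‖ ^ 2 = ‖resP N b μ m m‖ ^ 2 := by
  have h1 := P.norm_resP_sq (μ := -μ) (m := -m) (by simpa using hμ)
  rw [rho_neg, ← P.norm_resP_sq hμ] at h1
  have hpi : (4 * Real.pi ^ 2 : ℂ) ≠ 0 := by
    simp
  exact_mod_cast mul_left_cancel₀ hpi h1

/-- Near the poles the contribution of the residues is a sum of Poisson kernels. -/
theorem exists_resSum_bound (P : Param N b) {μ' : ℝ} {m' : ℤ} (hμ : μ' ≠ 0 ∨ ¬ (N : ℤ) ∣ 2 * m')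
    (mr : ℤ) :
    ∃ C, ∀ μr ε : ℝ, 0 < ε → ε ≤ b.re / 8 →
      ‖2 * Real.pi * Complex.I * resSum N b ε μr mr μ' m' +
        4 * Real.pi * (‖resP N b μ' m' m'‖ ^ 2 : ℝ) *
          (chi N (m' - mr) * poi (2 * ε) (μr - μ') +
            chi N (-m' - mr) * poi (2 * ε) (μr - -μ'))‖ ≤ C := by
  obtain ⟨C₁, -, h₁⟩ := P.exists_wave_pole_bound hμ mr
  obtain ⟨C₂, -, h₂⟩ := P.exists_wave_pole_bound (μ' := -μ') (m' := -m') (by simpa using hμ) mr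
  set R := resP N b μ' m' m' with hR
  set R' := resP N b (-μ') (-m') (-m') with hR'
  have q1 : conj R * R = ((‖R‖ ^ 2 : ℝ) : ℂ) := by
    rw [mul_comm, Complex.mul_conj, Complex.normSq_eq_norm_sq]
  have q2 : conj R' * R' = ((‖R‖ ^ 2 : ℝ) : ℂ) := by
    rw [mul_comm, Complex.mul_conj, Complex.normSq_eq_norm_sq, P.norm_resP_neg hμ]
  refine ⟨2 * Real.pi * (C₁ * ‖R‖ + C₂ * ‖R'‖), fun μr ε hε hε' => ?_⟩
  have g₁ := h₁ μr ε hε hε'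
  have g₂ := h₂ μr ε hε hε'
  rw [show -m' + mr = -(m' - mr) by ring, chi_neg] at g₂
  have e2 : chi N (m' + mr) = chi N (-m' - mr) := by
    rw [← chi_neg, neg_add']
  rw [e2] at g₁
  set a := chi N (m' - mr) with ha
  set c := chi N (-m' - mr) with hc
  rw [← Complex.norm_conj] at g₁ g₂
  rw [P.resSum_eq, ← hR, ← hR']
  push_cast at g₂
  set W := conj (wave N b μr mr (μ' + 2 * ε * Complex.I) m') with hW
  set W' := conj (wave N b μr mr (-μ' + 2 * ε * Complex.I) (-m')) with hW'
  simp only [map_sub, map_mul, map_add, map_div₀, Complex.conj_ofReal, Complex.conj_I, map_ofNat,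
    map_neg, ha, hc, conj_chi] at g₁ g₂
  rw [← ha, ← hc, ← hW] at g₁
  rw [← ha, ← hc, ← hW'] at g₂
  have p1 := poi_eq (v := 2 * ε) (by linarith) (μr - μ')
  have p2 := poi_eq (v := 2 * ε) (by linarith) (μr - -μ')
  push_cast at p1 p2
  have f1 : (1 : ℂ) / (μ' - μr + 2 * ε * -Complex.I) = -(1 / (μr - μ' + 2 * ε * Complex.I)) := by
    rw [← one_div_neg_eq_neg_one_div]; congr 1; ring
  have f2 : (1 : ℂ) / (μ' + μr + 2 * ε * -Complex.I) = 1 / (μr - -μ' - 2 * ε * Complex.I) := by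
    congr 1; ring
  have f3 : (1 : ℂ) / (-μ' - μr + 2 * ε * -Complex.I) =
      -(1 / (μr - -μ' + 2 * ε * Complex.I)) := by
    rw [← one_div_neg_eq_neg_one_div]; congr 1; ring
  have f4 : (1 : ℂ) / (-μ' + μr + 2 * ε * -Complex.I) = 1 / (μr - μ' - 2 * ε * Complex.I) := by
    congr 1; ring
  -- The residue at `μ'` contributes `-1 / (μr - μ' + 2iε)` and the residue at `-μ'` contributes `1
  -- / (μr - μ' - 2iε)`, both weighted by `‖R‖ ^ 2`; `poi_eq` merges them. The point `-μ'` is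
  -- treated in the same way.
  have main : 2 * Real.pi * Complex.I * (W * R + W' * R') +
      4 * Real.pi * (‖R‖ ^ 2 : ℝ) * (a * poi (2 * ε) (μr - μ') + c * poi (2 * ε) (μr - -μ')) =
      2 * Real.pi * Complex.I * (
        (W - conj R * (a / (μ' - μr + 2 * ε * -Complex.I) + c / (μ' + μr + 2 * ε * -Complex.I))) * R
          +
        (W' - conj R' * (c / (-μ' - μr + 2 * ε * -Complex.I) +
          a / (-μ' + μr + 2 * ε * -Complex.I))) * R') := by
    rw [div_eq_mul_one_div a, div_eq_mul_one_div c, div_eq_mul_one_div c, div_eq_mul_one_div a,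
      f1, f2, f3, f4]
    linear_combination
      2 * Real.pi * Complex.I *
        ((-a * (1 / (μr - μ' + 2 * ε * Complex.I)) + c * (1 / (μr - -μ' - 2 * ε * Complex.I))) * q1
          +
        (-c * (1 / (μr - -μ' + 2 * ε * Complex.I)) +
          a * (1 / (μr - μ' - 2 * ε * Complex.I))) * q2) +
      2 * Real.pi * Complex.I * (‖R‖ ^ 2 : ℝ) * (a * p1 + c * p2) +
      4 * Real.pi * (‖R‖ ^ 2 : ℝ) * (a * poi (2 * ε) (μr - μ') + c * poi (2 * ε) (μr - -μ')) *
        Complex.I_sq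
  rw [main, norm_mul]
  have : ‖(2 * Real.pi * Complex.I : ℂ)‖ = 2 * Real.pi := by simp [abs_of_pos Real.pi_pos]
  rw [this]
  have := Real.pi_pos
  gcongr
  refine norm_add_le_of_le ?_ ?_ <;> rw [norm_mul] <;> gcongr

end Param

/-! ### Approximate identities and tempered distributions. -/

theorem continuous_poi {v : ℝ} (hv : 0 < v) : Continuous (poi v) := by
  unfold poi
  exact continuous_const.mul (Continuous.inv₀ (by fun_prop) fun u => by positivity)

theorem norm_poi_le {v : ℝ} (hv : 0 < v) (u : ℝ) : ‖(poi v u : ℂ)‖ ≤ v * (v ^ 2)⁻¹ := by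
  rw [Complex.norm_real, poi, Real.norm_of_nonneg (by positivity)]
  gcongr
  nlinarith [sq_nonneg u]

theorem integrable_bounded_mul {g : ℝ → ℂ} (hg : Continuous g) {C : ℝ} (hC : ∀ x, ‖g x‖ ≤ C)
    (F : 𝓢(ℝ, ℂ)) : Integrable fun x => g x * F x :=
  F.integrable.bdd_mul hg.aestronglyMeasurable (.of_forall hC)

/-- The Poisson kernel is an approximate identity. -/
theorem tendsto_integral_poi (F : 𝓢(ℝ, ℂ)) (x₀ : ℝ) :
    Tendsto (fun v : ℝ => ∫ x : ℝ, (poi v (x - x₀) : ℂ) * F x) (𝓝[>] 0) (𝓝 (Real.pi * F x₀)) := by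
  obtain ⟨K, hK⟩ : ∃ K, ∀ x, ‖F x‖ ≤ K := by
    obtain ⟨K, -, h⟩ := F.decay 0 0
    exact ⟨K, fun x => by simpa using h x⟩
  have e : ∀ v : ℝ, 0 < v → ∫ x : ℝ, (poi v (x - x₀) : ℂ) * F x =
      ∫ t : ℝ, (((1 + t ^ 2)⁻¹ : ℝ) : ℂ) * F (v * t + x₀) := by
    intro v hv
    have h1 := Measure.integral_comp_mul_left (fun x : ℝ => (poi v x : ℂ) * F (x + x₀)) v
    have h2 := integral_add_right_eq_self (μ := volume)
      (fun x : ℝ => (poi v (x - x₀) : ℂ) * F x) x₀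
    simp only [add_sub_cancel_right] at h2
    rw [h2] at h1
    rw [abs_of_pos (by positivity), eq_inv_smul_iff₀ hv.ne', ← integral_smul] at h1
    rw [← h1]
    refine integral_congr_ae (.of_forall fun t => ?_)
    simp only [poi, Complex.real_smul]
    rw [← mul_assoc, ← Complex.ofReal_mul]
    congr 2
    field_simp
    ring
  have hlim : ∫ t : ℝ, (((1 + t ^ 2)⁻¹ : ℝ) : ℂ) * F x₀ = Real.pi * F x₀ := by
    rw [integral_mul_const, integral_complex_ofReal, integral_univ_inv_one_add_sq]
  rw [← hlim]
  have hd : Tendsto (fun v : ℝ => ∫ t : ℝ, (((1 + t ^ 2)⁻¹ : ℝ) : ℂ) * F (v * t + x₀)) (𝓝[>] 0)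
      (𝓝 (∫ t : ℝ, (((1 + t ^ 2)⁻¹ : ℝ) : ℂ) * F x₀)) := by
    refine tendsto_integral_filter_of_dominated_convergence (fun t => (1 + t ^ 2)⁻¹ * K)
      (.of_forall fun v => ?_) (.of_forall fun v => .of_forall fun t => ?_)
      (integrable_inv_one_add_sq.mul_const K) (.of_forall fun t => ?_)
    · refine Continuous.aestronglyMeasurable ?_
      refine (Complex.continuous_ofReal.comp
        (Continuous.inv₀ (by fun_prop) fun u => by positivity)).mul ?_
      exact F.continuous.comp (by fun_prop)
    · rw [norm_mul, Complex.norm_real, Real.norm_of_nonneg (by positivity)]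
      gcongr
      exact hK _
    · refine Tendsto.const_mul _ ?_
      have : Continuous fun v : ℝ => F (v * t + x₀) := F.continuous.comp (by fun_prop)
      have h := this.tendsto 0
      simp only [zero_mul, zero_add] at h
      exact h.mono_left nhdsWithin_le_nhds
  refine hd.congr' ?_
  filter_upwards [self_mem_nhdsWithin] with v hv
  exact (e v hv).symm

theorem tendsto_poi_zero {y : ℝ} (hy : y ≠ 0) : Tendsto (fun v : ℝ => poi v y) (𝓝[>] 0) (𝓝 0) := by
  have : ContinuousAt (fun v : ℝ => poi v y) 0 := by
    unfold poi
    exact continuousAt_id.mul (ContinuousAt.inv₀ (by fun_prop) (by positivity))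
  have h := this.tendsto
  simp only [poi, zero_mul] at h
  exact h.mono_left nhdsWithin_le_nhds

theorem tendsto_two_mul : Tendsto (fun v : ℝ => 2 * v) (𝓝[>] 0) (𝓝[>] 0) := by
  refine tendsto_nhdsWithin_iff.mpr ⟨?_, ?_⟩
  · have : Continuous fun v : ℝ => 2 * v := by fun_prop
    simpa using (this.tendsto 0).mono_left nhdsWithin_le_nhds
  · filter_upwards [self_mem_nhdsWithin] with v hv
    simpa using hv

/-- A bounded continuous function defines a tempered distribution. -/
theorem exists_temperedDistribution {g : ℝ → ℂ} (hg : Continuous g) {C : ℝ} (hC : ∀ x, ‖g x‖ ≤ C) :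
    ∃ T : 𝓢'(ℝ, ℂ), ∀ F : 𝓢(ℝ, ℂ), T F = ∫ x, g x * F x := by
  have hm : MemLp g ⊤ volume := memLp_top_of_bound hg.aestronglyMeasurable C (.of_forall hC)
  refine ⟨Lp.toTemperedDistribution (hm.toLp g), fun F => ?_⟩
  rw [Lp.toTemperedDistribution_apply]
  refine integral_congr_ae ?_
  filter_upwards [hm.coeFn_toLp] with x hx
  rw [hx, smul_eq_mul, mul_comm]

/-! ### The limit of the inner products. -/

/-- The inner product of two eigenstates, in the rescaled regulator. -/
def innerWave (N : ℕ) (b : ℂ) (v μr : ℝ) (mr : ℤ) (μr' : ℝ) (mr' : ℤ) : ℂ :=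
  ∑ m ∈ Finset.range N, ∫ u : ℝ, conj (wave N b μr mr (u + v * Complex.I) m) *
      wave N b μr' mr' (u + v * Complex.I) m

namespace Param
variable {N : ℕ} {b : ℂ}

theorem exists_conj_wave_mul_wave_bound (P : Param N b) {v : ℝ} (hv : 0 < v) (hv' : v < b.re) :
    ∃ C, 0 < C ∧ ∀ (μr : ℝ) (mr : ℤ) (μr' : ℝ) (mr' m : ℤ) (u : ℝ),
      ‖conj (wave N b μr mr (u + v * Complex.I) m) * wave N b μr' mr' (u + v * Complex.I) m‖ ≤
        C * Real.exp (-(2 * Real.pi / N * (b.re - v) * |u|)) := by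
  obtain ⟨C, hC, h⟩ := P.exists_wave_bound_line (by linarith [P.re] : -b.re < v) hv'.le hv
  refine ⟨C * C, by positivity, fun μr mr μr' mr' m u => ?_⟩
  have hN := P.rpos
  have hpi := Real.pi_pos
  have hi : (u + v * Complex.I : ℂ).im = v := by simp
  have hr : (u + v * Complex.I : ℂ).re = u := by simp
  have h' : ∀ (μr : ℝ) (mr : ℤ), ‖wave N b μr mr (u + v * Complex.I) m‖ ≤
      C * Real.exp (-(2 * Real.pi / N * (b.re - v) * |u|)) := fun μr mr => by
    have := h μr mr m (u + v * Complex.I) (by rw [hi]) (by rw [hi])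
      (by rw [hi]; exact le_abs_self v)
    rwa [hi, hr] at this
  have h1 : Real.exp (-(2 * Real.pi / N * (b.re - v) * |u|)) ≤ 1 := by
    rw [Real.exp_le_one_iff, neg_nonpos]
    have : 0 < b.re - v := by linarith
    positivity
  rw [norm_mul, Complex.norm_conj]
  calc _ ≤ (C * 1) * (C * Real.exp (-(2 * Real.pi / N * (b.re - v) * |u|))) := by
        gcongr
        · exact (h' μr mr).trans (by gcongr)
        · exact h' μr' mr'
    _ = _ := by ring

theorem integrable_conj_wave_mul_wave (P : Param N b) {v : ℝ} (hv : 0 < v) (hv' : v < b.re) (μr : ℝ)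
    (mr : ℤ)
    (μr' : ℝ) (mr' m : ℤ) : Integrable fun u : ℝ =>
      conj (wave N b μr mr (u + v * Complex.I) m) * wave N b μr' mr' (u + v * Complex.I) m := by
  obtain ⟨C, -, h⟩ := P.exists_conj_wave_mul_wave_bound hv hv'
  have hN := P.rpos
  have hpi := Real.pi_pos
  have hβ := P.re
  have hd : 0 < 2 * Real.pi / N * (b.re - v) := mul_pos (by positivity) (by linarith)
  have hc := fun (x : ℝ) (k : ℤ) => P.continuous_wave_line (v := v) (by linarith) (by linarith)
    hv.ne' x k m
  exact integrable_of_exp_bound (R := 0)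
    ((Complex.continuous_conj.comp (hc μr mr)).mul (hc μr' mr'))
    hd fun u _ => h μr mr μr' mr' m u

theorem exists_innerWave_bound (P : Param N b) {v : ℝ} (hv : 0 < v) (hv' : v < b.re) :
    ∃ C, ∀ (μr : ℝ) (mr : ℤ) (μr' : ℝ) (mr' : ℤ), ‖innerWave N b v μr mr μr' mr'‖ ≤ C := by
  obtain ⟨C, -, h⟩ := P.exists_conj_wave_mul_wave_bound hv hv'
  have hN := P.rpos
  have hpi := Real.pi_pos
  have hd : 0 < 2 * Real.pi / N * (b.re - v) := mul_pos (by positivity) (by linarith)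
  refine ⟨∑ m ∈ Finset.range N, ∫ u : ℝ, C * Real.exp (-(2 * Real.pi / N * (b.re - v) * |u|)),
    fun μr mr μr' mr' => ?_⟩
  refine (norm_sum_le _ _).trans (Finset.sum_le_sum fun m _ => ?_)
  exact norm_integral_le_of_norm_le ((integrable_exp_neg_mul_abs hd).const_mul C)
    (.of_forall fun u => h μr mr μr' mr' m u)

theorem continuous_wave_label (P : Param N b) {w : ℂ} (h0 : w.im ≠ 0) (hw : w ∈ strip b)
    (mr m : ℤ) :
    Continuous fun μr : ℝ => wave N b μr mr w m := by
  refine continuous_iff_continuousAt.mpr fun μr => ?_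
  have hne := ne_real_of_im_ne h0 μr
  have c1 : ContinuousAt (fun x : ℝ => hh N b (w - x) (m - mr)) μr :=
    (P.analyticAt_hh (sub_real_mem_strip hw μr) (sub_ne_zero.mpr hne.1)).continuousAt.comp
      (f := fun x : ℝ => w - x) (by fun_prop)
  have c2 : ContinuousAt (fun x : ℝ => hh N b (w + x) (m + mr)) μr :=
    (P.analyticAt_hh (add_real_mem_strip hw μr) (fun h => hne.2 (eq_neg_of_add_eq_zero_left
      h))).continuousAt.comp
      (f := fun x : ℝ => w + x) (by fun_prop)
  exact (continuousAt_const.mul c1).mul c2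

/-- With `exists_innerWave_bound` this makes the inner product a bounded continuous function of the
label, hence a tempered distribution. -/
theorem continuous_innerWave (P : Param N b) {v : ℝ} (hv : 0 < v) (hv' : v < b.re) (mr : ℤ)
    (μr' : ℝ) (mr' : ℤ) :
    Continuous fun μr => innerWave N b v μr mr μr' mr' := by
  obtain ⟨C, -, h⟩ := P.exists_conj_wave_mul_wave_bound hv hv'
  have hN := P.rpos
  have hpi := Real.pi_pos
  have hd : 0 < 2 * Real.pi / N * (b.re - v) := mul_pos (by positivity) (by linarith)
  refine continuous_finsetSum _ fun m _ => ?_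
  refine continuous_of_dominated
    (fun μr => (P.integrable_conj_wave_mul_wave hv hv' μr mr μr' mr' m).aestronglyMeasurable)
    (fun μr => .of_forall fun u => h μr mr μr' mr' m u)
    ((integrable_exp_neg_mul_abs hd).const_mul C) (.of_forall fun u => ?_)
  refine (Complex.continuous_conj.comp (P.continuous_wave_label ?_ ?_ mr m)).mul continuous_const
  · simpa using hv.ne'
  · constructor <;> simp <;> linarith

/-- The part of the inner product that remains bounded up to the real axis. -/
theorem exists_innerWave_sub_poi_bound (P : Param N b) {μ' : ℝ} {m' : ℤ}
    (hμ : μ' ≠ 0 ∨ ¬ (N : ℤ) ∣ 2 * m')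
    (mr : ℤ) :
    ∃ C, ∀ μr v : ℝ, 0 < v → v ≤ b.re / 8 →
      ‖innerWave N b v μr mr μ' m' - 4 * Real.pi * (‖resP N b μ' m' m'‖ ^ 2 : ℝ) *
          (chi N (m' - mr) * poi (2 * v) (μr - μ') +
            chi N (-m' - mr) * poi (2 * v) (μr - -μ'))‖ ≤ C := by
  obtain ⟨C₁, -, h₁⟩ := P.exists_innerLow_bound
  obtain ⟨C₂, h₂⟩ := P.exists_resSum_bound hμ mr
  refine ⟨C₁ + C₂, fun μr v hv hv' => ?_⟩
  rw [innerWave, P.inner_eq hv hv' μr mr hμ, sub_sub]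
  exact norm_sub_le_of_le (h₁ v μr mr μ' m' hv.le hv') (h₂ μr v hv hv')

/-- Both parts vanish separately: the inner product by orthogonality, the kernels because they
concentrate elsewhere. Hence `Q` is arbitrary. -/
theorem tendsto_innerWave_sub_poi (P : Param N b) {μr μ' : ℝ} {m' : ℤ}
    (hμ : μ' ≠ 0 ∨ ¬ (N : ℤ) ∣ 2 * m') (mr : ℤ)
    (h1 : μr ≠ μ') (h2 : μr ≠ -μ') (Q : ℂ) :
    Tendsto (fun v : ℝ => innerWave N b v μr mr μ' m' - Q *
          (chi N (m' - mr) * poi (2 * v) (μr - μ') +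
            chi N (-m' - mr) * poi (2 * v) (μr - -μ'))) (𝓝[>] 0) (𝓝 0) := by
  have hβ := P.re
  have t1 : Tendsto (fun v => innerWave N b v μr mr μ' m') (𝓝[>] 0) (𝓝 0) := by
    have h := (P.tendsto_innerLow μr mr μ' m').sub
      ((P.tendsto_resSum mr m' h1 h2).const_mul (2 * Real.pi * Complex.I))
    rw [P.innerLow_eq_resSum mr hμ h1 h2, sub_self] at h
    refine h.congr' ?_
    filter_upwards [Ioc_mem_nhdsGT (by linarith : (0 : ℝ) < b.re / 8)] with v hv
    rw [innerWave, P.inner_eq hv.1 hv.2 μr mr hμ]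
  have tp : ∀ y : ℝ, y ≠ 0 → Tendsto (fun v : ℝ => (poi (2 * v) y : ℂ)) (𝓝[>] 0) (𝓝 0) := by
    intro y hy
    have := (Complex.continuous_ofReal.tendsto 0).comp ((tendsto_poi_zero hy).comp tendsto_two_mul)
    simpa [Function.comp_def] using this
  have := t1.sub ((((tp _ (sub_ne_zero.mpr h1)).const_mul (chi N (m' - mr))).add
    ((tp _ (sub_ne_zero.mpr h2)).const_mul (chi N (-m' - mr)))).const_mul Q)
  simpa using this

/-- The limit of the inner products, tested against a Schwartz function. -/
theorem tendsto_integral_innerWave (P : Param N b) {μ' : ℝ} {m' : ℤ}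
    (hμ : μ' ≠ 0 ∨ ¬ (N : ℤ) ∣ 2 * m') (mr : ℤ)
    (F : 𝓢(ℝ, ℂ)) :
    Tendsto (fun v : ℝ => ∫ μr : ℝ, innerWave N b v μr mr μ' m' * F μr) (𝓝[>] 0)
      (𝓝 (1 / 4 * rho N b μ' mr * kron N mr m' * F μ' +
        1 / 4 * rho N b (-μ') mr * kron N mr (-m') * F (-μ'))) := by
  have hβ := P.re
  set Q : ℂ := ((‖resP N b μ' m' m'‖ ^ 2 : ℝ) : ℂ) with hQ
  set a := chi N (m' - mr) with ha
  set c := chi N (-m' - mr) with hc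
  set p : ℝ → ℝ → ℂ := fun v x => 4 * Real.pi * Q *
    (a * poi (2 * v) (x - μ') + c * poi (2 * v) (x - -μ')) with hp
  obtain ⟨C, hC⟩ := P.exists_innerWave_sub_poi_bound hμ mr
  have hpc : ∀ v : ℝ, 0 < v → Continuous (p v) := fun v hv => by
    have := continuous_poi (by linarith : 0 < 2 * v)
    simp only [hp]
    fun_prop
  have hIc : ∀ v : ℝ, 0 < v → v ≤ b.re / 8 → Continuous fun x => innerWave N b v x mr μ' m' :=
    fun v hv hv' => P.continuous_innerWave hv (by linarith) mr μ' m'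
  -- The remainder is dominated by `C * ‖F x‖`, and its pointwise limit is needed only off the null
  -- set `{μ', -μ'}`.
  have hrem : Tendsto (fun v : ℝ => ∫ x : ℝ, (innerWave N b v x mr μ' m' - p v x) * F x) (𝓝[>] 0)
      (𝓝 (∫ x : ℝ, (0 : ℂ))) := by
    have hsmall : ∀ᶠ v : ℝ in 𝓝[>] 0, v ∈ Set.Ioc 0 (b.re / 8) := Ioc_mem_nhdsGT (by linarith)
    refine tendsto_integral_filter_of_dominated_convergence (fun x => C * ‖F x‖) ?_ ?_
      (F.integrable.norm.const_mul C) ?_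
    · filter_upwards [hsmall] with v hv
      exact (((hIc v hv.1 hv.2).sub (hpc v hv.1)).mul F.continuous).aestronglyMeasurable
    · filter_upwards [hsmall] with v hv
      refine .of_forall fun x => ?_
      rw [norm_mul]
      gcongr
      exact hC x v hv.1 hv.2
    · have : ({μ', -μ'} : Set ℝ)ᶜ ∈ ae (volume : Measure ℝ) :=
        compl_mem_ae_iff.mpr ((Set.toFinite ({μ', -μ'} : Set ℝ)).measure_zero _)
      filter_upwards [this] with x hx
      simp only [Set.mem_compl_iff, Set.mem_insert_iff, Set.mem_singleton_iff, not_or] at hx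
      have := (P.tendsto_innerWave_sub_poi hμ mr hx.1 hx.2 (4 * Real.pi * Q)).mul_const (F x)
      rwa [zero_mul] at this
  have hpoi : Tendsto (fun v : ℝ => ∫ x : ℝ, p v x * F x) (𝓝[>] 0)
      (𝓝 (4 * Real.pi * Q * (a * (Real.pi * F μ') + c * (Real.pi * F (-μ'))))) := by
    have h := ((((tendsto_integral_poi F μ').comp tendsto_two_mul).const_mul a).add
      (((tendsto_integral_poi F (-μ')).comp tendsto_two_mul).const_mul c)).const_mul
        (4 * Real.pi * Q)
    refine h.congr' ?_
    filter_upwards [self_mem_nhdsWithin] with v hv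
    have hv2 : 0 < 2 * v := by simpa using hv
    have hi : ∀ y : ℝ, Integrable fun x : ℝ => (poi (2 * v) (x - y) : ℂ) * F x := fun y =>
      integrable_bounded_mul (by have := continuous_poi hv2; fun_prop)
        (fun x => norm_poi_le hv2 (x - y)) F
    simp only [Function.comp_def]
    rw [← integral_const_mul, ← integral_const_mul, ← integral_add ((hi _).const_mul _)
      ((hi _).const_mul _), ← integral_const_mul]
    refine integral_congr_ae (.of_forall fun x => ?_)
    simp only [hp]
    ring
  have hsum := hrem.add hpoi
  have e1 := P.chi_mul_norm_resP_sq hμ mr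
  have e2 := P.chi_mul_norm_resP_sq (μ := -μ') (m := -m') (by simpa using hμ) mr
  rw [P.norm_resP_neg hμ] at e2
  rw [← e1, ← e2, ← hQ, ← ha, ← hc]
  have hlim : (∫ _ : ℝ, (0 : ℂ)) + 4 * Real.pi * Q *
    (a * (Real.pi * F μ') + c * (Real.pi * F (-μ'))) =
      4 * (Real.pi : ℂ) ^ 2 * Q * a * F μ' + 4 * (Real.pi : ℂ) ^ 2 * Q * c * F (-μ') := by
    rw [integral_zero]; ring
  rw [hlim] at hsum
  refine hsum.congr' ?_
  filter_upwards [Ioc_mem_nhdsGT (by linarith : (0 : ℝ) < b.re / 8)] with v hv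
  have hv2 : 0 < 2 * v := by linarith [hv.1]
  obtain ⟨K, hK⟩ := P.exists_innerWave_bound hv.1 (by linarith [hv.2])
  have i1 : Integrable fun x => innerWave N b v x mr μ' m' * F x :=
    integrable_bounded_mul (hIc v hv.1 hv.2) (fun x => hK x mr μ' m') F
  have i2 : Integrable fun x => (innerWave N b v x mr μ' m' - p v x) * F x :=
    integrable_bounded_mul ((hIc v hv.1 hv.2).sub (hpc v hv.1)) (fun x => hC x v hv.1 hv.2) F
  have i3 : Integrable fun x => p v x * F x := by
    refine (i1.sub i2).congr (.of_forall fun x => ?_)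
    simp only [Pi.sub_apply]
    ring
  rw [← integral_add i2 i3]
  refine integral_congr_ae (.of_forall fun x => ?_)
  simp only
  ring

theorem innerPsi_eq (P : Param N b) {ε : ℝ} (hε : 0 < ε) (hε' : ε < b.re / Real.sqrt N) (μr : ℝ)
    (mr : ℤ) (μr' : ℝ)
    (mr' : ℤ) :
    innerPsi N b ε μr mr μr' mr' = innerWave N b (ε * Real.sqrt N) μr mr μr' mr' := by
  simp only [innerPsi, innerWave, P.psi_eq hε hε']

end Param

end QTeich

/-- The density is evaluated at the support of each delta, which is the meaning of `ρ(μ_r, m_r)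
δ(μ_r ∓ μ_{r'})`. Convergence of tempered distributions is tested on each Schwartz function. -/
theorem mainTheorem2 (N : ℕ) (hN : 0 < N) (b : ℂ) (hb : ‖b‖ = 1) (hre : 0 < b.re) (him : 0 < b.im)
    (mr : ℤ) (μr' : ℝ) (mr' : ℤ) (hr' : μr' ≠ 0 ∨ ¬ (N : ℤ) ∣ 2 * mr') :
    (∀ ε : ℝ, 0 < ε → ε < b.re / Real.sqrt N → ∀ (μr : ℝ) (m : ℤ),
      Integrable fun μ : ℝ =>
        conj (QTeich.psi N b ε μr mr μ m) * QTeich.psi N b ε μr' mr' μ m) ∧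
    ∃ T : ℝ → 𝓢'(ℝ, ℂ),
      (∀ ε : ℝ, 0 < ε → ε < b.re / Real.sqrt N → ∀ F : 𝓢(ℝ, ℂ),
        Integrable (fun μr : ℝ => QTeich.innerPsi N b ε μr mr μr' mr' * F μr) ∧
        T ε F = ∫ μr : ℝ, QTeich.innerPsi N b ε μr mr μr' mr' * F μr) ∧
      Tendsto T (𝓝[>] 0) (𝓝
        ((1 / 4 * QTeich.rho N b μr' mr * QTeich.kron N mr mr') • TemperedDistribution.delta μr' +
          (1 / 4 * QTeich.rho N b (-μr') mr * QTeich.kron N mr (-mr')) • TemperedDistribution.delta (-μr'))) := by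
  have P : QTeich.Param N b := ⟨hN, hb, hre, him⟩
  have hs := Real.sqrt_pos.mpr P.rpos
  have hpos : ∀ ε : ℝ, 0 < ε → 0 < ε * Real.sqrt N := fun ε hε => by positivity
  have hlt : ∀ ε : ℝ, ε < b.re / Real.sqrt N → ε * Real.sqrt N < b.re := fun ε hε => by
    rwa [lt_div_iff₀ hs] at hε
  refine ⟨fun ε hε hε' μr m => ?_, ?_⟩
  · simp only [P.psi_eq hε hε']
    exact P.integrable_conj_wave_mul_wave (hpos ε hε) (hlt ε hε') μr mr μr' mr' m
  · have hT : ∀ ε : ℝ, ∃ T : 𝓢'(ℝ, ℂ), 0 < ε → ε < b.re / Real.sqrt N → ∀ F : 𝓢(ℝ, ℂ),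
        Integrable (fun μr : ℝ => QTeich.innerPsi N b ε μr mr μr' mr' * F μr) ∧
        T F = ∫ μr : ℝ, QTeich.innerPsi N b ε μr mr μr' mr' * F μr := by
      intro ε
      by_cases h : 0 < ε ∧ ε < b.re / Real.sqrt N
      · simp only [P.innerPsi_eq h.1 h.2]
        have hc := P.continuous_innerWave (hpos ε h.1) (hlt ε h.2) mr μr' mr'
        obtain ⟨C, hC⟩ := P.exists_innerWave_bound (hpos ε h.1) (hlt ε h.2)
        obtain ⟨T, hT⟩ := QTeich.exists_temperedDistribution hc fun x => hC x mr μr' mr'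
        exact ⟨T, fun _ _ F => ⟨QTeich.integrable_bounded_mul hc (fun x => hC x mr μr' mr') F, hT
          F⟩⟩
      -- Outside the admissible range the distribution is set to zero; the limit `ε → 0⁺` does not
      -- see these values.
      · exact ⟨0, fun h1 h2 => absurd ⟨h1, h2⟩ h⟩
    choose T hT using hT
    refine ⟨T, hT, PointwiseConvergenceCLM.tendsto_iff_forall_tendsto.mpr fun F => ?_⟩
    have hscale : Tendsto (fun ε : ℝ => ε * Real.sqrt N) (𝓝[>] 0) (𝓝[>] 0) := by
      refine tendsto_nhdsWithin_iff.mpr ⟨?_, ?_⟩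
      · have : Continuous fun ε : ℝ => ε * Real.sqrt N := by fun_prop
        simpa using (this.tendsto 0).mono_left nhdsWithin_le_nhds
      · filter_upwards [self_mem_nhdsWithin] with ε hε
        exact hpos ε hε
    have h := (P.tendsto_integral_innerWave hr' mr F).comp hscale
    refine h.congr' ?_
    filter_upwards [Ioo_mem_nhdsGT (by positivity : 0 < b.re / Real.sqrt N)] with ε hε
    rw [(hT ε hε.1 hε.2 F).2]
    simp only [Function.comp_apply, P.innerPsi_eq hε.1 hε.2]
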